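/- Let $K$ be a field of characteristic zero, let $D\ge 1$, and let $J(D)$ be the free non-unital Jordan algebra over $K$ on $D$ generators $x_1,\dots,x_D$, on which $GL(D)=GL_D(K)$ acts by linear substitutions of the generators. For a Jordan algebra $J$ and $a,b\in J$ let $\partial_{a,b}(z)=a(zb)-(az)b$, and let $\mathrm{Inner}\,J$ be the linear span of the maps $\partial_{a,b}$; $GL(D)$ acts on $\mathrm{Inner}\,J(D)$ by conjugation. Let $\mathcal{B}J=\Lambda^2J/\langle a\wedge a^2 : a\in J\rangle$, write $\{\omega\}$ for the class of $\omega\in\Lambda^2J$ and $\partial_\omega=\sum_i\partial_{a_i,b_i}$ for $\omega=\sum_i a_i\wedge b_i$. The Tits–Allison–Gao Lie algebra of $J$ is $\mathfrak{sl}_2J=\mathcal{B}J\oplus(\mathfrak{sl}_2\otimes J)$ with, writing $x(a)=x\otimes a$, $$[x(a),y(b)]=[x,y](ab)+\kappa(x,y)\{a\wedge b\},\quad [\{\omega\},x(a)]=x(\partial_\omega a),\quad [\{\omega\},\{\omega'\}]=\partial_\omega.\{\omega'\},$$ where $\kappa(x,y)=\tfrac12\mathrm{Tr}(\mathrm{ad}\,x\circ\mathrm{ad}\,y)$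 and $\partial_\omega.\{a\wedge b\}=\{\partial_\omega a\wedge b\}+\{a\wedge\partial_\omega b\}$. The Lie algebra $\mathfrak{sl}_2$ acts on $\mathfrak{sl}_2J$ by the derivations $x.y(a)=[x,y](a)$, $x.\{\omega\}=0$, hence on the Lie algebra homology $H_k(\mathfrak{sl}_2J)$ with trivial coefficients $K$; let $H_k(\mathfrak{sl}_2J)^{\mathfrak{sl}_2}$ and $H_k(\mathfrak{sl}_2J)^{ad}$ be its invariants and its isotypic component of adjoint type. For $GL(D)$-modules $V=J(D)$ and $V=\mathrm{Inner}\,J(D)$ and $\mathbf{m}\in\mathbb{Z}_{\ge0}^D$ let $V_{\mathbf m}$ be the subspace on which each diagonal matrix $\mathrm{diag}(h_1,\dots,h_D)$ acts by $h_1^{m_1}\cdots h_D^{m_D}$, and let $[V]=\sum_{\mathbf m}\dim V_{\mathbf m}\,z_1^{m_1}\cdots z_D^{m_D}\in\mathbb{Z}[[z_1,\dots,z_D]]$. In $\mathbb{Z}[t,t^{-1}][[z_1,\dots,z_D]]$ put, for a series $a=\sum_{\mathbf{m}\neq 0,\,j}c_{\mathbf m,j}z^{\mathbf m}t^j$ without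 constant term, $$\lambda(a)=\prod_{\mathbf m\ne0,\,j}(1-z^{\mathbf m}t^j)^{c_{\mathbf m,j}}$$ (so that $\lambda$ of the character of a module $V$ is the character of $\sum_k(-1)^k\Lambda^kV$). Let $[L(2)]=t+1+t^{-1}$, and for $a=\sum_i c_i t^i$ with $c_i\in\mathbb{Z}[[z_1,\dots,z_D]]$ put $a:[L(0)]=c_0-c_{-1}$ and $a:[L(2)]=c_{-1}-c_{-2}$ (the multiplicities of the trivial and the adjoint representation of $PSL(2)$). There is a unique pair $A(D),B(D)$ of series in $\mathbb{Z}[[z_1,\dots,z_D]]$ without constant term such that $$\lambda(A(D)[L(2)]+B(D)):[L(0)]=1,\qquad \lambda(A(D)[L(2)]+B(D)):[L(2)]=-(z_1+\dots+z_D).$$ **Claim.** Assume that $H_k(\mathfrak{sl}_2J(D))^{\mathfrak{sl}_2}=0$ for all $k\ge1$ and $H_k(\mathfrak{sl}_2J(D))^{ad}=0$ for all $k\ge2$. Then all the spaces $J(D)_{\mathbf m}$ and $(\mathrm{Inner}\,J(D))_{\mathbf m}$ are finite dimensional, and $$[J(D)]=A(D)\qquad\text{and}\qquad[\mathrm{Inner}\,J(D)]=B(D).$$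 -/

import Mathlib

open scoped TensorProduct

set_option linter.unusedSectionVars false
set_option linter.unusedSimpArgs false

noncomputable section

namespace FreeJordan

universe u v

/-! ### Jordan algebras: the maps `∂_{a,b}`, inner derivations, the space `𝓑J` -/

section Jordan

variable (K : Type u) [Field K] [CharZero K]
variable (J : Type v) [NonUnitalNonAssocCommRing J] [Module K J] [IsScalarTower K J J]
  [SMulCommClass K J J]

/-- The bilinear map `(a, b) ↦ ∂_{a,b}`, where `∂_{a,b} z = a (z b) - (a z) b`. -/
def partialMap : J →ₗ[K] J →ₗ[K] Module.End K J :=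
  LinearMap.mk₂ K
    (fun a b => LinearMap.mulLeft K a ∘ₗ LinearMap.mulRight K b
      - LinearMap.mulRight K b ∘ₗ LinearMap.mulLeft K a)
    (fun a a' b => by ext z; simp [add_mul]; abel)
    (fun c a b => by ext z; simp [smul_sub, smul_mul_assoc])
    (fun a b b' => by ext z; simp [mul_add]; abel)
    (fun c a b => by ext z; simp [smul_sub, mul_smul_comm])

@[simp] theorem partialMap_apply (a b z : J) :
    partialMap K J a b z = a * (z * b) - (a * z) * b := by
  simp [partialMap]

/-- `Inner J`: the linear span of the maps `∂_{a,b}`. -/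
def Inner : Submodule K (Module.End K J) :=
  Submodule.span K {δ | ∃ a b : J, δ = partialMap K J a b}

variable {K J} in
theorem partialMap_self (a : J) : partialMap K J a a = 0 := by
  ext z
  simp [mul_comm]

/-- A bilinear map vanishing on the diagonal, as a linear map on `Λ²J`. -/
def wedgeLift {M : Type*} [AddCommGroup M] [Module K M] (B : J →ₗ[K] J →ₗ[K] M)
    (hB : ∀ a, B a a = 0) : (⋀[K]^2 J) →ₗ[K] M :=
  exteriorPower.alternatingMapLinearEquiv
    { toFun := fun v => B (v 0) (v 1)
      map_update_add' := by
        intro _ v i x y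
        fin_cases i <;> simp [Function.update]
      map_update_smul' := by
        intro _ v i c x
        fin_cases i <;> simp [Function.update]
      map_eq_zero_of_eq' := by
        intro v i j h hij
        fin_cases i <;> fin_cases j <;> simp_all }

variable {J}

/-- `a ∧ b` in `Λ²J`. -/
def wedge (a b : J) : ⋀[K]^2 J := exteriorPower.ιMulti K 2 ![a, b]

@[simp] theorem wedgeLift_wedge {M : Type*} [AddCommGroup M] [Module K M]
    (B : J →ₗ[K] J →ₗ[K] M) (hB : ∀ a, B a a = 0) (a b : J) :
    wedgeLift K J B hB (wedge K a b) = B a b := by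
  simp [wedgeLift, wedge]

theorem wedge_hom_ext {M : Type*} [AddCommGroup M] [Module K M] {f g : (⋀[K]^2 J) →ₗ[K] M}
    (h : ∀ a b, f (wedge K a b) = g (wedge K a b)) : f = g := by
  apply exteriorPower.linearMap_ext
  ext v
  have : v = ![v 0, v 1] := by ext i; fin_cases i <;> rfl
  have h' := h (v 0) (v 1)
  rw [this]
  simpa [wedge] using h'

theorem update_zero (a b x : J) : Function.update ![a, b] 0 x = ![x, b] := by
  ext i; fin_cases i <;> simp

theorem update_one (a b x : J) : Function.update ![a, b] 1 x = ![a, x] := by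
  ext i; fin_cases i <;> simp

variable (J) in
/-- The universal alternating map `(a, b) ↦ a ∧ b`, as a bilinear map. -/
def wedgeMap : J →ₗ[K] J →ₗ[K] ⋀[K]^2 J :=
  LinearMap.mk₂ K (wedge K)
    (fun a a' b => by
      have := (exteriorPower.ιMulti K 2).map_update_add ![a, b] 0 a a'
      rwa [update_zero, update_zero, update_zero] at this)
    (fun c a b => by
      have := (exteriorPower.ιMulti K 2).map_update_smul ![a, b] 0 c a
      rwa [update_zero, update_zero] at this)
    (fun a b b' => by
      have := (exteriorPower.ιMulti K 2).map_update_add ![a, b] 1 b b'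
      rwa [update_one, update_one, update_one] at this)
    (fun c a b => by
      have := (exteriorPower.ιMulti K 2).map_update_smul ![a, b] 1 c b
      rwa [update_one, update_one] at this)

@[simp] theorem wedgeMap_apply (a b : J) : wedgeMap K J a b = wedge K a b := rfl

theorem wedge_self (a : J) : wedge K a a = 0 :=
  (exteriorPower.ιMulti K 2).map_eq_zero_of_eq ![a, a] (i := 0) (j := 1) rfl (by decide)

variable (J)

/-- `R(J) ⊆ Λ²J`: the linear span of all `a ∧ a²`. -/
def relR : Submodule K (⋀[K]^2 J) := Submodule.span K (Set.range fun a : J => wedge K a (a * a))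

/-- `𝓑J = Λ²J / R(J)`. -/
abbrev BSpace : Type _ := (⋀[K]^2 J) ⧸ relR K J

/-- `(a, b) ↦ {a ∧ b} ∈ 𝓑J`. -/
def brace : J →ₗ[K] J →ₗ[K] BSpace K J := (wedgeMap K J).compr₂ (relR K J).mkQ

variable {J}

theorem brace_self (a : J) : brace K J a a = 0 := by
  simp [brace, wedge_self]

theorem brace_sq (a : J) : brace K J a (a * a) = 0 := by
  simp only [brace, LinearMap.compr₂_apply, wedgeMap_apply, Submodule.mkQ_apply,
    Submodule.Quotient.mk_eq_zero]
  exact Submodule.subset_span ⟨a, rfl⟩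

theorem brace_swap (a b : J) : brace K J b a = - brace K J a b := by
  have h := brace_self K (a + b)
  simp only [map_add, LinearMap.add_apply, brace_self, zero_add, add_zero] at h
  exact eq_neg_of_add_eq_zero_right (by rw [← h]; abel)

/-- A bilinear map with `B(a,a) = 0` and `B(a,a²) = 0`, as a linear map on `𝓑J`. -/
def BSpace.lift {M : Type*} [AddCommGroup M] [Module K M] (B : J →ₗ[K] J →ₗ[K] M)
    (hB : ∀ a, B a a = 0) (hB' : ∀ a, B a (a * a) = 0) : BSpace K J →ₗ[K] M :=
  (relR K J).liftQ (wedgeLift K J B hB) (by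
    rw [relR, Submodule.span_le]
    rintro _ ⟨a, rfl⟩
    simp [hB'])

@[simp] theorem BSpace.lift_brace {M : Type*} [AddCommGroup M] [Module K M]
    (B : J →ₗ[K] J →ₗ[K] M) (hB : ∀ a, B a a = 0) (hB' : ∀ a, B a (a * a) = 0) (a b : J) :
    BSpace.lift K B hB hB' (brace K J a b) = B a b := by
  simp [BSpace.lift, brace]

theorem BSpace.hom_ext {M : Type*} [AddCommGroup M] [Module K M] {f g : BSpace K J →ₗ[K] M}
    (h : ∀ a b, f (brace K J a b) = g (brace K J a b)) : f = g := by
  apply Submodule.linearMap_qext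
  apply wedge_hom_ext
  intro a b
  exact h a b

theorem brace_cyclic (a b c : J) :
    brace K J a (b * c) + brace K J b (c * a) + brace K J c (a * b) = 0 := by
  have key : ∀ x y : J, brace K J y (x * x) + (2 : K) • brace K J x (x * y) = 0 := by
    intro x y
    have h1 := brace_sq K (x + y)
    have h2 := brace_sq K (x - y)
    have hx := brace_sq K x
    have hy := brace_sq K y
    simp only [mul_add, add_mul, mul_sub, sub_mul, map_add, map_sub, LinearMap.add_apply,
      LinearMap.sub_apply, mul_comm y x, hx, hy] at h1 h2
    have : (2 : K) • (brace K J y (x * x) + (2 : K) • brace K J x (x * y)) = 0 := by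
      rw [← sub_eq_zero.mpr (h1.trans h2.symm)]
      module
    exact (smul_eq_zero.mp this).resolve_left two_ne_zero
  have h1 := key (b + c) a
  have h2 := key b a
  have h3 := key c a
  have : (2 : K) • (brace K J a (b * c) + brace K J b (c * a) + brace K J c (a * b)) =
      (brace K J a ((b + c) * (b + c)) + (2 : K) • brace K J (b + c) ((b + c) * a))
      - (brace K J a (b * b) + (2 : K) • brace K J b (b * a))
      - (brace K J a (c * c) + (2 : K) • brace K J c (c * a)) := by
    simp only [mul_add, add_mul, map_add, LinearMap.add_apply, mul_comm c b, mul_comm a b]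
    module
  rw [h1, h2, h3, sub_zero, sub_zero] at this
  exact (smul_eq_zero.mp this).resolve_left two_ne_zero

variable [IsCommJordan J]

theorem partialMap_sq (a : J) : partialMap K J a (a * a) = 0 := by
  ext z
  simp [← IsCommJordan.lmul_comm_rmul_rmul]

variable (J) in
/-- The map `{ω} ↦ ∂_ω` from `𝓑J` to the endomorphisms of `J`. -/
def bPartial : BSpace K J →ₗ[K] Module.End K J :=
  BSpace.lift K (partialMap K J) partialMap_self (partialMap_sq K)

@[simp] theorem bPartial_brace (a b : J) :
    bPartial K J (brace K J a b) = partialMap K J a b := by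
  simp [bPartial]

theorem jordan_lin (K : Type u) [Field K] [CharZero K] {J : Type v}
    [NonUnitalNonAssocCommRing J] [Module K J] [IsCommJordan J] (p q r z : J) :
    (p * ((q * r) * z) - (q * r) * (p * z)) + (q * ((r * p) * z) - (r * p) * (q * z))
      + (r * ((p * q) * z) - (p * q) * (r * z)) = 0 := by
  have h := congrArg (fun f => f z) (two_nsmul_lie_lmul_lmul_add_add_eq_zero p q r)
  have h2 : (2 : K) • ((p * ((q * r) * z) - (q * r) * (p * z))
      + (q * ((r * p) * z) - (r * p) * (q * z))
      + (r * ((p * q) * z) - (p * q) * (r * z))) = 0 := by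
    rw [ofNat_smul_eq_nsmul K 2]
    exact h
  exact (smul_eq_zero.mp h2).resolve_left two_ne_zero

theorem partialMap_leibniz (a b x y : J) :
    partialMap K J a b (x * y) = partialMap K J a b x * y + x * partialMap K J a b y := by
  have h1 := jordan_lin K a x y b
  have h2 := jordan_lin K b x y a
  rw [← sub_eq_zero]
  have h3 := sub_eq_zero.mpr (h1.trans h2.symm)
  rw [← h3]
  simp only [partialMap_apply, mul_sub, mul_comm]
  abel

theorem bPartial_leibniz (ω : BSpace K J) (x y : J) :
    bPartial K J ω (x * y) = bPartial K J ω x * y + x * bPartial K J ω y := by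
  have : (bPartial K J).flip (x * y)
      = LinearMap.mulRight K y ∘ₗ (bPartial K J).flip x
        + LinearMap.mulLeft K x ∘ₗ (bPartial K J).flip y := by
    apply BSpace.hom_ext
    intro a b
    simpa using partialMap_leibniz K a b x y
  exact congrArg (fun f => f ω) this

/-- A derivation `δ` of `J` acts on `𝓑J` by `δ {a ∧ b} = {δ a ∧ b} + {a ∧ δ b}`. -/
def derAct (δ : Module.End K J) (hδ : ∀ x y, δ (x * y) = δ x * y + x * δ y) :
    Module.End K (BSpace K J) :=
  BSpace.lift K ((brace K J).comp δ + (brace K J).compl₂ δ)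
    (fun a => by simp [brace_swap K a (δ a)])
    (fun a => by
      have := brace_cyclic K a a (δ a)
      simp only [LinearMap.add_apply, LinearMap.comp_apply, LinearMap.compl₂_apply, hδ, map_add]
      rw [← this]
      abel)

@[simp] theorem derAct_brace (δ : Module.End K J) (hδ) (a b : J) :
    derAct K δ hδ (brace K J a b) = brace K J (δ a) b + brace K J a (δ b) := by
  simp [derAct]

variable (J) in
/-- `(ω, ω') ↦ ∂_ω . {ω'}` on `𝓑J`. -/
def bAct : BSpace K J →ₗ[K] Module.End K (BSpace K J) where
  toFun ω := derAct K (bPartial K J ω) (bPartial_leibniz K ω)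
  map_add' ω ω' := by
    apply BSpace.hom_ext
    intro a b
    simp
    abel
  map_smul' c ω := by
    apply BSpace.hom_ext
    intro a b
    simp

@[simp] theorem bAct_brace (ω : BSpace K J) (a b : J) :
    bAct K J ω (brace K J a b)
      = brace K J (bPartial K J ω a) b + brace K J a (bPartial K J ω b) := by
  simp [bAct]

theorem bAct_skew (ω ω' : BSpace K J) : bAct K J ω ω' = - bAct K J ω' ω := by
  have : bAct K J = - (bAct K J).flip := by
    apply BSpace.hom_ext
    intro a b
    apply BSpace.hom_ext
    intro c d
    have h1 := brace_cyclic K (b * c) a d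
    have h2 := brace_cyclic K (a * c) b d
    have h3 := brace_cyclic K (b * d) a c
    have h4 := brace_cyclic K (a * d) b c
    simp only [LinearMap.neg_apply, LinearMap.flip_apply, bAct_brace, bPartial_brace,
      partialMap_apply]
    have e := congrArg₂ (· - ·) (congrArg₂ (· + ·) h2 h3) (congrArg₂ (· + ·) h1 h4)
    simp only [add_zero, sub_zero] at e
    rw [← sub_eq_zero, ← e]
    simp only [mul_comm c b, mul_comm c a, mul_comm d b, mul_comm (b * c) a,
      mul_comm (a * c) b, mul_comm (b * d) a, mul_comm (a * d) b, mul_comm (a * c) d,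
      mul_comm (b * c) d, map_sub, LinearMap.sub_apply, brace_swap K d (a * (b * c)),
      brace_swap K d (b * (a * c)), brace_swap K b (c * (a * d)), brace_swap K b (d * (a * c)),
      brace_swap K (b * c) (a * d), brace_swap K (a * c) (b * d)]
    abel
  exact congrArg (fun f => f ω ω') this

theorem bPartial_bAct (ω ω' : BSpace K J) :
    bPartial K J (bAct K J ω ω')
      = bPartial K J ω ∘ₗ bPartial K J ω' - bPartial K J ω' ∘ₗ bPartial K J ω := by
  have : bPartial K J ∘ₗ bAct K J ω
      = LinearMap.llcomp K J J J (bPartial K J ω) ∘ₗ bPartial K J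
        - (LinearMap.llcomp K J J J).flip (bPartial K J ω) ∘ₗ bPartial K J := by
    apply BSpace.hom_ext
    intro a b
    ext z
    have := bPartial_leibniz K ω
    simp [this, mul_add, add_mul]
    abel
  exact congrArg (fun f => f ω') this

theorem bAct_bAct (ω ω' ω'' : BSpace K J) :
    bAct K J (bAct K J ω ω') ω''
      = bAct K J ω (bAct K J ω' ω'') - bAct K J ω' (bAct K J ω ω'') := by
  have : bAct K J (bAct K J ω ω')
      = bAct K J ω ∘ₗ bAct K J ω' - bAct K J ω' ∘ₗ bAct K J ω := by
    apply BSpace.hom_ext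
    intro a b
    simp [bPartial_bAct]
    abel
  exact congrArg (fun f => f ω'') this

end Jordan

/-! ### The Lie algebra `sl₂` and the form `κ` -/

section Sl2
variable (K : Type u) [Field K] [CharZero K]

/-- The Lie algebra `sl₂` over `K`. -/
abbrev Sl2 : Type u := LieAlgebra.SpecialLinear.sl (Fin 2) K

theorem mem_sl2 (x : Matrix (Fin 2) (Fin 2) K) :
    x ∈ LieAlgebra.SpecialLinear.sl (Fin 2) K ↔ x.trace = 0 := LinearMap.mem_ker

/-- `κ(x, y) = ½ Tr (ad x ∘ ad y)`, the invariant form on `sl₂` with `κ(h, h) = 4`. -/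
def kappa : Sl2 K →ₗ[K] Sl2 K →ₗ[K] K := (2⁻¹ : K) • killingForm K (Sl2 K)

/-- Coordinates on `sl₂`. -/
def sl2Equiv : Sl2 K ≃ₗ[K] (Fin 3 → K) where
  toFun x := ![x.1 0 0, x.1 0 1, x.1 1 0]
  map_add' x y := by ext i; fin_cases i <;> simp
  map_smul' c y := by ext i; fin_cases i <;> simp
  invFun v := ⟨!![v 0, v 1; v 2, - v 0], by
    rw [mem_sl2]; simp [Matrix.trace_fin_two]⟩
  left_inv x := by
    have h := x.2
    rw [mem_sl2, Matrix.trace_fin_two] at h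
    ext i j
    fin_cases i <;> fin_cases j <;> simp
    linear_combination -h
  right_inv v := by ext i; fin_cases i <;> simp

theorem sl2_one_one (x : Sl2 K) : x.1 1 1 = - x.1 0 0 := by
    have h := x.2
    rw [mem_sl2, Matrix.trace_fin_two] at h
    linear_combination h

theorem kappa_apply (x y : Sl2 K) :
    kappa K x y = 4 * x.1 0 0 * y.1 0 0 + 2 * x.1 0 1 * y.1 1 0 + 2 * x.1 1 0 * y.1 0 1 := by
  have hx := sl2_one_one K x
  have hy := sl2_one_one K y
  simp only [kappa, LinearMap.smul_apply, killingForm_apply_apply]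
  rw [LinearMap.trace_eq_matrix_trace K (Module.Basis.ofEquivFun (sl2Equiv K))]
  simp [Matrix.vecMul, dotProduct, Matrix.trace, Fin.sum_univ_three, LinearMap.toMatrix_apply, sl2Equiv, Ring.lie_def,
    Matrix.mul_apply, Fin.sum_univ_two, Matrix.sub_apply, hx, hy]
  field_simp
  ring

theorem kappa_comm (x y : Sl2 K) : kappa K x y = kappa K y x := by
  simp only [kappa_apply]; ring

theorem lie_lie_sl2 (x y z : Sl2 K) :
    ⁅x, ⁅y, z⁆⁆ = kappa K x y • z - kappa K x z • y := by
  have hx := sl2_one_one K x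
  have hy := sl2_one_one K y
  have hz := sl2_one_one K z
  simp only [kappa_apply]
  ext i j
  fin_cases i <;> fin_cases j <;>
  simp [Ring.lie_def, Matrix.mul_apply, Fin.sum_univ_two, Matrix.sub_apply, hx, hy, hz] <;> ring

theorem kappa_lie (x y z : Sl2 K) : kappa K ⁅x, y⁆ z = - kappa K y ⁅x, z⁆ := by
  have hx := sl2_one_one K x
  have hy := sl2_one_one K y
  have hz := sl2_one_one K z
  simp only [kappa_apply]
  simp [Ring.lie_def, Matrix.mul_apply, Fin.sum_univ_two, Matrix.sub_apply, hx, hy, hz]; ring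
end Sl2

/-! ### The Tits–Allison–Gao Lie algebra `sl₂ J = 𝓑J ⊕ sl₂ ⊗ J` -/

section TAG

variable (K : Type u) [Field K] [CharZero K]
variable (J : Type v) [NonUnitalNonAssocCommRing J] [Module K J] [IsScalarTower K J J]
  [SMulCommClass K J J] [IsCommJordan J]

/-- The vector space `TAG(J) = 𝓑J ⊕ sl₂ ⊗ J`. -/
def TAG : Type (max u v) := BSpace K J × (Sl2 K ⊗[K] J)

instance : AddCommGroup (TAG K J) := inferInstanceAs (AddCommGroup (BSpace K J × (Sl2 K ⊗[K] J)))
instance : Module K (TAG K J) := inferInstanceAs (Module K (BSpace K J × (Sl2 K ⊗[K] J)))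

/-- `(x(a), y(b)) ↦ κ(x, y) {a ∧ b}`. -/
def tagPsi : (Sl2 K ⊗[K] J) →ₗ[K] (Sl2 K ⊗[K] J) →ₗ[K] BSpace K J :=
  (TensorProduct.map₂ (kappa K) (brace K J)).compr₂ (TensorProduct.lid K (BSpace K J)).toLinearMap

/-- `(x(a), y(b)) ↦ [x, y](a b)`. -/
def tagPhi : (Sl2 K ⊗[K] J) →ₗ[K] (Sl2 K ⊗[K] J) →ₗ[K] (Sl2 K ⊗[K] J) :=
  TensorProduct.map₂ 
    (LinearMap.mk₂ K (fun x y : Sl2 K => ⁅x, y⁆) add_lie smul_lie lie_add (fun c x y => lie_smul c x y))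
    (LinearMap.mul K J)

/-- `({ω}, x(a)) ↦ x(∂_ω a)`. -/
def tagAct : BSpace K J →ₗ[K] Module.End K (Sl2 K ⊗[K] J) :=
  LinearMap.lTensorHom (Sl2 K) ∘ₗ bPartial K J

variable {J}

@[simp] theorem tagPsi_tmul (x y : Sl2 K) (a b : J) :
    tagPsi K J (x ⊗ₜ a) (y ⊗ₜ b) = kappa K x y • brace K J a b := by
  simp [tagPsi]

@[simp] theorem tagPhi_tmul (x y : Sl2 K) (a b : J) :
    tagPhi K J (x ⊗ₜ a) (y ⊗ₜ b) = ⁅x, y⁆ ⊗ₜ (a * b) := by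
  simp [tagPhi]

@[simp] theorem tagAct_tmul (ω : BSpace K J) (x : Sl2 K) (a : J) :
    tagAct K J ω (x ⊗ₜ a) = x ⊗ₜ bPartial K J ω a := by
  simp [tagAct]

theorem tagPsi_skew (X Y : Sl2 K ⊗[K] J) : tagPsi K J X Y = - tagPsi K J Y X := by
  induction X with
  | zero => simp
  | add _ _ h h' => simp only [map_add, LinearMap.add_apply, h, h']; abel
  | tmul x a =>
    induction Y with
    | zero => simp
    | add _ _ h h' => simp only [map_add, LinearMap.add_apply, h, h']; abel
    | tmul y b => simp [kappa_comm K y x, brace_swap K a b]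

theorem tagPhi_skew (X Y : Sl2 K ⊗[K] J) : tagPhi K J X Y = - tagPhi K J Y X := by
  induction X with
  | zero => simp
  | add _ _ h h' => simp only [map_add, LinearMap.add_apply, h, h']; abel
  | tmul x a =>
    induction Y with
    | zero => simp
    | add _ _ h h' => simp only [map_add, LinearMap.add_apply, h, h']; abel
    | tmul y b => rw [tagPhi_tmul, tagPhi_tmul, ← lie_skew, mul_comm, TensorProduct.neg_tmul]

theorem bAct_tagPsi (ω : BSpace K J) (X Y : Sl2 K ⊗[K] J) :
    bAct K J ω (tagPsi K J X Y)
      = tagPsi K J (tagAct K J ω X) Y + tagPsi K J X (tagAct K J ω Y) := by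
  induction X with
  | zero => simp
  | add _ _ h h' => simp only [map_add, LinearMap.add_apply, h, h']; abel
  | tmul x a =>
    induction Y with
    | zero => simp
    | add _ _ h h' => simp only [map_add, LinearMap.add_apply, h, h']; abel
    | tmul y b => simp

theorem tagAct_tagPhi (ω : BSpace K J) (X Y : Sl2 K ⊗[K] J) :
    tagAct K J ω (tagPhi K J X Y)
      = tagPhi K J (tagAct K J ω X) Y + tagPhi K J X (tagAct K J ω Y) := by
  induction X with
  | zero => simp
  | add _ _ h h' => simp only [map_add, LinearMap.add_apply, h, h']; abel
  | tmul x a =>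
    induction Y with
    | zero => simp
    | add _ _ h h' => simp only [map_add, LinearMap.add_apply, h, h']; abel
    | tmul y b => simp [bPartial_leibniz, TensorProduct.tmul_add]

theorem tagAct_bAct (ω ω' : BSpace K J) (X : Sl2 K ⊗[K] J) :
    tagAct K J (bAct K J ω ω') X
      = tagAct K J ω (tagAct K J ω' X) - tagAct K J ω' (tagAct K J ω X) := by
  induction X with
  | zero => simp
  | add _ _ h h' => simp only [map_add, h, h']; abel
  | tmul x a => simp [bPartial_bAct, TensorProduct.tmul_sub]

theorem tagPsi_tagPhi (X Y Z : Sl2 K ⊗[K] J) :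
    tagPsi K J X (tagPhi K J Y Z)
      = tagPsi K J (tagPhi K J X Y) Z + tagPsi K J Y (tagPhi K J X Z) := by
  induction X with
  | zero => simp
  | add _ _ h h' => simp only [map_add, LinearMap.add_apply, h, h']; abel
  | tmul x a =>
    induction Y with
    | zero => simp
    | add _ _ h h' => simp only [map_add, LinearMap.add_apply, h, h']; abel
    | tmul y b =>
      induction Z with
      | zero => simp
      | add _ _ h h' => simp only [map_add, LinearMap.add_apply, h, h']; abel
      | tmul z c =>
        have h := congrArg (fun w => kappa K ⁅x, y⁆ z • w) (brace_cyclic K a b c)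
        have h1 : kappa K x ⁅y, z⁆ = kappa K ⁅x, y⁆ z := by
          rw [← lie_skew x y, map_neg, LinearMap.neg_apply, kappa_lie]; simp
        have h2 : kappa K y ⁅x, z⁆ = - kappa K ⁅x, y⁆ z := by
          rw [kappa_lie]; simp
        simp only [tagPsi_tmul, tagPhi_tmul, h1, h2, brace_swap K c (a * b), mul_comm a c]
        rw [← sub_eq_zero]
        simp only [smul_zero] at h
        rw [← h]
        module

theorem tagPhi_tagPhi (X Y Z : Sl2 K ⊗[K] J) :
    tagPhi K J X (tagPhi K J Y Z) - tagAct K J (tagPsi K J Y Z) X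
      = tagPhi K J (tagPhi K J X Y) Z + tagPhi K J Y (tagPhi K J X Z)
        + tagAct K J (tagPsi K J X Y) Z - tagAct K J (tagPsi K J X Z) Y := by
  induction X with
  | zero => simp
  | add _ _ h h' =>
    simp only [map_add, LinearMap.add_apply]
    rw [add_sub_add_comm, h, h']; abel
  | tmul x a =>
    induction Y with
    | zero => simp
    | add _ _ h h' =>
      simp only [map_add, LinearMap.add_apply]
      rw [add_sub_add_comm, h, h']; abel
    | tmul y b =>
      induction Z with
      | zero => simp
      | add _ _ h h' =>
        simp only [map_add, LinearMap.add_apply]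
        rw [add_sub_add_comm, h, h']; abel
      | tmul z c =>
        have h1 : ⁅⁅x, y⁆, z⁆ = kappa K y z • x - kappa K x z • y := by
          rw [← lie_skew, lie_lie_sl2, kappa_comm K z x, kappa_comm K z y]; abel
        simp only [tagPsi_tmul, tagPhi_tmul, tagAct_tmul, map_smul, LinearMap.smul_apply,
          bPartial_brace, partialMap_apply, h1, lie_lie_sl2, kappa_comm K y x,
          TensorProduct.tmul_sub, TensorProduct.sub_tmul, ← TensorProduct.smul_tmul', mul_comm]
        module

variable (J)

/-- The bracket of `TAG(J)`:
`[x(a), y(b)] = [x, y](a b) + κ(x, y) {a ∧ b}`, `[{ω}, x(a)] = x(∂_ω a)`,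
`[{ω}, {ω'}] = ∂_ω . {ω'}`. -/
instance : LieRing (TAG K J) where
  bracket p q :=
    (bAct K J p.1 q.1 + tagPsi K J p.2 q.2,
      tagAct K J p.1 q.2 - tagAct K J q.1 p.2 + tagPhi K J p.2 q.2)
  add_lie p q r := by
    refine Prod.ext ?_ ?_
    · change bAct K J (p.1 + q.1) r.1 + tagPsi K J (p.2 + q.2) r.2
        = (bAct K J p.1 r.1 + tagPsi K J p.2 r.2) + (bAct K J q.1 r.1 + tagPsi K J q.2 r.2)
      simp only [map_add, LinearMap.add_apply]; abel
    · change tagAct K J (p.1 + q.1) r.2 - tagAct K J r.1 (p.2 + q.2) + tagPhi K J (p.2 + q.2) r.2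
        = (tagAct K J p.1 r.2 - tagAct K J r.1 p.2 + tagPhi K J p.2 r.2)
          + (tagAct K J q.1 r.2 - tagAct K J r.1 q.2 + tagPhi K J q.2 r.2)
      simp only [map_add, LinearMap.add_apply]; abel
  lie_add p q r := by
    refine Prod.ext ?_ ?_
    · change bAct K J p.1 (q.1 + r.1) + tagPsi K J p.2 (q.2 + r.2)
        = (bAct K J p.1 q.1 + tagPsi K J p.2 q.2) + (bAct K J p.1 r.1 + tagPsi K J p.2 r.2)
      simp only [map_add]; abel
    · change tagAct K J p.1 (q.2 + r.2) - tagAct K J (q.1 + r.1) p.2 + tagPhi K J p.2 (q.2 + r.2)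
        = (tagAct K J p.1 q.2 - tagAct K J q.1 p.2 + tagPhi K J p.2 q.2)
          + (tagAct K J p.1 r.2 - tagAct K J r.1 p.2 + tagPhi K J p.2 r.2)
      simp only [map_add, LinearMap.add_apply]; abel
  lie_self p := by
    have key : ∀ {M : Type (max u v)} [AddCommGroup M] [Module K M] (m : M), m = - m → m = 0 := by
      intro M _ _ m hm
      have : (2 : K) • m = 0 := by rw [two_smul]; nth_rewrite 1 [hm]; simp
      exact (smul_eq_zero.mp this).resolve_left two_ne_zero
    have key' : ∀ m : BSpace K J, m = - m → m = 0 := by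
      intro m hm
      have : (2 : K) • m = 0 := by rw [two_smul]; nth_rewrite 1 [hm]; simp
      exact (smul_eq_zero.mp this).resolve_left two_ne_zero
    refine Prod.ext ?_ ?_
    · change bAct K J p.1 p.1 + tagPsi K J p.2 p.2 = 0
      rw [key' _ (bAct_skew K p.1 p.1), key' _ (tagPsi_skew K p.2 p.2), add_zero]
    · change tagAct K J p.1 p.2 - tagAct K J p.1 p.2 + tagPhi K J p.2 p.2 = 0
      rw [key _ (tagPhi_skew K p.2 p.2), sub_self, add_zero]
  leibniz_lie p q r := by
    obtain ⟨α, X⟩ := p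
    obtain ⟨β, Y⟩ := q
    obtain ⟨γ, Z⟩ := r
    refine Prod.ext ?_ ?_
    · change bAct K J α (bAct K J β γ + tagPsi K J Y Z)
          + tagPsi K J X (tagAct K J β Z - tagAct K J γ Y + tagPhi K J Y Z)
        = (bAct K J (bAct K J α β + tagPsi K J X Y) γ
            + tagPsi K J (tagAct K J α Y - tagAct K J β X + tagPhi K J X Y) Z)
          + (bAct K J β (bAct K J α γ + tagPsi K J X Z)
            + tagPsi K J Y (tagAct K J α Z - tagAct K J γ X + tagPhi K J X Z))
      simp only [map_add, map_sub, LinearMap.add_apply, LinearMap.sub_apply, bAct_bAct,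
        bAct_skew K (tagPsi K J X Y) γ, bAct_tagPsi, tagPsi_tagPhi K X Y Z,
        tagPsi_skew K Y (tagAct K J γ X)]
      abel
    · change tagAct K J α (tagAct K J β Z - tagAct K J γ Y + tagPhi K J Y Z)
          - tagAct K J (bAct K J β γ + tagPsi K J Y Z) X
          + tagPhi K J X (tagAct K J β Z - tagAct K J γ Y + tagPhi K J Y Z)
        = (tagAct K J (bAct K J α β + tagPsi K J X Y) Z
            - tagAct K J γ (tagAct K J α Y - tagAct K J β X + tagPhi K J X Y)
            + tagPhi K J (tagAct K J α Y - tagAct K J β X + tagPhi K J X Y) Z)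
          + (tagAct K J β (tagAct K J α Z - tagAct K J γ X + tagPhi K J X Z)
            - tagAct K J (bAct K J α γ + tagPsi K J X Z) Y
            + tagPhi K J Y (tagAct K J α Z - tagAct K J γ X + tagPhi K J X Z))
      have h := tagPhi_tagPhi K X Y Z
      rw [sub_eq_iff_eq_add] at h
      simp only [map_add, map_sub, LinearMap.add_apply, LinearMap.sub_apply, h,
        tagAct_bAct, tagAct_tagPhi, tagPhi_skew K Y (tagAct K J γ X)]
      abel

instance : LieAlgebra K (TAG K J) where
  lie_smul c p q := by
    refine Prod.ext ?_ ?_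
    · change bAct K J p.1 (c • q.1) + tagPsi K J p.2 (c • q.2)
        = c • (bAct K J p.1 q.1 + tagPsi K J p.2 q.2)
      simp
    · change tagAct K J p.1 (c • q.2) - tagAct K J (c • q.1) p.2 + tagPhi K J p.2 (c • q.2)
        = c • (tagAct K J p.1 q.2 - tagAct K J q.1 p.2 + tagPhi K J p.2 q.2)
      simp [smul_sub]

/-- The action of `x ∈ sl₂` on `TAG(J)` by a derivation: `x . y(a) = [x, y](a)`, `x . {ω} = 0`. -/
def sl2Der (x : Sl2 K) : LieDerivation K (TAG K J) (TAG K J) where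
  toFun p := (0, LinearMap.rTensor J (LieModule.toEnd K (Sl2 K) (Sl2 K) x) p.2)
  map_add' p q := Prod.ext (add_zero 0).symm (map_add _ p.2 q.2)
  map_smul' c p := Prod.ext (smul_zero c).symm (map_smul _ c p.2)
  leibniz' p q := by
    obtain ⟨α, X⟩ := p
    obtain ⟨β, Y⟩ := q
    set δ := LinearMap.rTensor J (LieModule.toEnd K (Sl2 K) (Sl2 K) x) with hδ
    have h1 : ∀ ω Z, δ (tagAct K J ω Z) = tagAct K J ω (δ Z) := by
      intro ω Z
      induction Z with
      | zero => simp
      | add _ _ h h' => simp only [map_add, h, h']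
      | tmul z c => simp [hδ]
    have h2 : ∀ Z W, tagPsi K J (δ Z) W + tagPsi K J Z (δ W) = 0 := by
      intro Z W
      induction Z with
      | zero => simp
      | add _ _ h h' =>
        simp only [map_add, LinearMap.add_apply]
        rw [add_add_add_comm, h, h', add_zero]
      | tmul z c =>
        induction W with
        | zero => simp
        | add _ _ h h' =>
          simp only [map_add]
          rw [add_add_add_comm, h, h', add_zero]
        | tmul w d => simp [hδ, kappa_lie]
    have h3 : ∀ Z W, δ (tagPhi K J Z W) = tagPhi K J (δ Z) W + tagPhi K J Z (δ W) := by
      intro Z W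
      induction Z with
      | zero => simp
      | add _ _ h h' => simp only [map_add, LinearMap.add_apply, h, h']; abel
      | tmul z c =>
        induction W with
        | zero => simp
        | add _ _ h h' => simp only [map_add, LinearMap.add_apply, h, h']; abel
        | tmul w d =>
          simp only [hδ, tagPhi_tmul, LinearMap.rTensor_tmul, LieModule.toEnd_apply_apply]
          rw [leibniz_lie, TensorProduct.add_tmul]
    refine Prod.ext ?_ ?_
    · change (0 : BSpace K J) = (bAct K J α 0 + tagPsi K J X (δ Y)) - (bAct K J β 0 + tagPsi K J Y (δ X))
      rw [tagPsi_skew K Y (δ X), map_zero, map_zero, zero_add, zero_add, sub_neg_eq_add, add_comm, h2]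
    · change δ (tagAct K J α Y - tagAct K J β X + tagPhi K J X Y)
        = (tagAct K J α (δ Y) - tagAct K J 0 X + tagPhi K J X (δ Y))
          - (tagAct K J β (δ X) - tagAct K J 0 Y + tagPhi K J Y (δ X))
      simp only [map_add, map_sub, h1, h3, tagPhi_skew K Y (δ X), map_zero, LinearMap.zero_apply]
      abel

end TAG

/-! ### Homology of Lie algebras (trivial coefficients), the Chevalley–Eilenberg complex -/
section Homology

variable (K : Type u) [Field K] (𝔤 : Type v) [LieRing 𝔤] [LieAlgebra K 𝔤]

open ExteriorAlgebra in
/-- The extension of a linear endomorphism `δ` of `𝔤` to a derivation of `Λ𝔤`: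
`x₁ ∧ … ∧ xₖ ↦ ∑ᵢ x₁ ∧ … ∧ δ xᵢ ∧ … ∧ xₖ`. -/
def extDer (δ : Module.End K 𝔤) : Module.End K (ExteriorAlgebra K 𝔤) :=
  CliffordAlgebra.foldr' (0 : QuadraticForm K 𝔤)
    (LinearMap.mk₂ K (fun x p => ι K (δ x) * p.1 + ι K x * p.2)
      (by intros; simp [add_mul]; abel)
      (by intros; simp)
      (by intros; simp [mul_add]; abel)
      (by intros; simp))
    (by
      intro m x fx
      have h := ExteriorAlgebra.ι_add_mul_swap (R := K) (δ m) m
      have h2 := ExteriorAlgebra.ι_sq_zero (R := K) m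
      change ι K (δ m) * (ι K m * x) + ι K m * (ι K (δ m) * x + ι K m * fx) = (0 : K) • fx
      rw [mul_add, ← mul_assoc, ← mul_assoc, ← mul_assoc, ← add_assoc, ← add_mul, h, h2]
      simp) 0

open ExteriorAlgebra in
theorem extDer_ι_mul (δ : Module.End K 𝔤) (x : 𝔤) (w : ExteriorAlgebra K 𝔤) :
    extDer K 𝔤 δ (ι K x * w) = ι K (δ x) * w + ι K x * extDer K 𝔤 δ w :=
  CliffordAlgebra.foldr'_ι_mul _ _ _ _ _ _

theorem extDer_one (δ : Module.End K 𝔤) : extDer K 𝔤 δ 1 = 0 := by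
  rw [← map_one (algebraMap K (ExteriorAlgebra K 𝔤)), extDer]
  exact (CliffordAlgebra.foldr'_algebraMap (0 : QuadraticForm K 𝔤) _ _ _ _).trans (smul_zero _)

open ExteriorAlgebra in
theorem ext_induction {P : ExteriorAlgebra K 𝔤 → Prop} (h1 : P 1)
    (hs : ∀ (c : K) x, P x → P (c • x)) (ha : ∀ x y, P x → P y → P (x + y))
    (hm : ∀ x w, P w → P (ι K x * w)) (w : ExteriorAlgebra K 𝔤) : P w := by
  induction w using CliffordAlgebra.left_induction with
  | algebraMap r => rw [Algebra.algebraMap_eq_smul_one]; exact hs r 1 h1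
  | add x y hx hy => exact ha x y hx hy
  | ι_mul x m hx => exact hm m x hx

theorem extDer_add (δ δ' : Module.End K 𝔤) :
    extDer K 𝔤 (δ + δ') = extDer K 𝔤 δ + extDer K 𝔤 δ' := by
  refine LinearMap.ext fun w => ?_
  induction w using ext_induction K 𝔤 with
  | h1 => simp [extDer_one]
  | hs c x h => simp [h]
  | ha x y h h' => rw [map_add, map_add, h, h']
  | hm x w h => simp only [extDer_ι_mul, LinearMap.add_apply, map_add, h, mul_add, add_mul]; abel

theorem extDer_smul (c : K) (δ : Module.End K 𝔤) :
    extDer K 𝔤 (c • δ) = c • extDer K 𝔤 δ := by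
  refine LinearMap.ext fun w => ?_
  induction w using ext_induction K 𝔤 with
  | h1 => simp [extDer_one]
  | hs c x h => simp [h]
  | ha x y h h' => simp [h, h']
  | hm x w h => simp [extDer_ι_mul, h]

theorem extDer_lie (δ δ' : Module.End K 𝔤) :
    extDer K 𝔤 ⁅δ, δ'⁆ = ⁅extDer K 𝔤 δ, extDer K 𝔤 δ'⁆ := by
  refine LinearMap.ext fun w => ?_
  induction w using ext_induction K 𝔤 with
  | h1 => simp [extDer_one, Ring.lie_def]
  | hs c x h => rw [map_smul, map_smul, h]
  | ha x y h h' => rw [map_add, map_add, h, h']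
  | hm x w h =>
    rw [Ring.lie_def (extDer K 𝔤 δ), LinearMap.sub_apply, Module.End.mul_apply,
      Module.End.mul_apply] at h
    rw [extDer_ι_mul, h]
    simp only [extDer_ι_mul, Ring.lie_def, LinearMap.sub_apply, Module.End.mul_apply, map_add,
      map_sub, mul_sub, sub_mul]
    abel

open ExteriorAlgebra in
/-- The Chevalley–Eilenberg differential on `Λ𝔤`, determined by `d 1 = 0` and
`d (x ∧ w) = (ad x) · w - x ∧ d w`; equivalently
`d (x₁ ∧ … ∧ xₖ) = ∑_{i<j} (-1)^{i+j+1} [xᵢ, xⱼ] ∧ x₁ ∧ … ∧ x̂ᵢ ∧ … ∧ x̂ⱼ ∧ … ∧ xₖ`. -/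
def ceD : Module.End K (ExteriorAlgebra K 𝔤) :=
  CliffordAlgebra.foldr' (0 : QuadraticForm K 𝔤)
    (LinearMap.mk₂ K (fun x p => extDer K 𝔤 (LieAlgebra.ad K 𝔤 x) p.1 - ι K x * p.2)
      (by intros; simp [extDer_add, add_mul]; abel)
      (by intros; simp [extDer_smul, smul_sub])
      (by intros; simp [mul_add]; abel)
      (by intros; simp [smul_sub]))
    (by
      intro m x fx
      have h2 := ExteriorAlgebra.ι_sq_zero (R := K) m
      change extDer K 𝔤 (LieAlgebra.ad K 𝔤 m) (ι K m * x)
        - ι K m * (extDer K 𝔤 (LieAlgebra.ad K 𝔤 m) x - ι K m * fx) = (0 : K) • fx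
      rw [extDer_ι_mul, mul_sub, ← mul_assoc, h2]
      simp) 0

theorem ceD_one : ceD K 𝔤 1 = 0 := by
  rw [← map_one (algebraMap K (ExteriorAlgebra K 𝔤)), ceD]
  exact (CliffordAlgebra.foldr'_algebraMap (0 : QuadraticForm K 𝔤) _ _ _ _).trans (smul_zero _)

open ExteriorAlgebra in
theorem ceD_ι_mul (x : 𝔤) (w : ExteriorAlgebra K 𝔤) :
    ceD K 𝔤 (ι K x * w) = extDer K 𝔤 (LieAlgebra.ad K 𝔤 x) w - ι K x * ceD K 𝔤 w :=
  CliffordAlgebra.foldr'_ι_mul _ _ _ _ _ _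

theorem ad_derivation (δ : LieDerivation K 𝔤 𝔤) (x : 𝔤) :
    LieAlgebra.ad K 𝔤 (δ x) = ⁅(δ : Module.End K 𝔤), LieAlgebra.ad K 𝔤 x⁆ := by
  ext y
  simp [Ring.lie_def]

theorem ceD_extDer (δ : LieDerivation K 𝔤 𝔤) (w : ExteriorAlgebra K 𝔤) :
    ceD K 𝔤 (extDer K 𝔤 (δ : Module.End K 𝔤) w) = extDer K 𝔤 (δ : Module.End K 𝔤) (ceD K 𝔤 w) := by
  induction w using ext_induction K 𝔤 with
  | h1 => simp [extDer_one, ceD_one]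
  | hs c x h => simp [h]
  | ha x y h h' => simp [h, h']
  | hm x w h =>
    simp only [extDer_ι_mul, ceD_ι_mul, h, map_add, map_sub]
    have := ad_derivation K 𝔤 δ x
    rw [LieDerivation.coeFn_coe, this, extDer_lie, Ring.lie_def, LinearMap.sub_apply,
      Module.End.mul_apply, Module.End.mul_apply]
    abel

theorem ceD_extDer_ad (x : 𝔤) (w : ExteriorAlgebra K 𝔤) :
    ceD K 𝔤 (extDer K 𝔤 (LieAlgebra.ad K 𝔤 x) w)
      = extDer K 𝔤 (LieAlgebra.ad K 𝔤 x) (ceD K 𝔤 w) := by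
  have h : LieAlgebra.ad K 𝔤 x = ((LieDerivation.ad K 𝔤 x : LieDerivation K 𝔤 𝔤) : Module.End K 𝔤) := by
    ext y; simp
  rw [h]
  exact ceD_extDer K 𝔤 _ w

theorem ceD_ceD (w : ExteriorAlgebra K 𝔤) : ceD K 𝔤 (ceD K 𝔤 w) = 0 := by
  induction w using ext_induction K 𝔤 with
  | h1 => simp [ceD_one]
  | hs c x h => simp [h]
  | ha x y h h' => simp [h, h']
  | hm x w h => simp [ceD_ι_mul, ceD_extDer_ad, h]

theorem extDer_mem (δ : Module.End K 𝔤) (k : ℕ) (w : ExteriorAlgebra K 𝔤) (hw : w ∈ ⋀[K]^k 𝔤) :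
    extDer K 𝔤 δ w ∈ ⋀[K]^k 𝔤 := by
  induction k generalizing w with
  | zero =>
    rw [ExteriorAlgebra.exteriorPower, pow_zero, Submodule.mem_one] at hw
    obtain ⟨c, rfl⟩ := hw
    rw [Algebra.algebraMap_eq_smul_one, map_smul, extDer_one, smul_zero]
    exact zero_mem _
  | succ k ih =>
    rw [ExteriorAlgebra.exteriorPower, pow_succ'] at hw ⊢
    induction hw using Submodule.mul_induction_on' with
    | mem_mul_mem m hm n hn =>
      obtain ⟨x, rfl⟩ := hm
      rw [extDer_ι_mul]
      exact add_mem (Submodule.mul_mem_mul ⟨_, rfl⟩ hn) (Submodule.mul_mem_mul ⟨_, rfl⟩ (ih n hn))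
    | add x _ y _ hx hy => rw [map_add]; exact add_mem hx hy

theorem ceD_mem (k : ℕ) (w : ExteriorAlgebra K 𝔤) (hw : w ∈ ⋀[K]^(k + 1) 𝔤) :
    ceD K 𝔤 w ∈ ⋀[K]^k 𝔤 := by
  induction k generalizing w with
  | zero =>
    rw [ExteriorAlgebra.exteriorPower, zero_add, pow_one] at hw
    obtain ⟨x, rfl⟩ := hw
    rw [← mul_one (ExteriorAlgebra.ι K x), ceD_ι_mul, extDer_one, ceD_one, mul_zero, sub_zero]
    exact zero_mem _
  | succ k ih =>
    rw [ExteriorAlgebra.exteriorPower, pow_succ'] at hw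
    induction hw using Submodule.mul_induction_on' with
    | mem_mul_mem m hm n hn =>
      obtain ⟨x, rfl⟩ := hm
      rw [ceD_ι_mul]
      refine sub_mem (extDer_mem K 𝔤 _ _ n hn) ?_
      rw [ExteriorAlgebra.exteriorPower, pow_succ']
      exact Submodule.mul_mem_mul ⟨_, rfl⟩ (ih n hn)
    | add x _ y _ hx hy => rw [map_add]; exact add_mem hx hy

/-- The `k`-cycles: the kernel of `d` on `Λᵏ𝔤`. -/
def cycles (k : ℕ) : Submodule K (ExteriorAlgebra K 𝔤) := (⋀[K]^k 𝔤) ⊓ LinearMap.ker (ceD K 𝔤)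

/-- The `k`-boundaries: the image of `Λᵏ⁺¹𝔤` under `d`. -/
def boundaries (k : ℕ) : Submodule K (ExteriorAlgebra K 𝔤) := (⋀[K]^(k + 1) 𝔤).map (ceD K 𝔤)

theorem boundaries_le_cycles (k : ℕ) : boundaries K 𝔤 k ≤ cycles K 𝔤 k := by
  rintro _ ⟨w, hw, rfl⟩
  exact ⟨ceD_mem K 𝔤 k w hw, ceD_ceD K 𝔤 w⟩

/-- The homology `H_k(𝔤)` of the Lie algebra `𝔤` with trivial coefficients. -/
abbrev LieHomology (k : ℕ) : Type _ :=
  cycles K 𝔤 k ⧸ (boundaries K 𝔤 k).submoduleOf (cycles K 𝔤 k)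

variable {𝔤} in
theorem extDer_mem_cycles (δ : LieDerivation K 𝔤 𝔤) (k : ℕ) (w : ExteriorAlgebra K 𝔤)
    (hw : w ∈ cycles K 𝔤 k) : extDer K 𝔤 (δ : Module.End K 𝔤) w ∈ cycles K 𝔤 k := by
  refine ⟨extDer_mem K 𝔤 _ k w hw.1, ?_⟩
  have h := hw.2
  rw [SetLike.mem_coe, LinearMap.mem_ker] at h ⊢
  rw [ceD_extDer, h, map_zero]

variable {𝔤} in
/-- The action on `H_k(𝔤)` induced by a derivation `δ` of `𝔤`. -/
def homologyAct (δ : LieDerivation K 𝔤 𝔤) (k : ℕ) : Module.End K (LieHomology K 𝔤 k) :=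
  Submodule.mapQ _ _ ((extDer K 𝔤 (δ : Module.End K 𝔤)).restrict (extDer_mem_cycles K δ k)) (by
    rintro ⟨_, hz⟩ ⟨w, hw, rfl⟩
    exact ⟨extDer K 𝔤 (δ : Module.End K 𝔤) w, extDer_mem K 𝔤 _ _ w hw, ceD_extDer K 𝔤 δ w⟩)

end Homology

/-! ### Isotypic parts of the homology of `sl₂ J` -/
section Isotypic

variable (K : Type u) [Field K] [CharZero K]
variable (J : Type v) [NonUnitalNonAssocCommRing J] [Module K J] [IsScalarTower K J J]
  [SMulCommClass K J J] [IsCommJordan J]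

/-- `H_k(sl₂ J)^{sl₂}`: the vectors killed by the action of `sl₂`. -/
def trivialPart (k : ℕ) : Submodule K (LieHomology K (TAG K J) k) :=
  ⨅ x : Sl2 K, LinearMap.ker (homologyAct K (sl2Der K J x) k)

/-- `H_k(sl₂ J)^{ad}`: the isotypic component of adjoint type, i.e. the sum of the images of all
`sl₂`-equivariant linear maps from the adjoint module `sl₂` to `H_k(sl₂ J)`. -/
def adjointPart (k : ℕ) : Submodule K (LieHomology K (TAG K J) k) :=
  ⨆ φ : {φ : Sl2 K →ₗ[K] LieHomology K (TAG K J) k //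
    ∀ x y : Sl2 K, φ ⁅x, y⁆ = homologyAct K (sl2Der K J x) k (φ y)}, LinearMap.range φ.1

end Isotypic

/-! ### Free Jordan algebras and the action of `GL(D)` -/
section Free

variable (K : Type u) [Field K] [CharZero K] (D : ℕ)

/-- The ideal of the free non-unital non-associative algebra generated by the elements
`a b - b a` and `a² (b a) - (a² b) a`. -/
def jordanIdeal : Submodule K (FreeNonUnitalNonAssocAlgebra K (Fin D)) :=
  sInf {N | (∀ a b, a * b - b * a ∈ N) ∧ (∀ a b, (a * a) * (b * a) - ((a * a) * b) * a ∈ N) ∧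
    (∀ a, ∀ n ∈ N, a * n ∈ N) ∧ (∀ a, ∀ n ∈ N, n * a ∈ N)}

theorem comm_mem (a b : FreeNonUnitalNonAssocAlgebra K (Fin D)) :
    a * b - b * a ∈ jordanIdeal K D :=
  (Submodule.mem_sInf).2 fun _ hN => hN.1 a b

theorem jordan_mem (a b : FreeNonUnitalNonAssocAlgebra K (Fin D)) :
    (a * a) * (b * a) - ((a * a) * b) * a ∈ jordanIdeal K D :=
  (Submodule.mem_sInf).2 fun _ hN => hN.2.1 a b

theorem mul_mem_left (a : FreeNonUnitalNonAssocAlgebra K (Fin D)) {n} (hn : n ∈ jordanIdeal K D) :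
    a * n ∈ jordanIdeal K D :=
  (Submodule.mem_sInf).2 fun N hN => hN.2.2.1 a n ((Submodule.mem_sInf).1 hn N hN)

theorem mul_mem_right (a : FreeNonUnitalNonAssocAlgebra K (Fin D)) {n} (hn : n ∈ jordanIdeal K D) :
    n * a ∈ jordanIdeal K D :=
  (Submodule.mem_sInf).2 fun N hN => hN.2.2.2 a n ((Submodule.mem_sInf).1 hn N hN)

/-- The free (non-unital) Jordan algebra `J(D)` on `D` generators over `K`. -/
def FreeJordanAlg : Type u := FreeNonUnitalNonAssocAlgebra K (Fin D) ⧸ jordanIdeal K D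

instance : AddCommGroup (FreeJordanAlg K D) :=
  inferInstanceAs (AddCommGroup (_ ⧸ jordanIdeal K D))
instance : Module K (FreeJordanAlg K D) :=
  inferInstanceAs (Module K (_ ⧸ jordanIdeal K D))

/-- The quotient map onto `J(D)`. -/
def toFree : FreeNonUnitalNonAssocAlgebra K (Fin D) →ₗ[K] FreeJordanAlg K D :=
  (jordanIdeal K D).mkQ

theorem toFree_surjective : Function.Surjective (toFree K D) :=
  (jordanIdeal K D).mkQ_surjective

theorem toFree_eq {a b : FreeNonUnitalNonAssocAlgebra K (Fin D)} :
    toFree K D a = toFree K D b ↔ a - b ∈ jordanIdeal K D :=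
  Submodule.Quotient.eq _

/-- The product of `J(D)`. -/
def freeMul : FreeJordanAlg K D →ₗ[K] FreeJordanAlg K D →ₗ[K] FreeJordanAlg K D :=
  Submodule.liftQ (jordanIdeal K D)
    (LinearMap.mk₂ K
      (fun (a : FreeNonUnitalNonAssocAlgebra K (Fin D)) (b : FreeJordanAlg K D) =>
        (Submodule.mapQ (jordanIdeal K D) (jordanIdeal K D) (LinearMap.mulLeft K a)
          (fun _ hn => mul_mem_left K D a hn) : FreeJordanAlg K D →ₗ[K] FreeJordanAlg K D) b)
      (fun a a' b => by
        obtain ⟨b, rfl⟩ := toFree_surjective K D b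
        exact congrArg (toFree K D) (add_mul a a' b))
      (fun c a b => by
        obtain ⟨b, rfl⟩ := toFree_surjective K D b
        exact congrArg (toFree K D) (smul_mul_assoc c a b))
      (fun a b b' => map_add _ b b')
      (fun c a b => map_smul _ c b))
    (fun n hn => by
      rw [LinearMap.mem_ker]
      ext1 b
      obtain ⟨b, rfl⟩ := toFree_surjective K D b
      exact (Submodule.Quotient.mk_eq_zero _).2 (mul_mem_right K D b hn))

instance : Mul (FreeJordanAlg K D) := ⟨fun a b => freeMul K D a b⟩

theorem toFree_mul (a b : FreeNonUnitalNonAssocAlgebra K (Fin D)) :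
    toFree K D (a * b) = toFree K D a * toFree K D b := rfl

instance : NonUnitalNonAssocCommRing (FreeJordanAlg K D) where
  left_distrib a b c := map_add (freeMul K D a) b c
  right_distrib a b c := LinearMap.map_add₂ (freeMul K D) a b c
  zero_mul a := LinearMap.map_zero₂ (freeMul K D) a
  mul_zero a := map_zero (freeMul K D a)
  mul_comm a b := by
    obtain ⟨a, rfl⟩ := toFree_surjective K D a
    obtain ⟨b, rfl⟩ := toFree_surjective K D b
    exact (toFree_eq K D).2 (comm_mem K D a b)

instance : IsScalarTower K (FreeJordanAlg K D) (FreeJordanAlg K D) :=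
  ⟨fun c a b => LinearMap.map_smul₂ (freeMul K D) c a b⟩

instance : SMulCommClass K (FreeJordanAlg K D) (FreeJordanAlg K D) :=
  ⟨fun c a b => (map_smul (freeMul K D a) c b).symm⟩

instance : IsCommJordan (FreeJordanAlg K D) where
  lmul_comm_rmul_rmul a b := by
    obtain ⟨a, rfl⟩ := toFree_surjective K D a
    obtain ⟨b, rfl⟩ := toFree_surjective K D b
    have h : (toFree K D a * toFree K D a) * (toFree K D b * toFree K D a)
        = ((toFree K D a * toFree K D a) * toFree K D b) * toFree K D a :=
      (toFree_eq K D).2 (jordan_mem K D a b)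
    rw [mul_comm (toFree K D a) (toFree K D b), mul_comm (toFree K D b * _), h, mul_comm _ (toFree K D a),
      mul_comm _ (toFree K D b)]

/-- The generators `x₁, …, x_D` of `J(D)`. -/
def gen (i : Fin D) : FreeJordanAlg K D := toFree K D (FreeNonUnitalNonAssocAlgebra.of K i)

section Lift
variable {J : Type v} [NonUnitalNonAssocCommRing J] [Module K J] [IsScalarTower K J J]
  [SMulCommClass K J J] [IsCommJordan J]

/-- The universal property of `J(D)`: a family of `D` elements of a Jordan algebra extends to
a morphism from `J(D)`. -/
def freeLift (f : Fin D → J) : FreeJordanAlg K D →ₙₐ[K] J where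
  toFun := Submodule.liftQ (jordanIdeal K D)
    (FreeNonUnitalNonAssocAlgebra.lift K f : _ →ₗ[K] J) (by
      set F := FreeNonUnitalNonAssocAlgebra.lift K f
      refine sInf_le ⟨?_, ?_, ?_, ?_⟩
      · intro a b
        simp [mul_comm]
      · intro a b
        simp only [LinearMap.mem_ker, map_sub, LinearMap.coe_coe, map_mul]
        rw [sub_eq_zero, mul_comm (F b) (F a), mul_comm (F a * F a) (F b), mul_comm _ (F a),
          mul_comm (F a * F a), IsCommJordan.lmul_comm_rmul_rmul]
        exact mul_comm _ _
      · intro a n hn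
        simp only [LinearMap.mem_ker, LinearMap.coe_coe, map_mul] at hn ⊢
        rw [hn, mul_zero]
      · intro a n hn
        simp only [LinearMap.mem_ker, LinearMap.coe_coe, map_mul] at hn ⊢
        rw [hn, zero_mul])
  map_smul' c a := map_smul _ c a
  map_zero' := map_zero _
  map_add' a b := map_add _ a b
  map_mul' a b := by
    obtain ⟨a, rfl⟩ := toFree_surjective K D a
    obtain ⟨b, rfl⟩ := toFree_surjective K D b
    exact map_mul (FreeNonUnitalNonAssocAlgebra.lift K f) a b

@[simp] theorem freeLift_gen (f : Fin D → J) (i : Fin D) : freeLift K D f (gen K D i) = f i :=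
  FreeNonUnitalNonAssocAlgebra.lift_of_apply K f i

theorem free_hom_ext {F G : FreeJordanAlg K D →ₙₐ[K] J}
    (h : ∀ i, F (gen K D i) = G (gen K D i)) : F = G := by
  let q : FreeNonUnitalNonAssocAlgebra K (Fin D) →ₙₐ[K] FreeJordanAlg K D :=
    { toFree K D with
      map_zero' := map_zero (toFree K D)
      map_mul' := toFree_mul K D }
  have hq : F.comp q = G.comp q := FreeNonUnitalNonAssocAlgebra.hom_ext K h
  ext a
  obtain ⟨a, rfl⟩ := toFree_surjective K D a
  exact congrArg (fun f => f a) hq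

end Lift

/-- The action of `g ∈ GL(D)` on `J(D)`: the automorphism with `xⱼ ↦ ∑ᵢ gᵢⱼ xᵢ`. -/
def glHom (g : GL (Fin D) K) : FreeJordanAlg K D →ₙₐ[K] FreeJordanAlg K D :=
  freeLift K D fun j => ∑ i, (g : Matrix (Fin D) (Fin D) K) i j • gen K D i

/-- `J(D)` as a representation of `GL(D)`. -/
def repJ : Representation K (GL (Fin D) K) (FreeJordanAlg K D) where
  toFun g := (glHom K D g : FreeJordanAlg K D →ₗ[K] FreeJordanAlg K D)
  map_one' := by
    have : glHom K D 1 = NonUnitalAlgHom.id K (FreeJordanAlg K D) := by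
      apply free_hom_ext
      intro j
      simp [glHom, Matrix.one_apply]
    ext a
    exact congrArg (fun f => f a) this
  map_mul' g h := by
    have : glHom K D (g * h) = (glHom K D g).comp (glHom K D h) := by
      apply free_hom_ext
      intro j
      simp only [glHom, freeLift_gen, NonUnitalAlgHom.comp_apply, map_sum, map_smul,
        Units.val_mul, Matrix.mul_apply, Finset.sum_smul, Finset.smul_sum, smul_smul]
      rw [Finset.sum_comm]
      simp only [mul_comm]
    ext a
    exact congrArg (fun f => f a) this

theorem repJ_mul (g : GL (Fin D) K) (a b : FreeJordanAlg K D) :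
    repJ K D g (a * b) = repJ K D g a * repJ K D g b :=
  map_mul (glHom K D g) a b

/-- `Inner J(D)` with the conjugation action of `GL(D)`: `g . ∂_{a,b} = ∂_{g a, g b}`. -/
def subrepInner : Subrepresentation (Representation.linHom (repJ K D) (repJ K D)) where
  toSubmodule := Inner K (FreeJordanAlg K D)
  apply_mem_toSubmodule g δ hδ := by
    suffices h : Inner K (FreeJordanAlg K D)
        ≤ (Inner K (FreeJordanAlg K D)).comap (Representation.linHom (repJ K D) (repJ K D) g) from
      h hδ
    rw [Inner, Submodule.span_le]
    rintro _ ⟨a, b, rfl⟩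
    refine Submodule.subset_span ⟨repJ K D g a, repJ K D g b, ?_⟩
    ext z
    simp [repJ_mul, Representation.self_inv_apply]

/-- `Inner J(D)` as a representation of `GL(D)`. -/
def repInner : Representation K (GL (Fin D) K) (Inner K (FreeJordanAlg K D)) :=
  (subrepInner K D).toRepresentation

variable {K D}
variable {V : Type*} [AddCommGroup V] [Module K V]

/-- The weight space `V_𝐦`: the vectors on which every diagonal matrix `diag(h₁, …, h_D)` acts as
the scalar `h₁^{m₁} ⋯ h_D^{m_D}`. -/
def weightSpace (ρ : Representation K (GL (Fin D) K) V) (m : Fin D →₀ ℕ) : Submodule K V where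
  carrier := {v | ∀ (g : GL (Fin D) K) (h : Fin D → K),
    (g : Matrix (Fin D) (Fin D) K) = Matrix.diagonal h → ρ g v = (∏ i, h i ^ m i) • v}
  add_mem' hv hw g h hg := by rw [map_add, hv g h hg, hw g h hg, smul_add]
  zero_mem' g h _ := by rw [map_zero, smul_zero]
  smul_mem' c v hv g h hg := by rw [map_smul, hv g h hg, smul_comm]

/-- The class `[V] = ∑_𝐦 dim V_𝐦 z₁^{m₁} ⋯ z_D^{m_D}` of an analytic `GL(D)`-module. -/
def gradedClass (ρ : Representation K (GL (Fin D) K) V) : MvPowerSeries (Fin D) ℤ :=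
  fun m => (Module.finrank K (weightSpace ρ m) : ℤ)

end Free

/-! ### The ring `R(GL(D) × PSL(2))` through characters, and the classes `A(D)`, `B(D)`

A class in `R_an(GL(D))` is identified with its character, a power series in `z₁, …, z_D` over `ℤ`;
a class in `R_an(GL(D) × PSL(2))` with its character, a power series in `z₁, …, z_D` over the ring
`ℤ[t, t⁻¹]`, where `t = e^α` for the root `α` of `sl₂`. -/
section Combi

open LaurentPolynomial MvPowerSeries

variable {D : ℕ}

/-- The character `∑_{-k ≤ i ≤ k} tⁱ` of the `PSL(2)`-module `L(2k)`, where `t = e^α`. -/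
def chL (k : ℕ) : ℤ[T;T⁻¹] := ∑ i ∈ Finset.Icc (-(k : ℤ)) k, T i

/-- The multiplicity `[a : L(2k)]` in a character `a = ∑ᵢ cᵢ tⁱ` of `PSL(2)`, equal to
`c_{-k} - c_{-k-1}`. -/
def mult (k : ℕ) (a : ℤ[T;T⁻¹]) : ℤ := a.coeff (-(k : ℤ)) - a.coeff (-(k : ℤ) - 1)

/-- The multiplicity `[a : L(2k)]` for a series `a` of characters of `PSL(2)`. -/
def multL (k : ℕ) (a : MvPowerSeries (Fin D) ℤ[T;T⁻¹]) : MvPowerSeries (Fin D) ℤ :=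
  fun m => mult k (coeff m a)

/-- The factor `∏_j (1 - z^p t^j)^{c_j⁺}` for a Laurent polynomial `c = ∑ c_j t^j`, where
`c_j⁺ = max(c_j, 0)`. -/
def lamFactor (p : Fin D →₀ ℕ) (c : ℤ[T;T⁻¹]) : MvPowerSeries (Fin D) ℤ[T;T⁻¹] :=
  ∏ j ∈ c.coeff.support, (1 - monomial p (T j)) ^ (c.coeff j).toNat

/-- `λ` of the positive part of `a = ∑ c_{p,j} z^p t^j` (with `c_{0,j} = 0`): the class
`∑_k (-1)^k [Λ^k V]`, where `V` has `max(c_{p,j}, 0)` basis vectors of weight `z^p t^j`. This is the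
product of the `(1 - z^p t^j)^{max(c_{p,j}, 0)}`; the coefficient of `z^m` only involves the factors
with `p ≤ m`. -/
def lamPos (a : MvPowerSeries (Fin D) ℤ[T;T⁻¹]) : MvPowerSeries (Fin D) ℤ[T;T⁻¹] :=
  fun m => coeff m (∏ p ∈ (Finset.Iic m).erase 0, lamFactor p (coeff p a))

/-- The operation `λ`: if `a = a' - a''` with `a'`, `a''` effective, then
`λ a = (λ a') (λ a'')⁻¹`. -/
def lam (a : MvPowerSeries (Fin D) ℤ[T;T⁻¹]) : MvPowerSeries (Fin D) ℤ[T;T⁻¹] :=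
  lamPos a * invOfUnit (lamPos (-a)) 1

/-- The element `a [L(2)] + b`. -/
def tagClass (a b : MvPowerSeries (Fin D) ℤ) : MvPowerSeries (Fin D) ℤ[T;T⁻¹] :=
  MvPowerSeries.map LaurentPolynomial.C a * MvPowerSeries.C (chL 1)
    + MvPowerSeries.map LaurentPolynomial.C b

/-- The equations defining `(A(D), B(D))`: `a` and `b` have no constant term,
`λ(a [L(2)] + b) : [L(0)] = 1` and `λ(a [L(2)] + b) : [L(2)] = -[K^D]`, where
`[K^D] = z₁ + ⋯ + z_D`. There is exactly one such pair; it consists of symmetric series because the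
equations are invariant under permutations of the variables. -/
structure IsCombiPair (a b : MvPowerSeries (Fin D) ℤ) : Prop where
  constantCoeff_left : constantCoeff a = 0
  constantCoeff_right : constantCoeff b = 0
  mult_zero : multL 0 (lam (tagClass a b)) = 1
  mult_one : multL 1 (lam (tagClass a b)) = - ∑ i, X i

abbrev PS (D : ℕ) := MvPowerSeries (Fin D) ℤ[T;T⁻¹]

theorem coeff_mul_of_vanish {m : Fin D →₀ ℕ} {E Q : PS D} (h : ∀ p < m, coeff p E = 0) :
    coeff m (E * Q) = coeff m E * coeff 0 Q := by
  classical
  rw [coeff_mul, Finset.sum_eq_single (m, 0)]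
  · rintro ⟨p, q⟩ hpq hne
    rw [Finset.HasAntidiagonal.mem_antidiagonal] at hpq
    have : p < m := by
      refine lt_of_le_of_ne (hpq ▸ le_self_add) ?_
      rintro rfl
      exact hne (by simpa using hpq)
    simp [h p this]
  · simp

theorem lamFactor_form (p : Fin D →₀ ℕ) (c : ℤ[T;T⁻¹]) :
    ∃ R : PS D, lamFactor p c
      = 1 - monomial p (∑ j ∈ c.coeff.support, (c.coeff j).toNat • (T j : ℤ[T;T⁻¹]))
        + monomial (p + p) 1 * R := by
  have mulform : ∀ (s t : ℤ[T;T⁻¹]) (R S : PS D), ∃ U : PS D,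
      (1 - monomial p s + monomial (p + p) 1 * R) * (1 - monomial p t + monomial (p + p) 1 * S)
        = 1 - monomial p (s + t) + monomial (p + p) 1 * U := by
    intro s t R S
    refine ⟨MvPowerSeries.C (s * t) + R * (1 - monomial p t + monomial (p + p) 1 * S)
      + (1 - monomial p s) * S, ?_⟩
    have h : (monomial p s : PS D) * monomial p t = monomial (p + p) 1 * MvPowerSeries.C (s * t) := by
      rw [monomial_mul_monomial, ← monomial_zero_eq_C_apply, monomial_mul_monomial, add_zero, one_mul]
    rw [map_add]
    linear_combination h
  have powform : ∀ (s : ℤ[T;T⁻¹]) (n : ℕ), ∃ U : PS D,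
      (1 - monomial p s) ^ n = 1 - monomial p (n • s) + monomial (p + p) 1 * U := by
    intro s n
    induction n with
    | zero => exact ⟨0, by simp⟩
    | succ n ih =>
      obtain ⟨U, hU⟩ := ih
      obtain ⟨W, hW⟩ := mulform (n • s) s U 0
      refine ⟨W, ?_⟩
      rw [pow_succ, hU, succ_nsmul, ← hW, mul_zero, add_zero]
  unfold lamFactor
  induction c.coeff.support using Finset.induction_on with
  | empty => exact ⟨0, by simp⟩
  | insert j s hj ih =>
    obtain ⟨U, hU⟩ := ih
    obtain ⟨W, hW⟩ := powform (T j) (c.coeff j).toNat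
    obtain ⟨R, hR⟩ := mulform ((c.coeff j).toNat • T j) _ W U
    exact ⟨R, by rw [Finset.prod_insert hj, hU, hW, hR, Finset.sum_insert hj]⟩

theorem coeff_zero_lamFactor {p : Fin D →₀ ℕ} (hp : p ≠ 0) (c : ℤ[T;T⁻¹]) :
    coeff 0 (lamFactor p c) = 1 := by
  classical
  obtain ⟨R, hR⟩ := lamFactor_form p c
  rw [hR]
  have h2 : ¬ p + p ≤ 0 := by simpa using hp
  rw [map_add, map_sub, coeff_monomial, coeff_monomial_mul, if_neg h2, if_neg (Ne.symm hp)]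
  simp

theorem coeff_lamPos_zero (f : PS D) : coeff 0 (lamPos f) = 1 := by
  rw [coeff_apply, lamPos]
  have : (Finset.Iic (0 : Fin D →₀ ℕ)).erase 0 = ∅ := by
    ext p; simp
  rw [this]
  simp

/-- The positive part of a Laurent polynomial. -/
def posPart (c : ℤ[T;T⁻¹]) : ℤ[T;T⁻¹] := ∑ j ∈ c.coeff.support, (c.coeff j).toNat • T j

theorem posPart_sub (c : ℤ[T;T⁻¹]) : posPart c - posPart (-c) = c := by
  ext i
  have h1 : ∀ d : ℤ[T;T⁻¹], (posPart d).coeff i = (d.coeff i).toNat := by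
    intro d
    rw [posPart, AddMonoidAlgebra.coeff_sum, Finsupp.finsetSum_apply]
    simp only [AddMonoidAlgebra.coeff_smul_apply, T_apply, smul_ite, smul_zero, nsmul_one,
      Finset.sum_ite_eq', Finsupp.mem_support_iff]
    by_cases h : d.coeff i = 0 <;> simp [h]
  rw [AddMonoidAlgebra.coeff_sub, Finsupp.sub_apply, h1, h1]
  simp

theorem coeff_lamPos (f : PS D) {m : Fin D →₀ ℕ} (hm : m ≠ 0) :
    coeff m (lamPos f)
      = coeff m (∏ p ∈ ((Finset.Iic m).erase 0).erase m, lamFactor p (coeff p f))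
        - posPart (coeff m f) := by
  classical
  have hmem : m ∈ (Finset.Iic m).erase 0 := by simp [hm]
  rw [coeff_apply, lamPos, ← Finset.mul_prod_erase _ _ hmem]
  set G := ∏ p ∈ ((Finset.Iic m).erase 0).erase m, lamFactor p (coeff p f) with hG
  have hG0 : coeff 0 G = 1 := by
    rw [hG, coeff_zero_eq_constantCoeff_apply, map_prod]
    refine Finset.prod_eq_one fun p hp => ?_
    simp only [Finset.mem_erase] at hp
    exact coeff_zero_lamFactor hp.2.1 _
  obtain ⟨R, hR⟩ := lamFactor_form m (coeff m f)
  have h2 : ¬ m + m ≤ m := by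
    intro h
    exact hm (by simpa using h)
  rw [hR, add_mul, sub_mul, one_mul, map_add, map_sub, mul_assoc, coeff_monomial_mul,
    coeff_monomial_mul, if_pos le_rfl, if_neg h2, tsub_self, hG0, mul_one, add_zero, posPart]

theorem coeff_lamPos_congr {f g : PS D} {m : Fin D →₀ ℕ} (h : ∀ p ≤ m, coeff p f = coeff p g) :
    coeff m (lamPos f) = coeff m (lamPos g) := by
  rw [coeff_apply, coeff_apply, lamPos, lamPos]
  congr 1
  refine Finset.prod_congr rfl fun p hp => ?_
  rw [h p (by simpa using (Finset.mem_erase.1 hp).2)]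

theorem lam_mul (f : PS D) : lam f * lamPos (-f) = lamPos f := by
  rw [lam, mul_assoc, invOfUnit_mul, mul_one]
  simpa using coeff_lamPos_zero (-f)

theorem coeff_lam_zero (f : PS D) : coeff 0 (lam f) = 1 := by
  have h := congrArg constantCoeff (lam_mul f)
  have h1 := coeff_lamPos_zero f
  have h2 := coeff_lamPos_zero (-f)
  rw [coeff_zero_eq_constantCoeff_apply] at *
  rwa [map_mul, h1, h2, mul_one] at h

theorem coeff_mul_diff {U U' Q Q' : PS D} {m : Fin D →₀ ℕ} (hm : m ≠ 0)
    (hU : ∀ p < m, coeff p U = coeff p U') (hQ : ∀ p < m, coeff p Q = coeff p Q')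
    (hU0 : coeff 0 U' = 1) (hQ0 : coeff 0 Q' = 1) :
    coeff m (U * Q) - coeff m (U' * Q')
      = (coeff m U - coeff m U') + (coeff m Q - coeff m Q') := by
  have e : U * Q = U' * Q' + (U - U') * Q + (Q - Q') * U' := by ring
  have h0 : coeff 0 Q = 1 := by
    rw [hQ 0 (pos_iff_ne_zero.2 hm), hQ0]
  have hU' : ∀ p < m, coeff p (U - U') = 0 := fun p hp => by rw [map_sub, hU p hp, sub_self]
  have hQ' : ∀ p < m, coeff p (Q - Q') = 0 := fun p hp => by rw [map_sub, hQ p hp, sub_self]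
  rw [e, map_add, map_add, coeff_mul_of_vanish hU', coeff_mul_of_vanish hQ', h0, hU0, map_sub,
    map_sub]
  ring

theorem coeff_lam_congr {f g : PS D} (m : Fin D →₀ ℕ) (h : ∀ p ≤ m, coeff p f = coeff p g) :
    coeff m (lam f) = coeff m (lam g) := by
  induction m using WellFoundedLT.induction with
  | ind m ih =>
    by_cases hm : m = 0
    · subst hm; rw [coeff_lam_zero, coeff_lam_zero]
    have hneg : ∀ p ≤ m, coeff p (-f) = coeff p (-g) := fun p hp => by
      rw [map_neg, map_neg, h p hp]
    have key := coeff_mul_diff (U := lam f) (U' := lam g) (Q := lamPos (-f)) (Q' := lamPos (-g)) hm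
      (fun p hp => ih p hp fun q hq => h q (hq.trans hp.le))
      (fun p hp => coeff_lamPos_congr fun q hq => hneg q (hq.trans hp.le))
      (coeff_lam_zero g) (coeff_lamPos_zero _)
    rw [lam_mul, lam_mul, coeff_lamPos_congr h, coeff_lamPos_congr hneg, sub_self, sub_self,
      add_zero] at key
    exact (sub_eq_zero.1 key.symm)

theorem coeff_lam_step {f g : PS D} {m : Fin D →₀ ℕ} (hm : m ≠ 0)
    (h : ∀ p < m, coeff p f = coeff p g) :
    coeff m (lam f) + coeff m f = coeff m (lam g) + coeff m g := by
  have hneg : ∀ p < m, coeff p (-f) = coeff p (-g) := fun p hp => by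
    rw [map_neg, map_neg, h p hp]
  have key := coeff_mul_diff (U := lam f) (U' := lam g) (Q := lamPos (-f)) (Q' := lamPos (-g)) hm
    (fun p hp => coeff_lam_congr p fun q hq => h q (lt_of_le_of_lt hq hp))
    (fun p hp => coeff_lamPos_congr fun q hq => hneg q (lt_of_le_of_lt hq hp))
    (coeff_lam_zero g) (coeff_lamPos_zero _)
  have hprod : ∀ f g : PS D, (∀ p < m, coeff p f = coeff p g) →
      coeff m (lamPos f) - coeff m (lamPos g) = posPart (coeff m g) - posPart (coeff m f) := by
    intro f g h
    rw [coeff_lamPos f hm, coeff_lamPos g hm]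
    have : (∏ p ∈ ((Finset.Iic m).erase 0).erase m, lamFactor p (coeff p f))
        = ∏ p ∈ ((Finset.Iic m).erase 0).erase m, lamFactor p (coeff p g) := by
      refine Finset.prod_congr rfl fun p hp => ?_
      simp only [Finset.mem_erase, Finset.mem_Iic] at hp
      rw [h p (lt_of_le_of_ne hp.2.2 hp.1)]
    rw [this]
    ring
  rw [lam_mul, lam_mul, hprod f g h, hprod _ _ hneg, map_neg, map_neg] at key
  have h1 := posPart_sub (coeff m f)
  have h2 := posPart_sub (coeff m g)
  linear_combination -key + h2 - h1

theorem mult_add (k : ℕ) (a b : ℤ[T;T⁻¹]) : mult k (a + b) = mult k a + mult k b := by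
  simp [mult]; ring

theorem mult_sub (k : ℕ) (a b : ℤ[T;T⁻¹]) : mult k (a - b) = mult k a - mult k b := by
  simp [mult]; ring

/-- The coefficient `x [L(2)] + y` of `tagClass`. -/
def tagCoeff (x y : ℤ) : ℤ[T;T⁻¹] := LaurentPolynomial.C x * chL 1 + LaurentPolynomial.C y

theorem coeff_tagClass (a b : MvPowerSeries (Fin D) ℤ) (m : Fin D →₀ ℕ) :
    coeff m (tagClass a b) = tagCoeff (coeff m a) (coeff m b) := by
  simp [tagClass, tagCoeff]

theorem chL_one : chL 1 = T (-1) + 1 + T 1 := by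
  have : Finset.Icc (-((1 : ℕ) : ℤ)) (1 : ℕ) = {-1, 0, 1} := by decide
  rw [chL, this]
  simp [add_assoc]

theorem mult_zero_tagCoeff (x y : ℤ) : mult 0 (tagCoeff x y) = y := by
  have h : tagCoeff x y = .single (-1) x + .single 0 x + .single 1 x + .single 0 y := by
    simp only [tagCoeff, chL_one, single_eq_C_mul_T, T_zero]; ring
  rw [h]
  simp only [mult, AddMonoidAlgebra.coeff_add, AddMonoidAlgebra.coeff_single, Finsupp.add_apply,
    Finsupp.single_apply]
  simp

theorem mult_one_tagCoeff (x y : ℤ) : mult 1 (tagCoeff x y) = x := by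
  have h : tagCoeff x y = .single (-1) x + .single 0 x + .single 1 x + .single 0 y := by
    simp only [tagCoeff, chL_one, single_eq_C_mul_T, T_zero]; ring
  rw [h]
  simp only [mult, AddMonoidAlgebra.coeff_add, AddMonoidAlgebra.coeff_single, Finsupp.add_apply,
    Finsupp.single_apply]
  simp

theorem IsCombiPair.unique {a b a' b' : MvPowerSeries (Fin D) ℤ} (h : IsCombiPair a b)
    (h' : IsCombiPair a' b') : a = a' ∧ b = b' := by
  have key : ∀ m : Fin D →₀ ℕ, coeff m a = coeff m a' ∧ coeff m b = coeff m b' := by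
    intro m
    induction m using WellFoundedLT.induction with
    | ind m ih =>
      by_cases hm : m = 0
      · subst hm
        have h1 := h.constantCoeff_left
        have h2 := h.constantCoeff_right
        have h3 := h'.constantCoeff_left
        have h4 := h'.constantCoeff_right
        rw [← coeff_zero_eq_constantCoeff_apply] at h1 h2 h3 h4
        rw [h1, h2, h3, h4]
        exact ⟨rfl, rfl⟩
      have step := coeff_lam_step (f := tagClass a b) (g := tagClass a' b') hm (fun p hp => by
        rw [coeff_tagClass, coeff_tagClass, (ih p hp).1, (ih p hp).2])
      rw [coeff_tagClass, coeff_tagClass] at step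
      have e0 : mult 0 (coeff m (lam (tagClass a b))) = mult 0 (coeff m (lam (tagClass a' b'))) :=
        congrArg (coeff m) (h.mult_zero.trans h'.mult_zero.symm)
      have e1 : mult 1 (coeff m (lam (tagClass a b))) = mult 1 (coeff m (lam (tagClass a' b'))) :=
        congrArg (coeff m) (h.mult_one.trans h'.mult_one.symm)
      have s0 := congrArg (mult 0) step
      have s1 := congrArg (mult 1) step
      simp only [mult_add, mult_zero_tagCoeff, mult_one_tagCoeff, e0, e1] at s0 s1
      exact ⟨add_left_cancel s1, add_left_cancel s0⟩
  exact ⟨MvPowerSeries.ext fun m => (key m).1, MvPowerSeries.ext fun m => (key m).2⟩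

/-- The recursive construction of the coefficients of the solution. -/
def combiStep (m : Fin D →₀ ℕ) (v : (p : Fin D →₀ ℕ) → p < m → ℤ × ℤ) : ℤ × ℤ :=
  open Classical in
  let f : PS D := fun p => if h : p < m then tagCoeff (v p h).1 (v p h).2 else 0
  if m = 0 then 0 else
    (mult 1 (coeff m (lam f)) - coeff m (- ∑ i, X i), mult 0 (coeff m (lam f)) - coeff m 1)

theorem exists_isCombiPair (D : ℕ) :
    ∃ p : MvPowerSeries (Fin D) ℤ × MvPowerSeries (Fin D) ℤ, IsCombiPair p.1 p.2 := by
  classical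
  let v : (Fin D →₀ ℕ) → ℤ × ℤ := WellFounded.fix (wellFounded_lt) combiStep
  have hv : ∀ m, v m = combiStep m fun p _ => v p := fun m => WellFounded.fix_eq _ _ m
  let a : MvPowerSeries (Fin D) ℤ := fun m => (v m).1
  let b : MvPowerSeries (Fin D) ℤ := fun m => (v m).2
  have hv0 : v 0 = 0 := by rw [hv, combiStep]; simp
  have key : ∀ m : Fin D →₀ ℕ, mult 0 (coeff m (lam (tagClass a b))) = coeff m 1 ∧
      mult 1 (coeff m (lam (tagClass a b))) = coeff m (- ∑ i, X i) := by
    intro m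
    by_cases hm : m = 0
    · subst hm
      rw [coeff_lam_zero]
      constructor
      · simp [mult, ← T_zero]
      · simp [mult, ← T_zero]
    · let f : PS D := fun p => if p < m then tagCoeff (v p).1 (v p).2 else 0
      have hf : ∀ p, coeff p f = if p < m then tagCoeff (v p).1 (v p).2 else 0 := fun _ => rfl
      have hvm : v m
          = (mult 1 (coeff m (lam f)) - coeff m (- ∑ i, X i), mult 0 (coeff m (lam f)) - coeff m 1) := by
        rw [hv, combiStep, if_neg hm]
        rfl
      have step := coeff_lam_step (f := tagClass a b) (g := f) hm (fun p hp => by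
        rw [coeff_tagClass, hf, if_pos hp]; rfl)
      rw [hf m, if_neg (lt_irrefl m), add_zero, coeff_tagClass] at step
      have s0 := congrArg (mult 0) step
      have s1 := congrArg (mult 1) step
      rw [mult_add, mult_zero_tagCoeff] at s0
      rw [mult_add, mult_one_tagCoeff] at s1
      have ha : coeff m a = mult 1 (coeff m (lam f)) - coeff m (- ∑ i, X i) := congrArg Prod.fst hvm
      have hb : coeff m b = mult 0 (coeff m (lam f)) - coeff m 1 := congrArg Prod.snd hvm
      constructor <;> omega
  refine ⟨(a, b), ?_, ?_, ?_, ?_⟩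
  · exact congrArg Prod.fst hv0
  · exact congrArg Prod.snd hv0
  · exact MvPowerSeries.ext fun m => (key m).1
  · exact MvPowerSeries.ext fun m => (key m).2

/-- `A(D)`: the first component of the unique pair satisfying `IsCombiPair`. -/
def classA (D : ℕ) : MvPowerSeries (Fin D) ℤ := (exists_isCombiPair D).choose.1

/-- `B(D)`: the second component of the unique pair satisfying `IsCombiPair`. -/
def classB (D : ℕ) : MvPowerSeries (Fin D) ℤ := (exists_isCombiPair D).choose.2

theorem isCombiPair_iff (a b : MvPowerSeries (Fin D) ℤ) :
    IsCombiPair a b ↔ a = classA D ∧ b = classB D := by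
  have h := (exists_isCombiPair D).choose_spec
  exact ⟨fun h' => h'.unique h, by rintro ⟨rfl, rfl⟩; exact h⟩

end Combi

end FreeJordan

end

noncomputable section

namespace FreeJordan

universe u v

/-! ### Weights on the exterior algebra of a Lie algebra with a weighted basis -/

section ExtWeight

open ExteriorAlgebra Set.powersetCard

variable {K : Type*} [Field K] {𝔤 : Type*} [LieRing 𝔤] [LieAlgebra K 𝔤]
variable {I : Type*} [LinearOrder I] (b : Module.Basis I K 𝔤)

/-! Write 𝔤 = sl₂ J(D). It is graded by multidegree, with finite dimensional components and nothing
in degree 0, and sl₂ acts on it with weights -2, 0, 2 only. Hence Λ𝔤 splits, as a complex, into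
finite dimensional pieces. Expanding the product that defines λ shows that the coefficients of λ of
the character of 𝔤 are the Euler characteristics of these pieces (`coeff_lam_of_basis`,
`sum_alternating_extPiece`). The multiplicity of L(2n) is the difference of two neighbouring weight
dimensions, which by sl₂-theory is the dimension of a space of lowest weight vectors
(`finrank_lowest`). So the two multiplicities in the defining equations of A(D), B(D) are Euler
characteristics of complexes of lowest weight vectors (`mult_coeff_lam`).

The vanishing hypotheses make these complexes exact: for L(0) in every degree k ≥ 1, for L(2) in
every degree k ≥ 2 (`exists_tagLowest_zero`, `exists_tagLowest_one`). In multidegree m ≠ 0 the first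
Euler characteristic is therefore 0, and the second is minus the contribution of H₁. The latter is
found by hand: f(ab) is a boundary (`lowMap_mul_mem`), so only the generators survive, which gives
-(z₁ + ⋯ + z_D). Thus the dimension series of J(D) and 𝓑J(D) solve the equations
(`isCombiPair_series`), and the solution is unique.

It remains to replace 𝓑J(D) by Inner J(D), that is, to show that {ω} ↦ ∂_ω is injective
(`eq_zero_of_bPartial_eq_zero`). A homogeneous element of the kernel is a central element z of 𝔤
killed by sl₂. If z ≠ 0, the vanishing of the invariant homology lets one solve u₀ = 1, d uₖ₊₁ = z ∧
uₖ for ever (`exists_chain`). Take a linear form φ with φ(z) = 1. Contraction by the coboundary of φ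
leads from uₖ₊₁ back to uₖ, modulo boundaries and multiples of z, so its k-th power sends uₖ to an
element with scalar part 1. But φ may be chosen to live in one multidegree, and then its coboundary
has finite rank, so that for large k the scalar part is 0. This contradiction is
`eq_zero_of_central`. -/

theorem extBasis_empty : b.ExteriorAlgebra ∅ = 1 := by
  rw [ExteriorAlgebra.basis_apply_ofCard b (n := 0) Finset.card_empty]
  simp [ExteriorAlgebra.ιMulti_family]

theorem extBasis_singleton (i : I) : b.ExteriorAlgebra {i} = ι K (b i) := by
  rw [ExteriorAlgebra.basis_apply_ofCard b (n := 1) (Finset.card_singleton i)]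
  have : Set.powersetCard.ofFinEmbEquiv.symm (ofCard (Finset.card_singleton i)) 0 = i := by
    have := (mem_range_ofFinEmbEquiv_symm_iff_mem (ofCard (Finset.card_singleton i)) i).2
      (by rw [← mem_coe_iff]; simp)
    obtain ⟨j, hj⟩ := this
    rwa [Subsingleton.elim j 0] at hj
  simp [ExteriorAlgebra.ιMulti_family, this]

theorem ι_mul_extBasis_of_mem {i : I} {s : Finset I} (h : i ∈ s) :
    ι K (b i) * b.ExteriorAlgebra s = 0 := by
  rw [← extBasis_singleton]
  exact basis_mul_of_not_disjoint b (ofCard (Finset.card_singleton i)) (ofCard (s := s) rfl)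
    (by simpa using h)

/-- The sign is that of the permutation sorting i into s. It need not be known, since only
membership in subspaces is ever deduced. -/
theorem ι_mul_extBasis_of_notMem {i : I} {s : Finset I} (h : i ∉ s) :
    ι K (b i) * b.ExteriorAlgebra s = b.ExteriorAlgebra (insert i s) ∨
      ι K (b i) * b.ExteriorAlgebra s = - b.ExteriorAlgebra (insert i s) := by
  rw [← extBasis_singleton]
  have hd : Disjoint (ofCard (Finset.card_singleton i)).val (ofCard (s := s) rfl).val := by
    simpa using h
  have key := basis_mul_of_disjoint b (ofCard (Finset.card_singleton i)) (ofCard (s := s) rfl) hd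
  have e : (disjUnion hd).val = insert i s := by
    ext j
    have := mem_disjUnion (hst := hd) (a := j)
    rw [← mem_coe_iff] at this
    rw [this]
    simp [← mem_coe_iff]
  rw [val_ofCard, val_ofCard, e] at key
  rcases Int.units_eq_one_or (Equiv.Perm.sign (permOfDisjoint hd)) with h1 | h1
  · left; rw [key, h1, one_smul]
  · right; rw [key, h1, Units.neg_smul, one_smul]

variable {A : Type*} [AddCommMonoid A] (wt : I → A)

/-- The weight space of weight `a` in a space with a weighted basis. -/
def piece (a : A) : Submodule K 𝔤 := Submodule.span K (b '' {i | wt i = a})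

/-- The weight space of weight `a` in `Λᵏ𝔤`. -/
def extPiece (k : ℕ) (a : A) : Submodule K (ExteriorAlgebra K 𝔤) :=
  Submodule.span K (b.ExteriorAlgebra '' {s | s.card = k ∧ ∑ i ∈ s, wt i = a})

variable {b wt}

theorem basis_mem_piece (i : I) : b i ∈ piece b wt (wt i) := Submodule.subset_span ⟨i, rfl, rfl⟩

theorem extBasis_mem (s : Finset I) :
    b.ExteriorAlgebra s ∈ extPiece b wt s.card (∑ i ∈ s, wt i) :=
  Submodule.subset_span ⟨s, ⟨rfl, rfl⟩, rfl⟩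

theorem extPiece_le {k : ℕ} {a : A} {N : Submodule K (ExteriorAlgebra K 𝔤)}
    (h : ∀ s : Finset I, s.card = k → ∑ i ∈ s, wt i = a → b.ExteriorAlgebra s ∈ N) :
    extPiece b wt k a ≤ N := by
  rw [extPiece, Submodule.span_le]
  rintro _ ⟨s, ⟨h1, h2⟩, rfl⟩
  exact h s h1 h2

theorem ι_mul_mem {k : ℕ} {a a' : A} {x : 𝔤} {w : ExteriorAlgebra K 𝔤}
    (hx : x ∈ piece b wt a) (hw : w ∈ extPiece b wt k a') :
    ι K x * w ∈ extPiece b wt (k + 1) (a + a') := by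
  have h1 : ∀ i, wt i = a → extPiece b wt k a' ≤
      (extPiece b wt (k + 1) (a + a')).comap (LinearMap.mulLeft K (ι K (b i))) := by
    intro i hi
    refine extPiece_le fun s hs hs' => ?_
    rw [Submodule.mem_comap, LinearMap.mulLeft_apply]
    by_cases his : i ∈ s
    · rw [ι_mul_extBasis_of_mem b his]; exact zero_mem _
    have hm : b.ExteriorAlgebra (insert i s) ∈ extPiece b wt (k + 1) (a + a') := by
      have := extBasis_mem (b := b) (wt := wt) (insert i s)
      rwa [Finset.card_insert_of_notMem his, Finset.sum_insert his, hs, hs', hi] at this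
    rcases ι_mul_extBasis_of_notMem b his with h | h
    · rwa [h]
    · rw [h]; exact neg_mem hm
  suffices h2 : piece b wt a ≤ (extPiece b wt (k + 1) (a + a')).comap
      (LinearMap.mulRight K w ∘ₗ ι K) from h2 hx
  rw [piece, Submodule.span_le]
  rintro _ ⟨i, hi, rfl⟩
  exact h1 i hi hw

theorem one_mem_extPiece : (1 : ExteriorAlgebra K 𝔤) ∈ extPiece b wt 0 0 := by
  have := extBasis_mem (b := b) (wt := wt) ∅
  rwa [extBasis_empty, Finset.card_empty, Finset.sum_empty] at this

theorem ι_mem {a : A} {x : 𝔤} (hx : x ∈ piece b wt a) : ι K x ∈ extPiece b wt 1 a := by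
  have := ι_mul_mem hx (one_mem_extPiece (b := b) (wt := wt))
  rwa [mul_one, add_zero] at this

/-- Lets an induction on finite sets use the recursion formulas for ι x * w while ignoring the sign.
-/
theorem extBasis_insert_mem {N : Submodule K (ExteriorAlgebra K 𝔤)} {i : I} {s : Finset I}
    (hi : i ∉ s) (h : ι K (b i) * b.ExteriorAlgebra s ∈ N) :
    b.ExteriorAlgebra (insert i s) ∈ N := by
  rcases ι_mul_extBasis_of_notMem b hi with h' | h' <;> rw [h'] at h
  · exact h
  · exact neg_mem_iff.1 h

theorem piece_le {a : A} {N : Submodule K 𝔤} (h : ∀ i, wt i = a → b i ∈ N) :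
    piece b wt a ≤ N := by
  rw [piece, Submodule.span_le]
  rintro _ ⟨i, hi, rfl⟩
  exact h i hi

/-- By the Leibniz rule each term alters a single factor, so the total weight moves by c whatever
the number of factors. -/
theorem extDer_mem_extPiece {c : A} {δ : Module.End K 𝔤}
    (hδ : ∀ i, δ (b i) ∈ piece b wt (wt i + c)) {k : ℕ} {a : A} {w : ExteriorAlgebra K 𝔤}
    (hw : w ∈ extPiece b wt k a) : extDer K 𝔤 δ w ∈ extPiece b wt k (a + c) := by
  have key : ∀ s : Finset I, b.ExteriorAlgebra s ∈
      (extPiece b wt s.card (∑ i ∈ s, wt i + c)).comap (extDer K 𝔤 δ) := by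
    intro s
    induction s using Finset.induction_on with
    | empty => rw [extBasis_empty, Submodule.mem_comap, extDer_one]; exact zero_mem _
    | insert i s hi ih =>
      refine extBasis_insert_mem hi ?_
      rw [Submodule.mem_comap, extDer_ι_mul, Finset.card_insert_of_notMem hi, Finset.sum_insert hi]
      refine add_mem ?_ ?_
      · have := ι_mul_mem (hδ i) (extBasis_mem (wt := wt) s)
        rwa [add_right_comm] at this
      · have := ι_mul_mem (basis_mem_piece (wt := wt) i) ih
        rwa [← add_assoc] at this
  suffices h : extPiece b wt k a ≤ (extPiece b wt k (a + c)).comap (extDer K 𝔤 δ) from h hw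
  refine extPiece_le fun s hs hs' => ?_
  have := key s
  rwa [hs, hs'] at this

theorem ceD_extBasis_mem (hbr : ∀ i j, ⁅b i, b j⁆ ∈ piece b wt (wt i + wt j)) (s : Finset I) :
    ceD K 𝔤 (b.ExteriorAlgebra s) ∈ extPiece b wt (s.card - 1) (∑ i ∈ s, wt i) := by
  suffices key : b.ExteriorAlgebra s ∈
      (extPiece b wt (s.card - 1) (∑ i ∈ s, wt i)).comap (ceD K 𝔤) from key
  induction s using Finset.induction_on with
  | empty => rw [extBasis_empty, Submodule.mem_comap, ceD_one]; exact zero_mem _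
  | insert i s hi ih =>
    refine extBasis_insert_mem hi ?_
    rw [Submodule.mem_comap, ceD_ι_mul, Finset.card_insert_of_notMem hi, Finset.sum_insert hi,
      Nat.add_sub_cancel]
    refine sub_mem ?_ ?_
    · rw [add_comm]
      refine extDer_mem_extPiece (fun j => ?_) (extBasis_mem s)
      rw [LieAlgebra.ad_apply, add_comm]
      exact hbr i j
    -- For empty s the truncated `s.card - 1` is not one less than the cardinality; the term
    -- disappears anyway because d 1 = 0.
    · rcases s.eq_empty_or_nonempty with rfl | hs
      · rw [extBasis_empty, ceD_one, mul_zero]; exact zero_mem _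
      · have := ι_mul_mem (basis_mem_piece (wt := wt) i) (Submodule.mem_comap.1 ih)
        rwa [Nat.sub_add_cancel hs.card_pos] at this

theorem ceD_mem_extPiece (hbr : ∀ i j, ⁅b i, b j⁆ ∈ piece b wt (wt i + wt j)) {k : ℕ} {a : A}
    {w : ExteriorAlgebra K 𝔤} (hw : w ∈ extPiece b wt (k + 1) a) :
    ceD K 𝔤 w ∈ extPiece b wt k a := by
  suffices h : extPiece b wt (k + 1) a ≤ (extPiece b wt k a).comap (ceD K 𝔤) from h hw
  refine extPiece_le fun s hs hs' => ?_
  have := ceD_extBasis_mem hbr s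
  rwa [hs, hs', Nat.add_sub_cancel] at this

variable (b wt) in
open Classical in
/-- The projection of `Λ𝔤` onto the part of weight `a`. -/
def extProj (a : A) : Module.End K (ExteriorAlgebra K 𝔤) :=
  b.ExteriorAlgebra.constr K fun s => if ∑ i ∈ s, wt i = a then b.ExteriorAlgebra s else 0

theorem extProj_of_mem {k : ℕ} {a : A} {w : ExteriorAlgebra K 𝔤} (hw : w ∈ extPiece b wt k a) :
    extProj b wt a w = w := by
  suffices h : extPiece b wt k a ≤ LinearMap.eqLocus (extProj b wt a) LinearMap.id from h hw
  refine extPiece_le fun s _ hs' => ?_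
  rw [LinearMap.mem_eqLocus, extProj, Module.Basis.constr_basis, if_pos hs', LinearMap.id_apply]

theorem extProj_of_mem_of_ne {k : ℕ} {a a' : A} (h : a' ≠ a) {w : ExteriorAlgebra K 𝔤}
    (hw : w ∈ extPiece b wt k a') : extProj b wt a w = 0 := by
  suffices h : extPiece b wt k a' ≤ LinearMap.ker (extProj b wt a) from h hw
  refine extPiece_le fun s _ hs' => ?_
  rw [LinearMap.mem_ker, extProj, Module.Basis.constr_basis, if_neg (hs' ▸ h)]

/-- Holds because d preserves weights; it is what makes a preimage under d homogeneous. -/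
theorem ceD_extProj (hbr : ∀ i j, ⁅b i, b j⁆ ∈ piece b wt (wt i + wt j)) (a : A)
    (w : ExteriorAlgebra K 𝔤) :
    ceD K 𝔤 (extProj b wt a w) = extProj b wt a (ceD K 𝔤 w) := by
  suffices h : ceD K 𝔤 ∘ₗ extProj b wt a = extProj b wt a ∘ₗ ceD K 𝔤 from LinearMap.congr_fun h w
  refine b.ExteriorAlgebra.ext fun s => ?_
  rw [LinearMap.comp_apply, LinearMap.comp_apply]
  by_cases h : ∑ i ∈ s, wt i = a
  · rw [extProj_of_mem (h ▸ extBasis_mem s), extProj_of_mem (h ▸ ceD_extBasis_mem hbr s)]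
  · rw [extProj_of_mem_of_ne h (extBasis_mem s),
      extProj_of_mem_of_ne h (ceD_extBasis_mem hbr s), map_zero]

theorem extBasis_mem_exteriorPower (s : Finset I) :
    b.ExteriorAlgebra s ∈ ⋀[K]^s.card 𝔤 := by
  rw [ExteriorAlgebra.basis_apply]
  exact (exteriorPower.ιMulti_family K s.card b _).2

theorem extPiece_le_exteriorPower (k : ℕ) (a : A) : extPiece b wt k a ≤ ⋀[K]^k 𝔤 :=
  extPiece_le fun s hs _ => hs ▸ extBasis_mem_exteriorPower s

theorem exteriorPower_le (k : ℕ) :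
    ⋀[K]^k 𝔤 ≤ Submodule.span K (b.ExteriorAlgebra '' {s | s.card = k}) := by
  intro w hw
  have h := (b.exteriorPower k).span_eq.ge (Submodule.mem_top (x := ⟨w, hw⟩))
  have h2 := Submodule.mem_map_of_mem (f := (⋀[K]^k 𝔤).subtype) h
  rw [Submodule.map_span] at h2
  refine Submodule.span_mono ?_ h2
  rintro _ ⟨_, ⟨s, rfl⟩, rfl⟩
  exact ⟨s.1, s.2, by rw [basis_eq_coe_basis]; rfl⟩

theorem extProj_mem {k : ℕ} (a : A) {w : ExteriorAlgebra K 𝔤} (hw : w ∈ ⋀[K]^k 𝔤) :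
    extProj b wt a w ∈ extPiece b wt k a := by
  suffices h : Submodule.span K (b.ExteriorAlgebra '' {s | s.card = k}) ≤
      (extPiece b wt k a).comap (extProj b wt a) from h (exteriorPower_le k hw)
  rw [Submodule.span_le]
  rintro _ ⟨s, hs, rfl⟩
  rw [SetLike.mem_coe, Submodule.mem_comap]
  by_cases h : ∑ i ∈ s, wt i = a
  · have := extBasis_mem (b := b) (wt := wt) s
    rw [hs, h] at this
    rwa [extProj_of_mem this]
  · rw [extProj_of_mem_of_ne h (extBasis_mem s)]
    exact zero_mem _

theorem linearIndependent_extBasis_restrict (S : Set (Finset I)) :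
    LinearIndependent K (fun s : S => b.ExteriorAlgebra s) :=
  b.ExteriorAlgebra.linearIndependent.comp _ Subtype.val_injective

theorem finrank_extPiece (k : ℕ) (a : A) :
    Module.finrank K (extPiece b wt k a)
      = Nat.card {s : Finset I // s.card = k ∧ ∑ i ∈ s, wt i = a} := by
  have h := linearIndependent_extBasis_restrict (b := b)
    {s : Finset I | s.card = k ∧ ∑ i ∈ s, wt i = a}
  rw [extPiece, Set.image_eq_range]
  exact Module.finrank_eq_nat_card_basis (Module.Basis.span h)

theorem extPiece_finite {k : ℕ} {a : A}
    (h : {s : Finset I | s.card = k ∧ ∑ i ∈ s, wt i = a}.Finite) :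
    Module.Finite K (extPiece b wt k a) :=
  Module.Finite.span_of_finite K (h.image _)

end ExtWeight

/-! ### Vectors of negative weight in representations of `sl₂` -/

/-- From F E y = 0 the commutation relation gives E Fᵏ⁺¹ y = (k + 1)(μ - k) Fᵏ y, and the
coefficient is nonzero since μ < 0 ≤ k. So Fᵏ⁺¹ y = 0 forces Fᵏ y = 0, and one descends from N to 0.
This gives the injectivity of F E on negative weight spaces without any appeal to complete
reducibility. -/
theorem eq_zero_of_lower_raise_eq_zero {K : Type*} [Field K] [CharZero K] {V : Type*}
    [AddCommGroup V] [Module K V] {E F H : Module.End K V}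
    (hEF : ∀ v, E (F v) = F (E v) + H v) {y : V} {μ : ℤ} (hμ : μ < 0)
    (hH : ∀ k : ℕ, H ((F ^ k) y) = ((μ - 2 * k : ℤ) : K) • (F ^ k) y) (hy : F (E y) = 0)
    {N : ℕ} (hN : (F ^ N) y = 0) : y = 0 := by
  have key : ∀ k : ℕ, E ((F ^ (k + 1)) y) = (((k + 1) * (μ - k) : ℤ) : K) • (F ^ k) y := by
    intro k
    induction k with
    | zero =>
      have := hH 0
      rw [zero_add, pow_one, hEF, hy, zero_add]
      simpa using this
    | succ k ih =>
      rw [pow_succ', Module.End.mul_apply, hEF, ih, hH, map_smul, ← Module.End.mul_apply,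
        ← pow_succ', ← add_smul]
      congr 1
      push_cast
      ring
  induction N with
  | zero => simpa using hN
  | succ k ih =>
    refine ih ?_
    have h := key k
    rw [hN, map_zero] at h
    refine (smul_eq_zero.1 h.symm).resolve_left ?_
    have : ((k + 1) * (μ - k) : ℤ) ≠ 0 := mul_ne_zero (by omega) (by omega)
    exact_mod_cast this

/-! ### The exterior algebra of a graded Lie algebra with an action of `sl₂` of types `L(0)`, `L(2)` -/

section Sl2Graded

variable {K : Type*} [Field K] [CharZero K] {𝔤 : Type*} [LieRing 𝔤] [LieAlgebra K 𝔤]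
variable {I : Type*} [LinearOrder I] {D : ℕ}

/-- `b` is a basis of `𝔤` consisting of vectors of weights `wt i = (m, j)`, where `m` is a nonzero
multidegree and `2 j ∈ {-2, 0, 2}` is the weight for the action of `sl₂` by the derivations
`e`, `f`, `h`. -/
structure IsSl2Graded (b : Module.Basis I K 𝔤) (wt : I → (Fin D →₀ ℕ) × ℤ)
    (e f h : LieDerivation K 𝔤 𝔤) : Prop where
  bracket : ∀ i j, ⁅b i, b j⁆ ∈ piece b wt (wt i + wt j)
  ne_zero : ∀ i, (wt i).1 ≠ 0
  finite : ∀ m, {i | (wt i).1 ≤ m}.Finite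
  small : ∀ i, |(wt i).2| ≤ 1
  e_mem : ∀ i, (e : Module.End K 𝔤) (b i) ∈ piece b wt (wt i + (0, 1))
  f_mem : ∀ i, (f : Module.End K 𝔤) (b i) ∈ piece b wt (wt i + (0, -1))
  h_eq : ∀ i, (h : Module.End K 𝔤) (b i) = ((2 * (wt i).2 : ℤ) : K) • b i
  lie_ef : ⁅(e : Module.End K 𝔤), (f : Module.End K 𝔤)⁆ = h

variable (K) in
/-- The action of a derivation of `𝔤` on `Λ𝔤`. -/
abbrev extAct (δ : LieDerivation K 𝔤 𝔤) : Module.End K (ExteriorAlgebra K 𝔤) :=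
  extDer K 𝔤 (δ : Module.End K 𝔤)

variable {b : Module.Basis I K 𝔤} {wt : I → (Fin D →₀ ℕ) × ℤ} {e f h : LieDerivation K 𝔤 𝔤}

variable (b wt f) in
/-- The space of lowest weight vectors of weight `-2n` and multidegree `m` in `Λᵏ𝔤`. -/
def lowest (n k : ℕ) (m : Fin D →₀ ℕ) : Submodule K (ExteriorAlgebra K 𝔤) :=
  extPiece b wt k (m, -(n : ℤ)) ⊓ LinearMap.ker (extAct K f)

namespace IsSl2Graded

variable (G : IsSl2Graded b wt e f h)
include G

theorem e_mem_extPiece {k : ℕ} {m : Fin D →₀ ℕ} {j : ℤ} {w : ExteriorAlgebra K 𝔤}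
    (hw : w ∈ extPiece b wt k (m, j)) : extAct K e w ∈ extPiece b wt k (m, j + 1) := by
  have := extDer_mem_extPiece G.e_mem hw
  rwa [Prod.mk_add_mk, add_zero] at this

theorem f_mem_extPiece {k : ℕ} {m : Fin D →₀ ℕ} {j : ℤ} {w : ExteriorAlgebra K 𝔤}
    (hw : w ∈ extPiece b wt k (m, j)) : extAct K f w ∈ extPiece b wt k (m, j - 1) := by
  have := extDer_mem_extPiece G.f_mem hw
  rwa [Prod.mk_add_mk, add_zero] at this

theorem h_apply {k : ℕ} {m : Fin D →₀ ℕ} {j : ℤ} {w : ExteriorAlgebra K 𝔤}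
    (hw : w ∈ extPiece b wt k (m, j)) : extAct K h w = ((2 * j : ℤ) : K) • w := by
  have key : ∀ s : Finset I, b.ExteriorAlgebra s ∈ LinearMap.eqLocus (extAct K h)
      (((2 * (∑ i ∈ s, wt i).2 : ℤ) : K) • LinearMap.id) := by
    intro s
    induction s using Finset.induction_on with
    | empty => rw [extBasis_empty, LinearMap.mem_eqLocus, extDer_one]; simp
    | insert i s hi ih =>
      refine extBasis_insert_mem hi ?_
      rw [LinearMap.mem_eqLocus] at ih ⊢
      rw [extDer_ι_mul, ih, G.h_eq, Finset.sum_insert hi]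
      simp only [LinearMap.smul_apply, LinearMap.id_apply, map_smul, smul_mul_assoc,
        mul_smul_comm, ← add_smul, Prod.snd_add]
      congr 1
      push_cast
      ring
  suffices hle : extPiece b wt k (m, j) ≤ LinearMap.eqLocus (extAct K h)
      (((2 * j : ℤ) : K) • LinearMap.id) from hle hw
  refine extPiece_le fun s _ hs' => ?_
  have := key s
  rwa [hs'] at this

theorem e_f_apply (w : ExteriorAlgebra K 𝔤) :
    extAct K e (extAct K f w) = extAct K f (extAct K e w) + extAct K h w := by
  have := LinearMap.congr_fun (extDer_lie K 𝔤 (e : Module.End K 𝔤) (f : Module.End K 𝔤)) w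
  rw [G.lie_ef, Ring.lie_def, LinearMap.sub_apply, Module.End.mul_apply, Module.End.mul_apply] at this
  rw [this]
  abel

theorem abs_snd_sum_le (s : Finset I) : |(∑ i ∈ s, wt i).2| ≤ s.card := by
  rw [Prod.snd_sum]
  refine (Finset.abs_sum_le_sum_abs _ _).trans ?_
  refine (Finset.sum_le_card_nsmul s _ 1 fun i _ => G.small i).trans ?_
  simp

/-- Every factor has degree at least one. Consequently only finitely many exterior powers meet a
given multidegree, and the alternating sums are finite. -/
theorem card_le_degree (s : Finset I) : s.card ≤ (∑ i ∈ s, wt i).1.degree := by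
  rw [Prod.fst_sum, map_sum, Finset.card_eq_sum_ones]
  refine Finset.sum_le_sum fun i _ => ?_
  have := G.ne_zero i
  rw [ne_eq, ← Finsupp.degree_eq_zero_iff] at this
  omega

theorem extPiece_eq_bot_of_abs {k : ℕ} {m : Fin D →₀ ℕ} {j : ℤ} (hj : (k : ℤ) < |j|) :
    extPiece b wt k (m, j) = ⊥ := by
  rw [eq_bot_iff]
  refine extPiece_le fun s hs hs' => ?_
  have := G.abs_snd_sum_le s
  rw [hs, hs'] at this
  exact absurd this (not_le.2 hj)

theorem extPiece_eq_bot_of_degree {k : ℕ} {m : Fin D →₀ ℕ} {j : ℤ} (hk : m.degree < k) :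
    extPiece b wt k (m, j) = ⊥ := by
  rw [eq_bot_iff]
  refine extPiece_le fun s hs hs' => ?_
  have := G.card_le_degree s
  rw [hs, hs'] at this
  exact absurd this (not_le.2 hk)

theorem subset_of_sum_eq {m : Fin D →₀ ℕ} {s : Finset I} (hs : (∑ i ∈ s, wt i).1 = m) :
    s ⊆ (G.finite m).toFinset := by
  intro i hi
  rw [Set.Finite.mem_toFinset, Set.mem_ofPred_eq, ← hs, Prod.fst_sum]
  exact Finset.single_le_sum (f := fun i => (wt i).1) (fun _ _ => zero_le) hi

theorem finite_extPiece (k : ℕ) (m : Fin D →₀ ℕ) (j : ℤ) :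
    Module.Finite K (extPiece b wt k (m, j)) := by
  refine extPiece_finite (((G.finite m).toFinset.powerset).finite_toSet.subset ?_)
  rintro s ⟨_, hs⟩
  exact Finset.mem_coe.2 (Finset.mem_powerset.2 (G.subset_of_sum_eq (by rw [hs])))

theorem f_pow_mem {k : ℕ} {m : Fin D →₀ ℕ} {j : ℤ} {w : ExteriorAlgebra K 𝔤}
    (hw : w ∈ extPiece b wt k (m, j)) (N : ℕ) :
    (extAct K f ^ N) w ∈ extPiece b wt k (m, j - N) := by
  induction N with
  | zero => simpa using hw
  | succ N ih =>
    rw [pow_succ', Module.End.mul_apply]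
    have := G.f_mem_extPiece ih
    rwa [sub_sub, ← Nat.cast_succ] at this

theorem e_pow_mem {k : ℕ} {m : Fin D →₀ ℕ} {j : ℤ} {w : ExteriorAlgebra K 𝔤}
    (hw : w ∈ extPiece b wt k (m, j)) (N : ℕ) :
    (extAct K e ^ N) w ∈ extPiece b wt k (m, j + N) := by
  induction N with
  | zero => simpa using hw
  | succ N ih =>
    rw [pow_succ', Module.End.mul_apply]
    have := G.e_mem_extPiece ih
    rwa [add_assoc, ← Nat.cast_succ] at this

/-- In Λᵏ the half-weights lie between -k and k, so k + 1 lowerings of a vector of negative weight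
leave this range; this provides the nilpotency needed. -/
theorem eq_zero_of_neg {k : ℕ} {m : Fin D →₀ ℕ} {j : ℤ} (hj : j < 0) {w : ExteriorAlgebra K 𝔤}
    (hw : w ∈ extPiece b wt k (m, j)) (h0 : extAct K f (extAct K e w) = 0) : w = 0 := by
  refine eq_zero_of_lower_raise_eq_zero (H := extAct K h) G.e_f_apply
    (mul_neg_of_pos_of_neg (two_pos : (0 : ℤ) < 2) hj) (fun N => ?_) h0 (N := k + 1) ?_
  · rw [G.h_apply (G.f_pow_mem hw N), mul_sub]
  · have h1 := G.f_pow_mem hw (k + 1)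
    rw [G.extPiece_eq_bot_of_abs] at h1
    · exact (Submodule.mem_bot K).1 h1
    · rw [abs_of_neg (by omega)]; push_cast; omega

/-- The mirror image: (f, e, -h) is again an sl₂-triple. -/
theorem eq_zero_of_pos {k : ℕ} {m : Fin D →₀ ℕ} {j : ℤ} (hj : 0 < j) {w : ExteriorAlgebra K 𝔤}
    (hw : w ∈ extPiece b wt k (m, j)) (h0 : extAct K e (extAct K f w) = 0) : w = 0 := by
  refine eq_zero_of_lower_raise_eq_zero (E := extAct K f) (F := extAct K e) (H := -extAct K h)
    (fun v => ?_) (mul_neg_of_neg_of_pos (by norm_num : (-2 : ℤ) < 0) hj) (fun N => ?_) h0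
    (N := k + 1) ?_
  · rw [G.e_f_apply, LinearMap.neg_apply]; abel
  · rw [LinearMap.neg_apply, G.h_apply (G.e_pow_mem hw N), ← neg_smul]
    congr 1
    push_cast
    ring
  · have h1 := G.e_pow_mem hw (k + 1)
    rw [G.extPiece_eq_bot_of_abs] at h1
    · exact (Submodule.mem_bot K).1 h1
    · rw [abs_of_pos (by omega)]; push_cast; omega

/-- On a finite dimensional space of negative weight the endomorphism f e is injective, hence
surjective. -/
theorem exists_lower_raise_eq (n k : ℕ) (m : Fin D →₀ ℕ) {w : ExteriorAlgebra K 𝔤}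
    (hw : w ∈ extPiece b wt k (m, -(n : ℤ) - 1)) :
    ∃ y ∈ extPiece b wt k (m, -(n : ℤ) - 1), extAct K f (extAct K e y) = w := by
  have hmaps : ∀ y ∈ extPiece b wt k (m, -(n : ℤ) - 1),
      (extAct K f ∘ₗ extAct K e) y ∈ extPiece b wt k (m, -(n : ℤ) - 1) := by
    intro y hy
    have := G.f_mem_extPiece (G.e_mem_extPiece hy)
    rwa [add_sub_cancel_right] at this
  have := G.finite_extPiece k m (-(n : ℤ) - 1)
  have hinj : Function.Injective ((extAct K f ∘ₗ extAct K e).restrict hmaps) := by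
    rw [← LinearMap.ker_eq_bot, LinearMap.ker_eq_bot']
    rintro ⟨y, hy⟩ h0
    exact Subtype.ext (G.eq_zero_of_neg (by omega) hy (congrArg Subtype.val h0))
  obtain ⟨y, hy⟩ := LinearMap.injective_iff_surjective.1 hinj ⟨w, hw⟩
  exact ⟨y.1, y.2, congrArg Subtype.val hy⟩

/-- Choose y with f e y = f u; then f kills u - e y. -/
theorem exists_decomp {n k : ℕ} {m : Fin D →₀ ℕ} {u : ExteriorAlgebra K 𝔤}
    (hu : u ∈ extPiece b wt k (m, -(n : ℤ))) :
    ∃ y ∈ extPiece b wt k (m, -(n : ℤ) - 1), u - extAct K e y ∈ lowest b wt f n k m := by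
  obtain ⟨y, hy, hy'⟩ := G.exists_lower_raise_eq n k m (G.f_mem_extPiece hu)
  refine ⟨y, hy, sub_mem hu ?_, ?_⟩
  · have := G.e_mem_extPiece hy
    rwa [sub_add_cancel] at this
  · rw [SetLike.mem_coe, LinearMap.mem_ker, map_sub, hy', sub_self]

/-- Rank-nullity for f between two neighbouring weight spaces: it is onto, because f e already is,
and its kernel consists of the lowest weight vectors. -/
theorem finrank_lowest (n k : ℕ) (m : Fin D →₀ ℕ) :
    (Module.finrank K (lowest b wt f n k m) : ℤ)
      = Module.finrank K (extPiece b wt k (m, -(n : ℤ)))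
        - Module.finrank K (extPiece b wt k (m, -(n : ℤ) - 1)) := by
  have := G.finite_extPiece k m (-(n : ℤ))
  have h1 := LinearMap.finrank_range_add_finrank_ker
    ((extAct K f).domRestrict (extPiece b wt k (m, -(n : ℤ))))
  have h2 : LinearMap.range ((extAct K f).domRestrict (extPiece b wt k (m, -(n : ℤ))))
      = extPiece b wt k (m, -(n : ℤ) - 1) := by
    refine le_antisymm ?_ fun w hw => ?_
    · rintro _ ⟨⟨u, hu⟩, rfl⟩
      exact G.f_mem_extPiece hu
    · obtain ⟨y, hy, hy'⟩ := G.exists_lower_raise_eq n k m hw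
      have := G.e_mem_extPiece hy
      rw [sub_add_cancel] at this
      exact ⟨⟨_, this⟩, hy'⟩
  have h3 : (LinearMap.ker ((extAct K f).domRestrict (extPiece b wt k (m, -(n : ℤ))))).map
      (extPiece b wt k (m, -(n : ℤ))).subtype = lowest b wt f n k m := by
    rw [LinearMap.ker_domRestrict, Submodule.map_comap_subtype]; rfl
  have h4 := (Submodule.equivMapOfInjective _
    (extPiece b wt k (m, -(n : ℤ))).injective_subtype
    (LinearMap.ker ((extAct K f).domRestrict (extPiece b wt k (m, -(n : ℤ)))))).finrank_eq
  rw [h3] at h4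
  rw [h2, h4] at h1
  omega

/-- Exactness passes from Λ𝔤 to lowest weight vectors: a given preimage is projected to the right
weight and then corrected by some e y with y of negative weight. -/
theorem exists_lowest_of_ceD_eq {n k : ℕ} {m : Fin D →₀ ℕ} {w u : ExteriorAlgebra K 𝔤}
    (hw : w ∈ lowest b wt f n k m) (hu : u ∈ ⋀[K]^(k + 1) 𝔤) (huw : ceD K 𝔤 u = w) :
    ∃ u' ∈ lowest b wt f n (k + 1) m, ceD K 𝔤 u' = w := by
  have hu' := extProj_mem (b := b) (wt := wt) (m, -(n : ℤ)) hu
  have huw' : ceD K 𝔤 (extProj b wt (m, -(n : ℤ)) u) = w := by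
    rw [ceD_extProj G.bracket, huw, extProj_of_mem hw.1]
  obtain ⟨y, hy, hy'⟩ := G.exists_decomp hu'
  refine ⟨_, hy', ?_⟩
  -- The correction does not change the boundary: f e (d y) = d (f u) = f w = 0 for the projected u,
  -- and f e is injective on negative weights, so d y = 0.
  have hdy : ceD K 𝔤 y = 0 := by
    refine G.eq_zero_of_neg (by omega) (ceD_mem_extPiece G.bracket hy) ?_
    have h1 := congrArg (ceD K 𝔤) (LinearMap.mem_ker.1 hy'.2)
    rw [map_sub, map_sub, ceD_extDer K 𝔤 f (extProj b wt _ u), huw', LinearMap.mem_ker.1 hw.2,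
      map_zero, zero_sub, neg_eq_zero] at h1
    rw [← ceD_extDer, ← ceD_extDer, h1]
  rw [map_sub, huw', ceD_extDer, hdy, map_zero, sub_zero]

theorem ceD_mem_lowest {n k : ℕ} {m : Fin D →₀ ℕ} {u : ExteriorAlgebra K 𝔤}
    (hu : u ∈ lowest b wt f n (k + 1) m) : ceD K 𝔤 u ∈ lowest b wt f n k m := by
  refine ⟨ceD_mem_extPiece G.bracket hu.1, ?_⟩
  have := LinearMap.mem_ker.1 hu.2
  rw [SetLike.mem_coe, LinearMap.mem_ker, ← ceD_extDer, this, map_zero]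

/-- For weight 0, f e w = e f w - h w = 0, and e w has positive weight. So lowest weight vectors of
weight 0 are invariants. -/
theorem e_apply_of_lowest_zero {k : ℕ} {m : Fin D →₀ ℕ} {w : ExteriorAlgebra K 𝔤}
    (hw : w ∈ lowest b wt f 0 k m) : extAct K e w = 0 := by
  refine G.eq_zero_of_pos (j := -((0 : ℕ) : ℤ) + 1) (by norm_num) (G.e_mem_extPiece hw.1) ?_
  have h1 := G.e_f_apply w
  rw [G.h_apply hw.1, LinearMap.mem_ker.1 hw.2, map_zero] at h1
  have : extAct K f (extAct K e w) = 0 := by simpa using h1.symm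
  rw [this, map_zero]

theorem h_apply_of_lowest_zero {k : ℕ} {m : Fin D →₀ ℕ} {w : ExteriorAlgebra K 𝔤}
    (hw : w ∈ lowest b wt f 0 k m) : extAct K h w = 0 := by
  rw [G.h_apply hw.1]; simp

/-- The vectors w, e w, e e w satisfy the relations of the adjoint module; these are exactly the
relations that make `adjMap` equivariant. -/
theorem lowest_one_relations {k : ℕ} {m : Fin D →₀ ℕ} {w : ExteriorAlgebra K 𝔤}
    (hw : w ∈ lowest b wt f 1 k m) :
    extAct K h w = (-2 : K) • w ∧ extAct K h (extAct K e w) = 0 ∧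
    extAct K h (extAct K e (extAct K e w)) = (2 : K) • extAct K e (extAct K e w) ∧
    extAct K f (extAct K e w) = (2 : K) • w ∧
    extAct K f (extAct K e (extAct K e w)) = (2 : K) • extAct K e w ∧
    extAct K e (extAct K e (extAct K e w)) = 0 := by
  have hf := LinearMap.mem_ker.1 hw.2
  have h0 : extAct K h w = (-2 : K) • w := by rw [G.h_apply hw.1]; simp
  have m1 := G.e_mem_extPiece hw.1
  have m2 := G.e_mem_extPiece m1
  have m3 := G.e_mem_extPiece m2
  have h1 : extAct K h (extAct K e w) = 0 := by rw [G.h_apply m1]; simp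
  have h2 : extAct K h (extAct K e (extAct K e w)) = (2 : K) • extAct K e (extAct K e w) := by
    rw [G.h_apply m2]; simp
  have f1 : extAct K f (extAct K e w) = (2 : K) • w := by
    have := G.e_f_apply w
    rw [hf, map_zero, h0] at this
    rw [eq_neg_of_add_eq_zero_left this.symm]; module
  have f2 : extAct K f (extAct K e (extAct K e w)) = (2 : K) • extAct K e w := by
    have := G.e_f_apply (extAct K e w)
    rw [h1, add_zero, f1, map_smul] at this
    exact this.symm
  refine ⟨h0, h1, h2, f1, f2, G.eq_zero_of_pos (by norm_num) m3 ?_⟩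
  have := G.e_f_apply (extAct K e (extAct K e w))
  rw [f2, h2, map_smul] at this
  rw [add_eq_right.1 this.symm, map_zero]

end IsSl2Graded

end Sl2Graded

/-! ### Alternating sums of dimensions -/

section Euler

/-- Here c stands for the dimensions of the terms of a complex, r for the ranks of the differentials
and δ for the homology; the ranks telescope. -/
theorem sum_alternating_of_eq {c r δ : ℕ → ℤ} (h : ∀ k, c k = r k + r (k + 1) + δ k) (N : ℕ) :
    ∑ k ∈ Finset.range N, (-1) ^ k * c k
      = r 0 - (-1) ^ N * r N + ∑ k ∈ Finset.range N, (-1) ^ k * δ k := by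
  induction N with
  | zero => simp
  | succ N ih =>
    rw [Finset.sum_range_succ, Finset.sum_range_succ, ih, h N]
    ring

/-- Rank-nullity on C, with the kernel identified with the image of C' by exactness. -/
theorem finrank_eq_of_exact {K V : Type*} [Field K] [AddCommGroup V] [Module K V]
    (d : Module.End K V) (C C' : Submodule K V) [Module.Finite K C]
    (h : ∀ w ∈ C, d w = 0 → ∃ u ∈ C', d u = w) (h' : ∀ u ∈ C', d u ∈ C ∧ d (d u) = 0) :
    Module.finrank K C = Module.finrank K (C.map d) + Module.finrank K (C'.map d) := by
  have h1 := LinearMap.finrank_range_add_finrank_ker (d.domRestrict C)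
  have h2 : LinearMap.range (d.domRestrict C) = C.map d := LinearMap.range_domRestrict C d
  have h3 : (LinearMap.ker (d.domRestrict C)).map C.subtype = C'.map d := by
    rw [LinearMap.ker_domRestrict, Submodule.map_comap_subtype]
    ext w
    constructor
    · rintro ⟨hw, hw'⟩
      obtain ⟨u, hu, rfl⟩ := h w hw hw'
      exact ⟨u, hu, rfl⟩
    · rintro ⟨u, hu, rfl⟩
      exact h' u hu
  have h4 := (Submodule.equivMapOfInjective _ C.injective_subtype
    (LinearMap.ker (d.domRestrict C))).finrank_eq
  rw [h3] at h4
  rw [h2, h4] at h1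
  exact h1.symm

/-! ### Euler characteristics of the complexes of lowest weight vectors. -/

variable {K : Type*} [Field K] [CharZero K] {𝔤 : Type*} [LieRing 𝔤] [LieAlgebra K 𝔤]
variable {I : Type*} [LinearOrder I] {D : ℕ}
variable {b : Module.Basis I K 𝔤} {wt : I → (Fin D →₀ ℕ) × ℤ} {e f h : LieDerivation K 𝔤 𝔤}

namespace IsSl2Graded

variable (G : IsSl2Graded b wt e f h)
include G

theorem finite_lowest (n k : ℕ) (m : Fin D →₀ ℕ) : Module.Finite K (lowest b wt f n k m) := by
  have := G.finite_extPiece k m (-(n : ℤ))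
  exact Submodule.finiteDimensional_of_le
    (inf_le_left : lowest b wt f n k m ≤ extPiece b wt k (m, -(n : ℤ)))

theorem lowest_eq_bot_of_degree {n k : ℕ} {m : Fin D →₀ ℕ} (hk : m.degree < k) :
    lowest b wt f n k m = ⊥ := by
  rw [lowest, G.extPiece_eq_bot_of_degree hk, bot_inf_eq]

omit G in
theorem lowest_zero_eq_bot {n : ℕ} {m : Fin D →₀ ℕ} (hm : m ≠ 0) :
    lowest b wt f n 0 m = ⊥ := by
  rw [eq_bot_iff]
  refine inf_le_left.trans (extPiece_le fun s hs hs' => ?_)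
  rw [Finset.card_eq_zero.1 hs, Finset.sum_empty] at hs'
  exact absurd (congrArg Prod.fst hs').symm hm

theorem finrank_lowest_eq {n k : ℕ} {m : Fin D →₀ ℕ}
    (hex : ∀ w ∈ lowest b wt f n k m, ceD K 𝔤 w = 0 → ∃ u ∈ lowest b wt f n (k + 1) m, ceD K 𝔤 u = w) :
    (Module.finrank K (lowest b wt f n k m) : ℤ)
      = Module.finrank K ((lowest b wt f n k m).map (ceD K 𝔤))
        + Module.finrank K ((lowest b wt f n (k + 1) m).map (ceD K 𝔤)) := by
  have := G.finite_lowest n k m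
  exact_mod_cast finrank_eq_of_exact (ceD K 𝔤) _ _ hex
    fun u hu => ⟨G.ceD_mem_lowest hu, ceD_ceD K 𝔤 u⟩

/-- Exactness is required only from k = 2 on. The term k = 0 is zero because m ≠ 0, and d is zero on
the term k = 1, so the sum is minus the dimension of the homology in degree 1. -/
theorem sum_alternating_lowest {n : ℕ} {m : Fin D →₀ ℕ} (hm : m ≠ 0)
    (hex : ∀ k, 2 ≤ k → ∀ w ∈ lowest b wt f n k m, ceD K 𝔤 w = 0 →
      ∃ u ∈ lowest b wt f n (k + 1) m, ceD K 𝔤 u = w) :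
    ∑ k ∈ Finset.range (m.degree + 1), (-1) ^ k * (Module.finrank K (lowest b wt f n k m) : ℤ)
      = (Module.finrank K ((lowest b wt f n 2 m).map (ceD K 𝔤)) : ℤ)
        - Module.finrank K (lowest b wt f n 1 m) := by
  set c : ℕ → ℤ := fun k => Module.finrank K (lowest b wt f n k m) with hc
  set r : ℕ → ℤ := fun k => Module.finrank K ((lowest b wt f n k m).map (ceD K 𝔤)) with hr
  have hd1 : (lowest b wt f n 1 m).map (ceD K 𝔤) = ⊥ := by
    rw [eq_bot_iff, ← lowest_zero_eq_bot (b := b) (wt := wt) (f := f) (n := n) hm]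
    rintro _ ⟨u, hu, rfl⟩
    exact G.ceD_mem_lowest hu
  have hbot : ∀ S : Submodule K (ExteriorAlgebra K 𝔤), S = ⊥ → (Module.finrank K S : ℤ) = 0 := by
    rintro _ rfl
    rw [finrank_bot, Nat.cast_zero]
  have h0 : c 0 = 0 := hbot _ (lowest_zero_eq_bot hm)
  have hr0 : r 0 = 0 := hbot _ (by rw [lowest_zero_eq_bot hm, Submodule.map_bot])
  have hr1 : r 1 = 0 := hbot _ hd1
  have hrN : r (m.degree + 1) = 0 :=
    hbot _ (by rw [G.lowest_eq_bot_of_degree (Nat.lt_succ_self _), Submodule.map_bot])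
  have hdeg : 1 ≤ m.degree := by
    rw [ne_eq, ← Finsupp.degree_eq_zero_iff] at hm
    omega
  -- The defect δ is concentrated at k = 1, where c 1 - r 2 is the dimension of the cycles modulo
  -- the boundaries.
  rw [sum_alternating_of_eq (c := c) (r := r) (δ := fun k => if k = 1 then c 1 - r 2 else 0)
    (fun k => ?_), hr0, hrN, Finset.sum_eq_single 1]
  · simp [hc, hr]
  · intro k _ hk
    rw [if_neg hk, mul_zero]
  · intro h1
    exact absurd (Finset.mem_range.2 (by omega)) h1
  · rcases k with _ | _ | k
    · simp [h0, hr0, hr1]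
    · simp [hr1]
    · rw [if_neg (by omega), add_zero]
      exact G.finrank_lowest_eq (hex (k + 2) (by omega))

theorem finrank_extPiece_eq_card (k : ℕ) (m : Fin D →₀ ℕ) (j : ℤ) :
    Module.finrank K (extPiece b wt k (m, j))
      = (((G.finite m).toFinset.powerset.filter fun s => ∑ i ∈ s, wt i = (m, j)).filter
          fun s => s.card = k).card := by
  rw [finrank_extPiece]
  refine Nat.subtype_card _ fun s => ?_
  rw [Finset.mem_filter, Finset.mem_filter, Finset.mem_powerset]
  exact ⟨fun hs => ⟨hs.2, hs.1.2⟩,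
    fun hs => ⟨⟨G.subset_of_sum_eq (by rw [hs.2]), hs.2⟩, hs.1⟩⟩

/-- The weight pieces have bases indexed by finite sets of indices; the right-hand side groups these
sets by total weight instead of cardinality. -/
theorem sum_alternating_extPiece (m : Fin D →₀ ℕ) (j : ℤ) :
    ∑ k ∈ Finset.range (m.degree + 1), (-1) ^ k * (Module.finrank K (extPiece b wt k (m, j)) : ℤ)
      = ∑ s ∈ (G.finite m).toFinset.powerset with ∑ i ∈ s, wt i = (m, j), (-1) ^ s.card := by
  rw [← Finset.sum_fiberwise_of_maps_to (g := Finset.card) (t := Finset.range (m.degree + 1))]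
  · refine Finset.sum_congr rfl fun k _ => ?_
    rw [G.finrank_extPiece_eq_card, Finset.sum_congr rfl fun s hs => by
      rw [(Finset.mem_filter.1 hs).2], Finset.sum_const, nsmul_eq_mul, mul_comm]
  · intro s hs
    have h1 := (Finset.mem_filter.1 hs).2
    have := G.card_le_degree s
    rw [h1] at this
    exact Finset.mem_range.2 (Nat.lt_succ_of_le this)

end IsSl2Graded

end Euler

/-! ### The operation `λ` on the character of a space with a weighted basis -/

section Lambda

open LaurentPolynomial MvPowerSeries

variable {D : ℕ} {I : Type*} {wt : I → (Fin D →₀ ℕ) × ℤ} {c : PS D}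

/-- An effective class has empty negative part, so the denominator in λ is 1. -/
theorem lam_eq_lamPos (hc : ∀ p j, 0 ≤ (coeff p c).coeff j) : lam c = lamPos c := by
  have h1 : lamPos (-c) = 1 := by
    ext1 m
    change coeff m (∏ p ∈ (Finset.Iic m).erase 0, lamFactor p (coeff p (-c))) = _
    rw [Finset.prod_eq_one]
    intro p _
    refine Finset.prod_eq_one fun j _ => ?_
    have := hc p j
    rw [map_neg, AddMonoidAlgebra.coeff_neg, Finsupp.neg_apply, Int.toNat_of_nonpos (by omega),
      pow_zero]
  have h2 := mul_invOfUnit (1 : PS D) 1 (by simp)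
  rw [one_mul] at h2
  rw [lam, h1, h2, mul_one]

theorem prod_neg_monomial (s : Finset I) :
    ∏ i ∈ s, (-(monomial (wt i).1 (T (wt i).2 : ℤ[T;T⁻¹]) : PS D))
      = monomial (∑ i ∈ s, wt i).1 ((-1) ^ s.card * T (∑ i ∈ s, wt i).2) := by
  classical
  induction s using Finset.induction_on with
  | empty =>
    rw [Finset.prod_empty, Finset.sum_empty, Finset.card_empty, pow_zero, one_mul]
    change 1 = monomial 0 (T 0 : ℤ[T;T⁻¹])
    rw [T_zero]
    rfl
  | insert i s hi ih =>
    rw [Finset.prod_insert hi, ih, Finset.card_insert_of_notMem hi, Finset.sum_insert hi,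
      neg_mul, monomial_mul_monomial, ← map_neg, Prod.fst_add, Prod.snd_add, T_add]
    congr 1
    ring

theorem lamFactor_eq_prod (m p : Fin D →₀ ℕ) (hp : p ≤ m) (hfin : {i | (wt i).1 ≤ m}.Finite)
    (hc : ∀ p j, (coeff p c).coeff j = Nat.card {i // wt i = (p, j)}) :
    lamFactor p (coeff p c) = ∏ i ∈ hfin.toFinset with (wt i).1 = p,
      (1 - monomial (wt i).1 (T (wt i).2)) := by
  classical
  have hcard : ∀ j, (coeff p c).coeff j
      = ((hfin.toFinset.filter fun i => (wt i).1 = p).filter fun i => (wt i).2 = j).card := by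
    intro j
    rw [hc]
    refine congrArg Nat.cast (Nat.subtype_card _ fun i => ?_)
    rw [Finset.mem_filter, Finset.mem_filter, Set.Finite.mem_toFinset]
    constructor
    · rintro ⟨⟨_, rfl⟩, rfl⟩; rfl
    · intro hi
      simp only [hi, and_true]
      exact Set.mem_ofPred_eq ▸ hi ▸ hp
  rw [lamFactor, ← Finset.prod_fiberwise_of_maps_to (g := fun i => (wt i).2)
    (t := (coeff p c).coeff.support)]
  · refine Finset.prod_congr rfl fun j _ => ?_
    rw [Finset.prod_congr rfl (g := fun _ => 1 - monomial p (T j)), Finset.prod_const, hcard,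
      Int.toNat_natCast]
    intro i hi
    rw [Finset.mem_filter, Finset.mem_filter] at hi
    rw [hi.1.2, hi.2]
  · intro i hi
    rw [Finsupp.mem_support_iff, hcard]
    have : 0 < ((hfin.toFinset.filter fun i => (wt i).1 = p).filter
      fun i' => (wt i').2 = (wt i).2).card := Finset.card_pos.2 ⟨i, Finset.mem_filter.2 ⟨hi, rfl⟩⟩
    omega

/-- Up to degree m, λ of a character is the product of 1 - z^p t^j over the basis vectors of degree
at most m. Expanding it, each subset contributes its sign at its total weight. -/
theorem coeff_lam_of_basis (hne : ∀ i, (wt i).1 ≠ 0) {m : Fin D →₀ ℕ}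
    (hfin : {i | (wt i).1 ≤ m}.Finite)
    (hc : ∀ p j, (coeff p c).coeff j = Nat.card {i // wt i = (p, j)}) (j : ℤ) :
    (coeff m (lam c)).coeff j
      = ∑ s ∈ hfin.toFinset.powerset with ∑ i ∈ s, wt i = (m, j), (-1) ^ s.card := by
  classical
  rw [lam_eq_lamPos fun p j => by rw [hc]; exact Int.natCast_nonneg _]
  change (coeff m (∏ p ∈ (Finset.Iic m).erase 0, lamFactor p (coeff p c))).coeff j = _
  have h1 : ∏ p ∈ (Finset.Iic m).erase 0, lamFactor p (coeff p c)
      = ∏ i ∈ hfin.toFinset, (1 - monomial (wt i).1 (T (wt i).2)) := by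
    -- Degree 0 is excluded from the product in `lamPos`; no basis vector is lost, since none has
    -- degree 0.
    rw [← Finset.prod_fiberwise_of_maps_to (g := fun i => (wt i).1) (t := (Finset.Iic m).erase 0)]
    · refine Finset.prod_congr rfl fun p hp => ?_
      simp only [Finset.mem_erase, Finset.mem_Iic] at hp
      exact lamFactor_eq_prod m p hp.2 hfin hc
    · intro i hi
      simp only [Finset.mem_erase, Finset.mem_Iic]
      exact ⟨hne i, (Set.Finite.mem_toFinset hfin).1 hi⟩
  rw [h1]
  simp only [sub_eq_add_neg]
  rw [Finset.prod_one_add, map_sum, AddMonoidAlgebra.coeff_sum, Finset.sum_apply', Finset.sum_filter]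
  refine Finset.sum_congr rfl fun s _ => ?_
  rw [prod_neg_monomial, coeff_monomial]
  by_cases h : (∑ i ∈ s, wt i).1 = m
  · rw [if_pos h.symm]
    have h3 : ((-1) ^ s.card * T (∑ i ∈ s, wt i).2 : ℤ[T;T⁻¹])
        = .single (∑ i ∈ s, wt i).2 ((-1) ^ s.card) := by
      rw [single_eq_C_mul_T]; simp
    rw [h3, AddMonoidAlgebra.coeff_single, Finsupp.single_apply]
    congr 1
    rw [Prod.ext_iff]
    simp [h]
  · rw [if_neg (Ne.symm h), if_neg (fun h' => h (by rw [h']))]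
    rfl

end Lambda

/-! ### Decompositions into eigenspaces -/

section Eigen

variable {K V A : Type*} [Field K] [AddCommGroup V] [Module K V] {T : Module.End K V}
  {χ : A → K} {N : A → Submodule K V}

theorem iSupIndep_of_le_eigenspace (hχ : Function.Injective χ)
    (hN : ∀ a, N a ≤ T.eigenspace (χ a)) : iSupIndep N :=
  (T.eigenspaces_iSupIndep.comp hχ).mono hN

/-- Split an eigenvector into its part in N a and a part y in the other pieces. Then y lies both in
the eigenspace of χ a and in the sum of the other eigenspaces, so y = 0. -/
theorem eigenspace_le_of_iSup_eq_top (hχ : Function.Injective χ)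
    (hN : ∀ a, N a ≤ T.eigenspace (χ a)) (htop : ⨆ a, N a = ⊤) (a : A) :
    T.eigenspace (χ a) ≤ N a := by
  intro v hv
  have hv' : v ∈ N a ⊔ ⨆ (a') (_ : a' ≠ a), N a' := by
    have : ⨆ a, N a ≤ N a ⊔ ⨆ (a') (_ : a' ≠ a), N a' := by
      refine iSup_le fun a' => ?_
      by_cases h : a' = a
      · rw [h]; exact le_sup_left
      · exact le_sup_of_le_right (le_iSup_of_le a' (le_iSup_of_le h le_rfl))
    exact this (htop ▸ Submodule.mem_top)
  obtain ⟨x, hx, y, hy, rfl⟩ := Submodule.mem_sup.1 hv'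
  have h1 : y ∈ T.eigenspace (χ a) := (Submodule.add_mem_iff_right _ (hN a hx)).1 hv
  have h2 : y ∈ ⨆ (a') (_ : a' ≠ a), T.eigenspace (χ a') :=
    iSup₂_mono (fun a' _ => hN a') hy
  have h3 := (Submodule.disjoint_def.1 ((T.eigenspaces_iSupIndep.comp hχ) a)) y h1 h2
  rwa [h3, add_zero]

end Eigen

/-! ### The gradings of `J(D)`, `𝓑J(D)` and `Inner J(D)` -/

section Grading

variable (K : Type u) [Field K] [CharZero K] {D : ℕ}

/-- A family of distinct primes. -/
def finPrime (i : Fin D) : ℕ := Nat.nth Nat.Prime i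

theorem finPrime_prime (i : Fin D) : (finPrime i).Prime := Nat.prime_nth_prime i

/-- The character `m ↦ ∏ pᵢ^{mᵢ}`, where `p₀, p₁, …` are the primes. -/
def primeChar (m : Fin D →₀ ℕ) : K := ∏ i, (finPrime i : K) ^ m i

/-- Unique factorization of integers, usable in K because the characteristic is zero. -/
theorem primeChar_injective : Function.Injective (primeChar K (D := D)) := by
  intro m m' hm
  have h : ∏ i, finPrime i ^ m i = ∏ i, finPrime i ^ m' i := by
    have : ((∏ i, finPrime i ^ m i : ℕ) : K) = (∏ i, finPrime i ^ m' i : ℕ) := by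
      push_cast; exact hm
    exact_mod_cast this
  have hf : ∀ (m : Fin D →₀ ℕ) (j : Fin D),
      (∏ i, finPrime i ^ m i).factorization (finPrime j) = m j := by
    intro m j
    rw [Nat.factorization_prod fun i _ => pow_ne_zero _ (finPrime_prime i).ne_zero, Finset.sum_apply',
      Finset.sum_eq_single j]
    · rw [(finPrime_prime j).factorization_pow, Finsupp.single_eq_same]
    · intro i _ hij
      rw [(finPrime_prime i).factorization_pow, Finsupp.single_apply, if_neg]
      intro h'
      exact hij (Fin.ext (Nat.nth_injective Nat.infinite_setOfPred_prime h'))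
    · intro hj; exact absurd (Finset.mem_univ j) hj
  ext j
  rw [← hf m j, h, hf m' j]

variable (D) in
/-- A diagonal matrix whose weight spaces are its eigenspaces. -/
def primeDiag : GL (Fin D) K :=
  Matrix.GeneralLinearGroup.mkOfDetNeZero
    (Matrix.diagonal fun i => (finPrime i : K)) (by
      rw [Matrix.det_diagonal]
      exact Finset.prod_ne_zero_iff.2 fun i _ =>
        Nat.cast_ne_zero.2 (finPrime_prime i).ne_zero)

theorem primeDiag_coe : (primeDiag K D : Matrix (Fin D) (Fin D) K)
    = Matrix.diagonal fun i => (finPrime i : K) := rfl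

theorem weightSpace_le_eigenspace {V : Type*} [AddCommGroup V] [Module K V]
    (ρ : Representation K (GL (Fin D) K) V) (m : Fin D →₀ ℕ) :
    weightSpace ρ m ≤ Module.End.eigenspace (ρ (primeDiag K D)) (primeChar K m) := fun _ hv =>
  Module.End.mem_eigenspace_iff.2 (hv (primeDiag K D) _ (primeDiag_coe K))

/-- The single matrix `primeDiag` already separates all multidegrees. So candidate pieces that lie
in the weight spaces and span everything must be the weight spaces; this is how the abstract
definition is matched with J(D) and Inner J(D). -/
theorem eq_weightSpace {V : Type*} [AddCommGroup V] [Module K V]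
    {ρ : Representation K (GL (Fin D) K) V} {N : (Fin D →₀ ℕ) → Submodule K V}
    (hN : ∀ m, N m ≤ weightSpace ρ m) (htop : ⨆ m, N m = ⊤) (m : Fin D →₀ ℕ) :
    weightSpace ρ m = N m :=
  le_antisymm ((weightSpace_le_eigenspace K ρ m).trans
    (eigenspace_le_of_iSup_eq_top (primeChar_injective K)
      (fun a => (hN a).trans (weightSpace_le_eigenspace K ρ a)) htop m)) (hN m)

theorem isInternal_of_le_weightSpace {V : Type*} [AddCommGroup V] [Module K V]
    {ρ : Representation K (GL (Fin D) K) V} {N : (Fin D →₀ ℕ) → Submodule K V}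
    (hN : ∀ m, N m ≤ weightSpace ρ m) (htop : ⨆ m, N m = ⊤) : DirectSum.IsInternal N :=
  DirectSum.isInternal_submodule_of_iSupIndep_of_iSup_eq_top
    (iSupIndep_of_le_eigenspace (primeChar_injective K)
      fun a => (hN a).trans (weightSpace_le_eigenspace K ρ a)) htop

/-! ### The multidegree components of J(D). -/

/-- Nonassociative monomials in the generators of `J(D)`, with their multidegrees. -/
inductive IsMonomial : (Fin D →₀ ℕ) → FreeJordanAlg K D → Prop
  | gen (i : Fin D) : IsMonomial (Finsupp.single i 1) (gen K D i)
  | mul {p q : Fin D →₀ ℕ} {a b : FreeJordanAlg K D} (ha : IsMonomial p a) (hb : IsMonomial q b) :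
      IsMonomial (p + q) (a * b)

/-- The component of multidegree `m` of `J(D)`. -/
def jPiece (m : Fin D →₀ ℕ) : Submodule K (FreeJordanAlg K D) :=
  Submodule.span K {x | IsMonomial K m x}

variable {K}

theorem IsMonomial.ne_zero {m : Fin D →₀ ℕ} {x : FreeJordanAlg K D} (h : IsMonomial K m x) :
    m ≠ 0 := by
  induction h with
  | gen i => simp
  | mul _ _ h1 _ => exact fun h => h1 (add_eq_zero.1 h).1

theorem jPiece_zero : jPiece K (0 : Fin D →₀ ℕ) = ⊥ := by
  rw [jPiece, Submodule.span_eq_bot]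
  exact fun x hx => absurd rfl hx.ne_zero

theorem mul_mem_jPiece {p q : Fin D →₀ ℕ} {a b : FreeJordanAlg K D} (ha : a ∈ jPiece K p)
    (hb : b ∈ jPiece K q) : a * b ∈ jPiece K (p + q) := by
  have : Submodule.map₂ (LinearMap.mul K (FreeJordanAlg K D)) (jPiece K p) (jPiece K q)
      ≤ jPiece K (p + q) := by
    rw [jPiece, jPiece, Submodule.map₂_span_span, Submodule.span_le]
    rintro _ ⟨x, hx, y, hy, rfl⟩
    exact Submodule.subset_span (hx.mul hy)
  exact this (Submodule.apply_mem_map₂ _ ha hb)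

theorem gen_mem_jPiece (i : Fin D) : gen K D i ∈ jPiece K (Finsupp.single i 1) :=
  Submodule.subset_span (.gen i)

theorem exists_isMonomial (x : FreeMagma (Fin D)) :
    ∃ m, IsMonomial K m (toFree K D (MonoidAlgebra.single x 1)) := by
  induction x with
  | ih1 i => exact ⟨_, .gen i⟩
  | ih2 x y hx hy =>
    obtain ⟨p, hp⟩ := hx
    obtain ⟨q, hq⟩ := hy
    refine ⟨p + q, ?_⟩
    have := hp.mul hq
    rwa [← toFree_mul, MonoidAlgebra.single_mul_single, one_mul] at this

theorem iSup_jPiece : ⨆ m, jPiece K (D := D) m = ⊤ := by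
  rw [eq_top_iff]
  intro x _
  obtain ⟨x, rfl⟩ := toFree_surjective K D x
  induction x using MonoidAlgebra.induction_linear with
  | zero => rw [map_zero]; exact zero_mem _
  | add x y hx hy => rw [map_add]; exact add_mem (hx trivial) (hy trivial)
  | single y c =>
    obtain ⟨m, hm⟩ := exists_isMonomial (K := K) y
    have : (MonoidAlgebra.single y c : FreeNonUnitalNonAssocAlgebra K (Fin D))
        = c • MonoidAlgebra.single y 1 := by simp
    rw [this, map_smul]
    exact Submodule.smul_mem _ _ (Submodule.mem_iSup_of_mem m (Submodule.subset_span hm))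

theorem isMonomial_apply {g : GL (Fin D) K} {t : Fin D → K}
    (hg : (g : Matrix (Fin D) (Fin D) K) = Matrix.diagonal t) {m : Fin D →₀ ℕ}
    {x : FreeJordanAlg K D} (hx : IsMonomial K m x) :
    repJ K D g x = (∏ i, t i ^ m i) • x := by
  classical
  induction hx with
  | gen i =>
    change glHom K D g (gen K D i) = _
    rw [glHom, freeLift_gen, hg, Finset.sum_eq_single i, Matrix.diagonal_apply_eq,
      Finset.prod_eq_single i]
    · simp
    · intro j _ hj; simp [hj.symm]
    · simp
    · intro j _ hj; rw [Matrix.diagonal_apply_ne _ hj, zero_smul]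
    · simp
  | mul _ _ h1 h2 =>
    rw [repJ_mul, h1, h2, smul_mul_smul_comm, ← Finset.prod_mul_distrib]
    simp only [Finsupp.add_apply, pow_add]

theorem jPiece_le_weightSpace (m : Fin D →₀ ℕ) : jPiece K m ≤ weightSpace (repJ K D) m := by
  rw [jPiece, Submodule.span_le]
  exact fun x hx g t hg => isMonomial_apply hg hx

theorem weightSpace_repJ (m : Fin D →₀ ℕ) : weightSpace (repJ K D) m = jPiece K m :=
  eq_weightSpace K jPiece_le_weightSpace iSup_jPiece m

theorem isInternal_jPiece : DirectSum.IsInternal (jPiece K (D := D)) :=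
  isInternal_of_le_weightSpace K jPiece_le_weightSpace iSup_jPiece

variable (K) in
/-- The decomposable elements of multidegree `m`. -/
def jDecomp (m : Fin D →₀ ℕ) : Submodule K (FreeJordanAlg K D) :=
  ⨆ x ∈ (Finset.HasAntidiagonal.antidiagonal m).filter (fun x => x.1 ≠ 0 ∧ x.2 ≠ 0),
    Submodule.map₂ (LinearMap.mul K (FreeJordanAlg K D)) (jPiece K x.1) (jPiece K x.2)

/-- A monomial is a generator or a product of two monomials of nonzero degree. This drives both the
finiteness of the components and the computation of H₁. -/
theorem jPiece_le (m : Fin D →₀ ℕ) :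
    jPiece K m ≤ Submodule.span K (gen K D '' {i | Finsupp.single i 1 = m}) ⊔ jDecomp K m := by
  rw [jPiece, Submodule.span_le]
  intro x hx
  cases hx with
  | gen i => exact Submodule.mem_sup_left (Submodule.subset_span ⟨i, rfl, rfl⟩)
  | @mul p q a b ha hb =>
    refine Submodule.mem_sup_right ?_
    have h1 : (p, q) ∈ (Finset.HasAntidiagonal.antidiagonal (p + q)).filter
        (fun x => x.1 ≠ 0 ∧ x.2 ≠ 0) :=
      Finset.mem_filter.2 ⟨Finset.HasAntidiagonal.mem_antidiagonal.2 rfl, ha.ne_zero, hb.ne_zero⟩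
    exact Submodule.mem_iSup_of_mem (p, q) (Submodule.mem_iSup_of_mem h1
      (Submodule.apply_mem_map₂ (LinearMap.mul K (FreeJordanAlg K D))
        (Submodule.subset_span ha) (Submodule.subset_span hb)))

theorem jDecomp_le (m : Fin D →₀ ℕ) : jDecomp K m ≤ jPiece K m := by
  refine iSup₂_le fun x hx => Submodule.map₂_le.2 fun a ha b hb => ?_
  have := mul_mem_jPiece ha hb
  rwa [Finset.HasAntidiagonal.mem_antidiagonal.1 (Finset.mem_filter.1 hx).1] at this

/-- Induction on the multidegree: both factors of a decomposable element have strictly smaller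
degree, and only finitely many splittings of m exist. -/
theorem jPiece_fg (m : Fin D →₀ ℕ) : (jPiece K m).FG := by
  induction m using WellFoundedLT.induction with
  | ind m ih =>
    have h1 : jPiece K m = Submodule.span K (gen K D '' {i | Finsupp.single i 1 = m}) ⊔ jDecomp K m := by
      refine le_antisymm (jPiece_le m) (sup_le ?_ (jDecomp_le m))
      rw [Submodule.span_le]
      rintro _ ⟨i, rfl, rfl⟩
      exact gen_mem_jPiece i
    rw [h1]
    refine Submodule.FG.sup (Submodule.fg_span (Set.toFinite _)) ?_
    refine Submodule.fg_biSup _ _ fun x hx => ?_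
    rw [Finset.mem_filter, Finset.HasAntidiagonal.mem_antidiagonal] at hx
    obtain ⟨rfl, h2, h3⟩ := hx
    exact Submodule.FG.map₂ _
      (ih _ (lt_add_of_pos_right _ (pos_iff_ne_zero.2 h3)))
      (ih _ (lt_add_of_pos_left _ (pos_iff_ne_zero.2 h2)))

instance jPiece_finite (m : Fin D →₀ ℕ) : Module.Finite K (jPiece K m) :=
  Module.Finite.iff_fg.2 (jPiece_fg m)

/-! ### The multidegree components of 𝓑J(D). -/

variable (K) in
/-- The component of multidegree `m` of `𝓑J(D)`. -/
def bPiece (m : Fin D →₀ ℕ) : Submodule K (BSpace K (FreeJordanAlg K D)) :=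
  ⨆ x ∈ Finset.HasAntidiagonal.antidiagonal m,
    Submodule.map₂ (brace K (FreeJordanAlg K D)) (jPiece K x.1) (jPiece K x.2)

theorem brace_mem_bPiece {p q : Fin D →₀ ℕ} {a b : FreeJordanAlg K D} (ha : a ∈ jPiece K p)
    (hb : b ∈ jPiece K q) : brace K _ a b ∈ bPiece K (p + q) :=
  Submodule.mem_iSup_of_mem (p, q) (Submodule.mem_iSup_of_mem
    (Finset.HasAntidiagonal.mem_antidiagonal.2 rfl) (Submodule.apply_mem_map₂ _ ha hb))

theorem bPiece_le {m : Fin D →₀ ℕ} {N : Submodule K (BSpace K (FreeJordanAlg K D))}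
    (h : ∀ p q, p + q = m → ∀ a ∈ jPiece K p, ∀ b ∈ jPiece K q, brace K _ a b ∈ N) :
    bPiece K m ≤ N :=
  iSup₂_le fun x hx => Submodule.map₂_le.2
    (h x.1 x.2 (Finset.HasAntidiagonal.mem_antidiagonal.1 hx))

instance bPiece_finite (m : Fin D →₀ ℕ) : Module.Finite K (bPiece K m) :=
  Module.Finite.iff_fg.2 (Submodule.fg_biSup _ _ fun x _ =>
    Submodule.FG.map₂ _ (jPiece_fg x.1) (jPiece_fg x.2))

theorem bPiece_zero : bPiece K (0 : Fin D →₀ ℕ) = ⊥ := by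
  rw [eq_bot_iff]
  refine bPiece_le fun p q hpq a ha b _ => ?_
  rw [(add_eq_zero.1 hpq).1, jPiece_zero, Submodule.mem_bot] at ha
  rw [ha, map_zero, LinearMap.zero_apply]
  exact zero_mem _

theorem BSpace.eq_top_of_brace_mem {J : Type v} [NonUnitalNonAssocCommRing J] [Module K J]
    [IsScalarTower K J J] [SMulCommClass K J J] {N : Submodule K (BSpace K J)}
    (h : ∀ a b, brace K J a b ∈ N) : N = ⊤ := by
  have : N.mkQ = 0 := BSpace.hom_ext K fun a b => (Submodule.Quotient.mk_eq_zero N).2 (h a b)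
  rw [← N.ker_mkQ, this, LinearMap.ker_zero]

theorem iSup_bPiece : ⨆ m, bPiece K (D := D) m = ⊤ := by
  refine BSpace.eq_top_of_brace_mem fun a b => ?_
  have h : Submodule.map₂ (brace K (FreeJordanAlg K D)) (⨆ m, jPiece K m) (⨆ m, jPiece K m)
      ≤ ⨆ m, bPiece K (D := D) m := by
    rw [Submodule.map₂_iSup_left]
    refine iSup_le fun p => ?_
    rw [Submodule.map₂_iSup_right]
    exact iSup_le fun q => Submodule.map₂_le.2 fun a ha b hb =>
      Submodule.mem_iSup_of_mem (p + q) (brace_mem_bPiece ha hb)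
  rw [iSup_jPiece] at h
  exact h (Submodule.apply_mem_map₂ _ Submodule.mem_top Submodule.mem_top)

variable (K D) in
/-- The action of `g ∈ GL(D)` on `𝓑J(D)`: `g . {a ∧ b} = {g a ∧ g b}`. -/
def glB (g : GL (Fin D) K) : Module.End K (BSpace K (FreeJordanAlg K D)) :=
  BSpace.lift K ((brace K _).compl₁₂ (repJ K D g) (repJ K D g))
    (fun a => brace_self K _) (fun a => by
      rw [LinearMap.compl₁₂_apply, repJ_mul]
      exact brace_sq K _)

theorem glB_brace (g : GL (Fin D) K) (a b : FreeJordanAlg K D) :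
    glB K D g (brace K _ a b) = brace K _ (repJ K D g a) (repJ K D g b) := by
  unfold glB
  exact BSpace.lift_brace K _ _ (fun a => by
    rw [LinearMap.compl₁₂_apply, repJ_mul]
    exact brace_sq K _) a b

variable (K D) in
/-- `𝓑J(D)` as a representation of `GL(D)`. -/
def repB : Representation K (GL (Fin D) K) (BSpace K (FreeJordanAlg K D)) where
  toFun := glB K D
  map_one' := by
    refine BSpace.hom_ext K fun a b => ?_
    rw [glB_brace, map_one, Module.End.one_apply, Module.End.one_apply, Module.End.one_apply]
  map_mul' g g' := by
    refine BSpace.hom_ext K fun a b => ?_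
    rw [Module.End.mul_apply, glB_brace, glB_brace, glB_brace, map_mul, Module.End.mul_apply,
      Module.End.mul_apply]

theorem repB_brace (g : GL (Fin D) K) (a b : FreeJordanAlg K D) :
    repB K D g (brace K _ a b) = brace K _ (repJ K D g a) (repJ K D g b) :=
  glB_brace g a b

theorem bPiece_le_weightSpace (m : Fin D →₀ ℕ) : bPiece K m ≤ weightSpace (repB K D) m := by
  refine bPiece_le fun p q hpq a ha b hb g t hg => ?_
  rw [repB_brace, jPiece_le_weightSpace p ha g t hg, jPiece_le_weightSpace q hb g t hg, map_smul,
    map_smul, LinearMap.smul_apply, smul_smul, ← Finset.prod_mul_distrib, ← hpq]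
  simp only [Finsupp.add_apply, pow_add, mul_comm]

theorem isInternal_bPiece : DirectSum.IsInternal (bPiece K (D := D)) :=
  isInternal_of_le_weightSpace K bPiece_le_weightSpace iSup_bPiece

/-! ### Inner J as a quotient of 𝓑J. -/

theorem bPartial_mem_inner {J : Type v} [NonUnitalNonAssocCommRing J] [Module K J]
    [IsScalarTower K J J] [SMulCommClass K J J] [IsCommJordan J] (ω : BSpace K J) :
    bPartial K J ω ∈ Inner K J := by
  have : (Inner K J).comap (bPartial K J) = ⊤ := BSpace.eq_top_of_brace_mem fun a b => by
    rw [Submodule.mem_comap, bPartial_brace]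
    exact Submodule.subset_span ⟨a, b, rfl⟩
  exact this.ge (Submodule.mem_top (x := ω))

variable (K) in
/-- The surjection `{ω} ↦ ∂_ω` from `𝓑J` to `Inner J`. -/
def bInner (J : Type v) [NonUnitalNonAssocCommRing J] [Module K J]
    [IsScalarTower K J J] [SMulCommClass K J J] [IsCommJordan J] : BSpace K J →ₗ[K] Inner K J :=
  (bPartial K J).codRestrict (Inner K J) bPartial_mem_inner

theorem bInner_surjective {J : Type v} [NonUnitalNonAssocCommRing J] [Module K J]
    [IsScalarTower K J J] [SMulCommClass K J J] [IsCommJordan J] :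
    Function.Surjective (bInner K J) := by
  have h : Inner K J ≤ LinearMap.range (bPartial K J) := by
    rw [Inner, Submodule.span_le]
    rintro _ ⟨a, b, rfl⟩
    exact ⟨brace K J a b, bPartial_brace K a b⟩
  rintro ⟨δ, hδ⟩
  obtain ⟨ω, rfl⟩ := h hδ
  exact ⟨ω, rfl⟩

/-- Since GL(D) acts by automorphisms, conjugation carries ∂_{a,b} to ∂_{ga,gb}. The grading of
𝓑J(D) can therefore be pushed forward to Inner J(D). -/
theorem bInner_repB (g : GL (Fin D) K) (ω : BSpace K (FreeJordanAlg K D)) :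
    bInner K _ (repB K D g ω) = repInner K D g (bInner K _ ω) := by
  suffices h : bInner K _ ∘ₗ repB K D g = repInner K D g ∘ₗ bInner K _ from
    LinearMap.congr_fun h ω
  refine BSpace.hom_ext K fun a b => Subtype.ext ?_
  change bPartial K _ (repB K D g (brace K _ a b))
    = Representation.linHom (repJ K D) (repJ K D) g (bPartial K _ (brace K _ a b))
  rw [repB_brace, bPartial_brace, bPartial_brace]
  ext z
  simp [repJ_mul, Representation.self_inv_apply]

theorem bPiece_map_le_weightSpace (m : Fin D →₀ ℕ) :
    (bPiece K m).map (bInner K _) ≤ weightSpace (repInner K D) m := by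
  rintro _ ⟨ω, hω, rfl⟩ g t hg
  rw [← bInner_repB, bPiece_le_weightSpace m hω g t hg, map_smul]

theorem weightSpace_repInner (m : Fin D →₀ ℕ) :
    weightSpace (repInner K D) m = (bPiece K m).map (bInner K _) := by
  refine eq_weightSpace K bPiece_map_le_weightSpace ?_ m
  rw [← Submodule.map_iSup, iSup_bPiece, Submodule.map_top,
    LinearMap.range_eq_top.2 bInner_surjective]

theorem bPartial_apply_mem {p q : Fin D →₀ ℕ} {ω : BSpace K (FreeJordanAlg K D)}
    {a : FreeJordanAlg K D} (hω : ω ∈ bPiece K p) (ha : a ∈ jPiece K q) :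
    bPartial K _ ω a ∈ jPiece K (p + q) := by
  suffices h : bPiece K p ≤ (jPiece K (p + q)).comap ((bPartial K _).flip a) from h hω
  refine bPiece_le fun r s hrs x hx y hy => ?_
  rw [Submodule.mem_comap, LinearMap.flip_apply, bPartial_brace, partialMap_apply, ← hrs]
  refine sub_mem ?_ ?_
  · have := mul_mem_jPiece hx (mul_mem_jPiece ha hy)
    rwa [add_comm q s, ← add_assoc] at this
  · have := mul_mem_jPiece (mul_mem_jPiece hx ha) hy
    rwa [add_right_comm] at this

theorem bAct_mem {p q : Fin D →₀ ℕ} {ω ω' : BSpace K (FreeJordanAlg K D)}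
    (hω : ω ∈ bPiece K p) (hω' : ω' ∈ bPiece K q) : bAct K _ ω ω' ∈ bPiece K (p + q) := by
  suffices h : bPiece K q ≤ (bPiece K (p + q)).comap (bAct K _ ω) from h hω'
  refine bPiece_le fun r s hrs x hx y hy => ?_
  rw [Submodule.mem_comap, bAct_brace, ← hrs]
  refine add_mem ?_ ?_
  · have := brace_mem_bPiece (bPartial_apply_mem hω hx) hy
    rwa [add_assoc] at this
  · have := brace_mem_bPiece hx (bPartial_apply_mem hω hy)
    rwa [add_left_comm] at this

theorem gen_ne_zero (i : Fin D) : gen K D i ≠ 0 := by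
  -- The field K is itself a Jordan algebra, and sending every generator to 1 defines a morphism to
  -- it.
  let : IsCommJordan K := ⟨fun a b => by ring⟩
  intro h
  have := freeLift_gen K D (J := K) (fun _ => 1) i
  rw [h, map_zero] at this
  exact zero_ne_one this

end Grading

/-! ### A weighted basis of `sl₂ J(D)` -/

section Basis

variable (K : Type u) [Field K] [CharZero K] {D : ℕ}

/-- The standard basis `(h, e, f)` of `sl₂`. -/
def sl2Basis : Module.Basis (Fin 3) K (Sl2 K) := Module.Basis.ofEquivFun (sl2Equiv K)

/-- Half of the weights of `h, e, f`. -/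
def sl2Wt : Fin 3 → ℤ := ![0, 1, -1]

theorem sl2Basis_coe (s : Fin 3) : (sl2Basis K s : Matrix (Fin 2) (Fin 2) K)
    = !![(Pi.single s 1 : Fin 3 → K) 0, (Pi.single s 1 : Fin 3 → K) 1;
        (Pi.single s 1 : Fin 3 → K) 2, -(Pi.single s 1 : Fin 3 → K) 0] := by
  rw [sl2Basis, Module.Basis.coe_ofEquivFun]
  rfl

theorem sl2_eq (x : Sl2 K) : x = x.1 0 0 • sl2Basis K 0 + x.1 0 1 • sl2Basis K 1
    + x.1 1 0 • sl2Basis K 2 := by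
  ext i j
  fin_cases i <;> fin_cases j <;> simp [sl2Basis_coe, sl2_one_one]

theorem sl2_lie_h_e : ⁅sl2Basis K 0, sl2Basis K 1⁆ = (2 : K) • sl2Basis K 1 := by
  ext i j
  fin_cases i <;> fin_cases j <;> simp [sl2Basis_coe, Ring.lie_def]; norm_num

theorem sl2_lie_h_f : ⁅sl2Basis K 0, sl2Basis K 2⁆ = (-2 : K) • sl2Basis K 2 := by
  ext i j
  fin_cases i <;> fin_cases j <;> simp [sl2Basis_coe, Ring.lie_def]; norm_num

theorem sl2_lie_e_f : ⁅sl2Basis K 1, sl2Basis K 2⁆ = sl2Basis K 0 := by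
  ext i j
  fin_cases i <;> fin_cases j <;> simp [sl2Basis_coe, Ring.lie_def]

/-- The vectors of weight `2j` of `sl₂`. -/
def sl2Piece (j : ℤ) : Submodule K (Sl2 K) :=
  LinearMap.eqLocus (LieAlgebra.ad K (Sl2 K) (sl2Basis K 0)) (((2 * j : ℤ) : K) • LinearMap.id)

variable {K}

theorem mem_sl2Piece {j : ℤ} {x : Sl2 K} :
    x ∈ sl2Piece K j ↔ ⁅sl2Basis K 0, x⁆ = ((2 * j : ℤ) : K) • x := Iff.rfl

theorem sl2Basis_mem (s : Fin 3) : sl2Basis K s ∈ sl2Piece K (sl2Wt s) := by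
  rw [mem_sl2Piece]
  fin_cases s
  · simp [sl2Wt]
  · simp [sl2Wt, sl2_lie_h_e]
  · simp [sl2Wt, sl2_lie_h_f]

theorem lie_mem_sl2Piece {j j' : ℤ} {x y : Sl2 K} (hx : x ∈ sl2Piece K j)
    (hy : y ∈ sl2Piece K j') : ⁅x, y⁆ ∈ sl2Piece K (j + j') := by
  rw [mem_sl2Piece] at *
  rw [leibniz_lie, hx, hy, smul_lie, lie_smul, ← add_smul]
  push_cast
  rw [mul_add]

/-- Invariance of κ under ad h gives (2j + 2j') κ(x, y) = 0. -/
theorem kappa_eq_zero {j j' : ℤ} {x y : Sl2 K} (hx : x ∈ sl2Piece K j) (hy : y ∈ sl2Piece K j')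
    (h : j + j' ≠ 0) : kappa K x y = 0 := by
  rw [mem_sl2Piece] at *
  have h1 := kappa_lie K (sl2Basis K 0) x y
  rw [hx, hy, map_smul, LinearMap.smul_apply, map_smul, eq_neg_iff_add_eq_zero, ← add_smul,
    smul_eq_mul] at h1
  refine (mul_eq_zero.1 h1).resolve_left ?_
  rw [← Int.cast_add]
  exact Int.cast_ne_zero.2 (by omega)

/-- The eigenvalue equation is read in the coordinates along h, e, f, on which ad h has eigenvalues
0, 2, -2. -/
theorem sl2Piece_coord {j : ℤ} {x : Sl2 K} (hx : x ∈ sl2Piece K j) :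
    (x.1 0 0 = 0 ∨ j = 0) ∧ (x.1 0 1 = 0 ∨ j = 1) ∧ (x.1 1 0 = 0 ∨ j = -1) := by
  rw [mem_sl2Piece] at hx
  have key : ∀ (c : K) (n : ℤ), (n : K) * c = 0 → c = 0 ∨ n = 0 := fun c n h =>
    (mul_eq_zero.1 h).symm.imp_right Int.cast_eq_zero.1
  have h00 := congrArg (fun y : Sl2 K => y.1 0 0) hx
  have h01 := congrArg (fun y : Sl2 K => y.1 0 1) hx
  have h10 := congrArg (fun y : Sl2 K => y.1 1 0) hx
  simp [sl2Basis_coe, Ring.lie_def, Matrix.mul_apply, Matrix.vecMul, dotProduct] at h00 h01 h10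
  refine ⟨?_, ?_, ?_⟩
  · rcases h00 with h | h
    · exact Or.inr h
    · exact Or.inl h
  · rcases key (x.1 0 1) (2 - 2 * j) (by push_cast; linear_combination h01) with h | h
    · exact Or.inl h
    · exact Or.inr (by omega)
  · rcases key (x.1 1 0) (2 + 2 * j) (by push_cast; linear_combination -h10) with h | h
    · exact Or.inl h
    · exact Or.inr (by omega)

variable (K D)

/-- The index set of a homogeneous basis of `J(D)`. -/
abbrev JIdx : Type := Σ m : Fin D →₀ ℕ, Fin (Module.finrank K (jPiece K m))

/-- The index set of a homogeneous basis of `𝓑J(D)`. -/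
abbrev BIdx : Type := Σ m : Fin D →₀ ℕ, Fin (Module.finrank K (bPiece K m))

/-- The index set of a basis of weight vectors of `sl₂ J(D)`. -/
def TagIdx : Type := BIdx K D ⊕ (Fin 3 × JIdx K D)

-- Any linear order serves: it only fixes the order of the factors in the basis of the exterior
-- algebra indexed by finite sets.
open Classical in
instance : LinearOrder (TagIdx K D) := linearOrderOfSTO WellOrderingRel

/-- A homogeneous basis of `J(D)`. -/
def jBasis : Module.Basis (JIdx K D) K (FreeJordanAlg K D) :=
  isInternal_jPiece.collectedBasis fun m => Module.finBasis K (jPiece K m)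

/-- A homogeneous basis of `𝓑J(D)`. -/
def bBasis : Module.Basis (BIdx K D) K (BSpace K (FreeJordanAlg K D)) :=
  isInternal_bPiece.collectedBasis fun m => Module.finBasis K (bPiece K m)

/-- A basis of weight vectors of `sl₂ J(D)`. -/
def tagBasis : Module.Basis (TagIdx K D) K (TAG K (FreeJordanAlg K D)) :=
  (bBasis K D).prod ((sl2Basis K).tensorProduct (jBasis K D))

/-- The weights of the vectors of `tagBasis`. -/
def tagWt : TagIdx K D → (Fin D →₀ ℕ) × ℤ :=
  Sum.elim (fun x => (x.1, 0)) fun x => (x.2.1, sl2Wt x.1)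

variable {K D}

/-- The element `{ω}` of `sl₂ J`. -/
def tagB {J : Type v} [NonUnitalNonAssocCommRing J] [Module K J] [IsScalarTower K J J]
    [SMulCommClass K J J] [IsCommJordan J] (ω : BSpace K J) : TAG K J := (ω, 0)

/-- The element `x(a)` of `sl₂ J`. -/
def tagS {J : Type v} [NonUnitalNonAssocCommRing J] [Module K J] [IsScalarTower K J J]
    [SMulCommClass K J J] [IsCommJordan J] (x : Sl2 K) (a : J) : TAG K J := (0, x ⊗ₜ a)

theorem jBasis_mem (x : JIdx K D) : jBasis K D x ∈ jPiece K x.1 :=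
  isInternal_jPiece.collectedBasis_mem _ x

theorem bBasis_mem (x : BIdx K D) : bBasis K D x ∈ bPiece K x.1 :=
  isInternal_bPiece.collectedBasis_mem _ x

theorem tagBasis_inl (x : BIdx K D) : tagBasis K D (Sum.inl x) = tagB (bBasis K D x) :=
  Prod.ext (Module.Basis.prod_apply_inl_fst _ _ _) (Module.Basis.prod_apply_inl_snd _ _ _)

theorem tagBasis_inr (s : Fin 3) (x : JIdx K D) :
    tagBasis K D (Sum.inr (s, x)) = tagS (sl2Basis K s) (jBasis K D x) :=
  Prod.ext (Module.Basis.prod_apply_inr_fst _ _ _)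
    ((Module.Basis.prod_apply_inr_snd _ _ _).trans (Module.Basis.tensorProduct_apply _ _ _ _))

/-! ### Brackets and the action of sl₂ on the elements {ω} and x(a). -/

section General

variable {J : Type v} [NonUnitalNonAssocCommRing J] [Module K J] [IsScalarTower K J J]
    [SMulCommClass K J J] [IsCommJordan J]

variable (K J) in
/-- The inclusion of `𝓑J` in `sl₂ J`. -/
def tagBMap : BSpace K J →ₗ[K] TAG K J := LinearMap.inl K (BSpace K J) (Sl2 K ⊗[K] J)

variable (K J) in
/-- The bilinear map `(x, a) ↦ x(a)`. -/
def tagSMap : Sl2 K →ₗ[K] J →ₗ[K] TAG K J :=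
  (TensorProduct.mk K (Sl2 K) J).compr₂ (LinearMap.inr K (BSpace K J) (Sl2 K ⊗[K] J))

theorem tagBMap_apply (ω : BSpace K J) : tagBMap K J ω = tagB ω := rfl

theorem tagSMap_apply (x : Sl2 K) (a : J) : tagSMap K J x a = tagS x a := rfl

theorem lie_tagB_tagB (ω ω' : BSpace K J) : ⁅tagB ω, tagB ω'⁆ = tagB (bAct K J ω ω') := by
  refine Prod.ext ?_ ?_
  · change bAct K J ω ω' + tagPsi K J 0 0 = bAct K J ω ω'
    rw [map_zero, add_zero]
  · change tagAct K J ω 0 - tagAct K J ω' 0 + tagPhi K J 0 0 = 0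
    simp

theorem lie_tagB_tagS (ω : BSpace K J) (x : Sl2 K) (a : J) :
    ⁅tagB ω, tagS x a⁆ = tagS x (bPartial K J ω a) := by
  refine Prod.ext ?_ ?_
  · change bAct K J ω 0 + tagPsi K J 0 (x ⊗ₜ a) = 0
    simp
  · change tagAct K J ω (x ⊗ₜ a) - tagAct K J 0 0 + tagPhi K J 0 (x ⊗ₜ a) = x ⊗ₜ bPartial K J ω a
    simp

theorem lie_tagS_tagS (x y : Sl2 K) (a a' : J) :
    ⁅tagS x a, tagS y a'⁆ = tagS ⁅x, y⁆ (a * a') + kappa K x y • tagB (brace K J a a') := by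
  refine Prod.ext ?_ ?_
  · change bAct K J 0 0 + tagPsi K J (x ⊗ₜ a) (y ⊗ₜ a') = 0 + kappa K x y • brace K J a a'
    simp
  · change tagAct K J 0 (y ⊗ₜ a') - tagAct K J 0 (x ⊗ₜ a) + tagPhi K J (x ⊗ₜ a) (y ⊗ₜ a')
      = ⁅x, y⁆ ⊗ₜ (a * a') + kappa K x y • (0 : Sl2 K ⊗[K] J)
    simp

theorem sl2Der_tagB (x : Sl2 K) (ω : BSpace K J) : sl2Der K J x (tagB ω) = 0 :=
  Prod.ext rfl (map_zero _)

theorem sl2Der_tagS (x y : Sl2 K) (a : J) : sl2Der K J x (tagS y a) = tagS ⁅x, y⁆ a := rfl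

theorem tag_linearMap_ext {M : Type*} [AddCommGroup M] [Module K M] {φ ψ : TAG K J →ₗ[K] M}
    (h : ∀ ω, φ (tagB ω) = ψ (tagB ω)) (h' : ∀ x a, φ (tagS x a) = ψ (tagS x a)) : φ = ψ := by
  refine LinearMap.prod_ext (R := K) (M := BSpace K J) (M₂ := Sl2 K ⊗[K] J) ?_ ?_
  · exact LinearMap.ext h
  · exact TensorProduct.ext' h'

theorem sl2Der_lie (x y : Sl2 K) :
    ⁅(sl2Der K J x : Module.End K (TAG K J)), (sl2Der K J y : Module.End K (TAG K J))⁆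
      = sl2Der K J ⁅x, y⁆ := by
  refine tag_linearMap_ext (fun ω => ?_) fun z a => ?_
  · change sl2Der K J x (sl2Der K J y (tagB ω)) - sl2Der K J y (sl2Der K J x (tagB ω))
      = sl2Der K J ⁅x, y⁆ (tagB ω)
    simp only [sl2Der_tagB, map_zero, sub_zero]
  · change sl2Der K J x (sl2Der K J y (tagS z a)) - sl2Der K J y (sl2Der K J x (tagS z a))
      = sl2Der K J ⁅x, y⁆ (tagS z a)
    rw [sl2Der_tagS, sl2Der_tagS, sl2Der_tagS, sl2Der_tagS, sl2Der_tagS, lie_lie,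
      ← tagSMap_apply, ← tagSMap_apply, ← tagSMap_apply, map_sub, LinearMap.sub_apply]

end General

theorem span_collectedBasis {A V : Type*} [DecidableEq A] [AddCommGroup V] [Module K V]
    {N : A → Submodule K V} (h : DirectSum.IsInternal N) {ι : A → Type*}
    (B : ∀ a, Module.Basis (ι a) K (N a)) (a : A) :
    N a = Submodule.span K (Set.range fun i => h.collectedBasis B ⟨a, i⟩) := by
  have h1 := congrArg (Submodule.map (N a).subtype) (B a).span_eq
  rw [Submodule.map_span, Submodule.map_subtype_top, ← Set.range_comp] at h1
  rw [h.collectedBasis_coe]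
  exact h1.symm

theorem tagWt_inl (x : BIdx K D) : tagWt K D (Sum.inl x) = (x.1, 0) := rfl

theorem tagWt_inr (s : Fin 3) (x : JIdx K D) : tagWt K D (Sum.inr (s, x)) = (x.1, sl2Wt s) := rfl

theorem tagB_mem_piece {m : Fin D →₀ ℕ} {ω : BSpace K (FreeJordanAlg K D)}
    (hω : ω ∈ bPiece K m) : tagB ω ∈ piece (tagBasis K D) (tagWt K D) (m, 0) := by
  suffices hle : bPiece K m ≤ (piece (tagBasis K D) (tagWt K D) (m, 0)).comap (tagBMap K _)
    from hle hω
  conv_lhs => rw [span_collectedBasis isInternal_bPiece (fun m => Module.finBasis K (bPiece K m)) m]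
  rw [Submodule.span_le]
  rintro _ ⟨i, rfl⟩
  rw [SetLike.mem_coe, Submodule.mem_comap, tagBMap_apply]
  rw [← bBasis, ← tagBasis_inl]
  exact basis_mem_piece (wt := tagWt K D) (Sum.inl ⟨m, i⟩)

theorem tagS_basis_mem_piece {m : Fin D →₀ ℕ} {a : FreeJordanAlg K D} (s : Fin 3)
    (ha : a ∈ jPiece K m) :
    tagS (sl2Basis K s) a ∈ piece (tagBasis K D) (tagWt K D) (m, sl2Wt s) := by
  suffices hle : jPiece K m ≤ (piece (tagBasis K D) (tagWt K D) (m, sl2Wt s)).comap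
      (tagSMap K _ (sl2Basis K s)) from hle ha
  conv_lhs => rw [span_collectedBasis isInternal_jPiece (fun m => Module.finBasis K (jPiece K m)) m]
  rw [Submodule.span_le]
  rintro _ ⟨i, rfl⟩
  rw [SetLike.mem_coe, Submodule.mem_comap, tagSMap_apply]
  rw [← jBasis, ← tagBasis_inr]
  exact basis_mem_piece (wt := tagWt K D) (Sum.inr (s, ⟨m, i⟩))

theorem tagS_mem_piece {m : Fin D →₀ ℕ} {j : ℤ} {x : Sl2 K} {a : FreeJordanAlg K D}
    (hx : x ∈ sl2Piece K j) (ha : a ∈ jPiece K m) :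
    tagS x a ∈ piece (tagBasis K D) (tagWt K D) (m, j) := by
  have key : ∀ (c : K) (s : Fin 3), (c = 0 ∨ j = sl2Wt s) →
      c • tagS (sl2Basis K s) a ∈ piece (tagBasis K D) (tagWt K D) (m, j) := by
    rintro c s (rfl | rfl)
    · rw [zero_smul]; exact zero_mem _
    · exact Submodule.smul_mem _ _ (tagS_basis_mem_piece s ha)
  obtain ⟨h0, h1, h2⟩ := sl2Piece_coord hx
  rw [sl2_eq K x, ← tagSMap_apply]
  simp only [map_add, map_smul, LinearMap.add_apply, LinearMap.smul_apply, tagSMap_apply]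
  exact add_mem (add_mem (key _ 0 h0) (key _ 1 h1)) (key _ 2 h2)

theorem tagS_mul_add_mem {p q : Fin D →₀ ℕ} {j j' : ℤ} {x y : Sl2 K} {a a' : FreeJordanAlg K D}
    (hx : x ∈ sl2Piece K j) (hy : y ∈ sl2Piece K j') (ha : a ∈ jPiece K p)
    (ha' : a' ∈ jPiece K q) :
    ⁅tagS x a, tagS y a'⁆ ∈ piece (tagBasis K D) (tagWt K D) (p + q, j + j') := by
  rw [lie_tagS_tagS]
  refine add_mem (tagS_mem_piece (lie_mem_sl2Piece hx hy) (mul_mem_jPiece ha ha')) ?_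
  -- The summand in 𝓑J has sl₂-weight 0, so it fits only when the weights of x and y cancel;
  -- otherwise κ(x, y) = 0.
  by_cases h : j + j' = 0
  · rw [h]
    exact Submodule.smul_mem _ _ (tagB_mem_piece (brace_mem_bPiece ha ha'))
  · rw [kappa_eq_zero hx hy h, zero_smul]
    exact zero_mem _

theorem finrank_ne_zero_of_fin {V : Type*} [AddCommGroup V] [Module K V] {N : Submodule K V}
    (i : Fin (Module.finrank K N)) : N ≠ ⊥ := by
  rintro rfl
  rw [finrank_bot] at i
  exact i.elim0

theorem tagIdx_finite (m : Fin D →₀ ℕ) : {i | (tagWt K D i).1 ≤ m}.Finite := by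
  have key : ∀ d : (Fin D →₀ ℕ) → ℕ, {x : Σ m, Fin (d m) | x.1 ≤ m}.Finite := fun d =>
    (Finset.finite_toSet ((Finset.Iic m).sigma fun _ => Finset.univ)).subset fun x hx =>
      Finset.mem_coe.2 (Finset.mem_sigma.2 ⟨Finset.mem_Iic.2 hx, Finset.mem_univ _⟩)
  have h1 := key fun m => Module.finrank K (bPiece K m)
  have h2 := key fun m => Module.finrank K (jPiece K m)
  refine ((h1.image Sum.inl).union ((Set.finite_univ.prod h2).image Sum.inr)).subset ?_
  rintro (x | ⟨s, x⟩) hx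
  · exact Or.inl ⟨x, hx, rfl⟩
  · exact Or.inr ⟨(s, x), ⟨Set.mem_univ _, hx⟩, rfl⟩

theorem sl2Der_basis_mem {j : ℤ} {x : Sl2 K} (hx : x ∈ sl2Piece K j) (i : TagIdx K D) :
    (sl2Der K (FreeJordanAlg K D) x : Module.End K (TAG K (FreeJordanAlg K D))) (tagBasis K D i)
      ∈ piece (tagBasis K D) (tagWt K D) (tagWt K D i + (0, j)) := by
  rcases i with i | ⟨s, i⟩
  · rw [tagBasis_inl]
    have := sl2Der_tagB x (bBasis K D i)
    exact this.symm ▸ zero_mem _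
  · rw [tagBasis_inr]
    have := tagS_mem_piece (lie_mem_sl2Piece hx (sl2Basis_mem s)) (jBasis_mem i)
    rw [add_comm] at this
    rw [tagWt_inr, Prod.mk_add_mk, add_zero]
    exact this

-- This supplies all the general theory needs to know about sl₂ J(D). Degree 0 does not occur
-- because J(D) is non-unital, every monomial having positive degree.
variable (K D) in
theorem isSl2Graded : IsSl2Graded (tagBasis K D) (tagWt K D)
    (sl2Der K (FreeJordanAlg K D) (sl2Basis K 1)) (sl2Der K (FreeJordanAlg K D) (sl2Basis K 2))
    (sl2Der K (FreeJordanAlg K D) (sl2Basis K 0)) where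
  bracket i j := by
    rcases i with i | ⟨s, i⟩ <;> rcases j with j | ⟨t, j⟩
    · rw [tagBasis_inl, tagBasis_inl, lie_tagB_tagB]
      exact tagB_mem_piece (bAct_mem (bBasis_mem i) (bBasis_mem j))
    · rw [tagBasis_inl, tagBasis_inr, lie_tagB_tagS]
      have := tagS_mem_piece (sl2Basis_mem t) (bPartial_apply_mem (bBasis_mem i) (jBasis_mem j))
      convert this using 1
      simp [tagWt]
    · rw [tagBasis_inl, tagBasis_inr, ← lie_skew, lie_tagB_tagS]
      have := tagS_mem_piece (sl2Basis_mem s) (bPartial_apply_mem (bBasis_mem j) (jBasis_mem i))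
      refine neg_mem ?_
      convert this using 1
      simp [tagWt, add_comm]
    · rw [tagBasis_inr, tagBasis_inr]
      exact tagS_mul_add_mem (sl2Basis_mem s) (sl2Basis_mem t) (jBasis_mem i) (jBasis_mem j)
  ne_zero i := by
    rcases i with ⟨m, i⟩ | ⟨s, ⟨m, i⟩⟩
    · rintro rfl
      exact finrank_ne_zero_of_fin i bPiece_zero
    · rintro rfl
      exact finrank_ne_zero_of_fin i jPiece_zero
  finite := tagIdx_finite
  small i := by
    rcases i with i | ⟨s, i⟩
    · simp [tagWt]
    · change |sl2Wt s| ≤ 1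
      fin_cases s <;> decide
  e_mem := sl2Der_basis_mem (sl2Basis_mem 1)
  f_mem := sl2Der_basis_mem (sl2Basis_mem 2)
  h_eq i := by
    rcases i with i | ⟨s, i⟩
    · rw [tagBasis_inl]
      refine (sl2Der_tagB _ _).trans ?_
      simp [tagWt]
    · rw [tagBasis_inr]
      refine (sl2Der_tagS _ _ _).trans ?_
      rw [mem_sl2Piece.1 (sl2Basis_mem s), tagWt_inr, ← tagSMap_apply, map_smul,
        LinearMap.smul_apply, tagSMap_apply]
  lie_ef := by rw [sl2Der_lie, sl2_lie_e_f]

/-! ### The character of `sl₂ J(D)` -/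

theorem card_sigma_fst {d : (Fin D →₀ ℕ) → ℕ} (p : Fin D →₀ ℕ) :
    Nat.card {x : Σ m, Fin (d m) // x.1 = p} = d p := by
  rw [Nat.card_congr (Equiv.sigmaSubtype p), Nat.card_eq_fintype_card, Fintype.card_fin]

/-- A basis vector of 𝓑J(D) counts once, in weight 0; one of J(D) counts once for each of h, e, f.
-/
theorem card_tagWt (p : Fin D →₀ ℕ) (j : ℤ) :
    Nat.card {i // tagWt K D i = (p, j)}
      = (if j = 0 then Module.finrank K (bPiece K p) else 0)
        + Nat.card {s // sl2Wt s = j} * Module.finrank K (jPiece K p) := by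
  have hB : Nat.card {x : BIdx K D // x.1 = p ∧ 0 = j}
      = if j = 0 then Module.finrank K (bPiece K p) else 0 := by
    split_ifs with h
    · subst h
      rw [← card_sigma_fst (d := fun m => Module.finrank K (bPiece K m)) p]
      exact Nat.card_congr (Equiv.subtypeEquivRight fun x => and_iff_left rfl)
    · rw [Nat.card_eq_zero]
      exact Or.inl ⟨fun x => h x.2.2.symm⟩
  have hJ : Nat.card {x : Fin 3 × JIdx K D // sl2Wt x.1 = j ∧ x.2.1 = p}
      = Nat.card {s // sl2Wt s = j} * Module.finrank K (jPiece K p) := by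
    rw [Nat.card_congr (Equiv.subtypeProdEquivProd (p := fun s => sl2Wt s = j)
      (q := fun x : JIdx K D => x.1 = p)), Nat.card_prod,
      card_sigma_fst (d := fun m => Module.finrank K (jPiece K m))]
  have hfin : ∀ d : (Fin D →₀ ℕ) → ℕ, Finite {x : Σ m, Fin (d m) // x.1 = p} := fun d =>
    Finite.of_equiv _ (Equiv.sigmaSubtype p).symm
  have hf1 : Finite {x : BIdx K D // x.1 = p ∧ 0 = j} :=
    Finite.of_injective (β := {x : BIdx K D // x.1 = p}) (fun x => ⟨x.1, x.2.1⟩)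
      fun x y hxy => by simpa [Subtype.ext_iff] using hxy
  have hf2 : Finite {x : Fin 3 × JIdx K D // sl2Wt x.1 = j ∧ x.2.1 = p} :=
    Finite.of_equiv _ (Equiv.subtypeProdEquivProd (p := fun s => sl2Wt s = j)
      (q := fun x : JIdx K D => x.1 = p)).symm
  rw [← hB, ← hJ, ← Nat.card_sum]
  refine Nat.card_congr ((Equiv.subtypeSum (α := BIdx K D) (β := Fin 3 × JIdx K D)).trans
    (Equiv.sumCongr (Equiv.subtypeEquivRight fun x => ?_) (Equiv.subtypeEquivRight fun x => ?_)))
  · exact Prod.ext_iff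
  · exact Prod.ext_iff.trans and_comm

theorem coeff_tagCoeff (x y j : ℤ) : (tagCoeff x y).coeff j
    = (if j = 0 then y else 0) + Nat.card {s // sl2Wt s = j} * x := by
  have h : tagCoeff x y = .single (-1) x + .single 0 x + .single 1 x + .single 0 y := by
    simp only [tagCoeff, chL_one, LaurentPolynomial.single_eq_C_mul_T, LaurentPolynomial.T_zero]
    ring
  have hc : Nat.card {s // sl2Wt s = j} = if j = 0 ∨ j = 1 ∨ j = -1 then 1 else 0 := by
    rw [Nat.card_eq_fintype_card, Fintype.card_subtype]
    by_cases h0 : j = 0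
    · subst h0; decide
    by_cases h1 : j = 1
    · subst h1; decide
    by_cases h2 : j = -1
    · subst h2; decide
    rw [if_neg (by tauto), Finset.card_eq_zero, Finset.filter_eq_empty_iff]
    intro s _
    fin_cases s
    · exact Ne.symm h0
    · exact Ne.symm h1
    · exact Ne.symm h2
  rw [h, hc]
  simp only [AddMonoidAlgebra.coeff_add, AddMonoidAlgebra.coeff_single, Finsupp.add_apply,
    Finsupp.single_apply]
  split_ifs <;> omega

variable (K D) in
/-- The series of the dimensions of the components of `J(D)`. -/
def jSeries : MvPowerSeries (Fin D) ℤ := fun m => Module.finrank K (jPiece K m)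

variable (K D) in
/-- The series of the dimensions of the components of `𝓑J(D)`. -/
def bSeries : MvPowerSeries (Fin D) ℤ := fun m => Module.finrank K (bPiece K m)

/-- In other words [J][L(2)] + [𝓑J] is the character of 𝔤, in the form required by
`coeff_lam_of_basis`. -/
theorem coeff_tagClass_eq_card (p : Fin D →₀ ℕ) (j : ℤ) :
    (MvPowerSeries.coeff p (tagClass (jSeries K D) (bSeries K D))).coeff j
      = Nat.card {i // tagWt K D i = (p, j)} := by
  rw [coeff_tagClass, coeff_tagCoeff, card_tagWt]
  change (if j = 0 then (Module.finrank K (bPiece K p) : ℤ) else 0) + _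
    * (Module.finrank K (jPiece K p) : ℤ) = _
  push_cast
  rfl

/-- A multiplicity is a difference of coefficients at -n and -n - 1, that is, of two Euler
characteristics; degree by degree this difference counts lowest weight vectors. -/
theorem mult_coeff_lam (n : ℕ) (m : Fin D →₀ ℕ) :
    mult n (MvPowerSeries.coeff m (lam (tagClass (jSeries K D) (bSeries K D))))
      = ∑ k ∈ Finset.range (m.degree + 1), (-1) ^ k * (Module.finrank K (lowest (tagBasis K D)
        (tagWt K D) (sl2Der K (FreeJordanAlg K D) (sl2Basis K 2)) n k m) : ℤ) := by
  have G := isSl2Graded K D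
  have h := coeff_lam_of_basis G.ne_zero (G.finite m) coeff_tagClass_eq_card
  rw [mult, h, h, ← G.sum_alternating_extPiece, ← G.sum_alternating_extPiece,
    ← Finset.sum_sub_distrib]
  refine Finset.sum_congr rfl fun k _ => ?_
  rw [G.finrank_lowest, mul_sub]

end Basis

/-! ### Central elements and the homology of a graded Lie algebra -/

section Central

open ExteriorAlgebra

variable {K : Type*} [Field K] {𝔤 : Type*} [LieRing 𝔤] [LieAlgebra K 𝔤]

/-- The contraction of `Λ𝔤` by a linear form on `𝔤`. -/
def contr (φ : Module.Dual K 𝔤) : Module.End K (ExteriorAlgebra K 𝔤) :=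
  CliffordAlgebra.contractLeft (Q := (0 : QuadraticForm K 𝔤)) φ

theorem contr_ι_mul (φ : Module.Dual K 𝔤) (x : 𝔤) (w : ExteriorAlgebra K 𝔤) :
    contr φ (ι K x * w) = φ x • w - ι K x * contr φ w :=
  CliffordAlgebra.contractLeft_ι_mul _ _ _

theorem contr_one (φ : Module.Dual K 𝔤) : contr φ (1 : ExteriorAlgebra K 𝔤) = 0 :=
  CliffordAlgebra.contractLeft_one _ _

/-- The commutator of a contraction with a derivation is the contraction by the transposed form. -/
theorem contr_extDer (φ : Module.Dual K 𝔤) (δ : Module.End K 𝔤) (w : ExteriorAlgebra K 𝔤) :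
    contr φ (extDer K 𝔤 δ w) = extDer K 𝔤 δ (contr φ w) + contr (φ ∘ₗ δ) w := by
  induction w using ext_induction K 𝔤 with
  | h1 => simp [extDer_one, contr_one]
  | hs c x h => simp [h]
  | ha x y h h' => simp only [map_add, h, h']; abel
  | hm x w h =>
    simp only [extDer_ι_mul, contr_ι_mul, map_add, map_sub, map_smul, h, LinearMap.comp_apply,
      mul_add]
    abel

/-- The contraction by the coboundary of a linear form. -/
def contrD (φ : Module.Dual K 𝔤) : Module.End K (ExteriorAlgebra K 𝔤) :=
  ceD K 𝔤 ∘ₗ contr φ + contr φ ∘ₗ ceD K 𝔤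

theorem contrD_apply (φ : Module.Dual K 𝔤) (w : ExteriorAlgebra K 𝔤) :
    contrD φ w = ceD K 𝔤 (contr φ w) + contr φ (ceD K 𝔤 w) := rfl

theorem contr_zero (w : ExteriorAlgebra K 𝔤) : contr (0 : Module.Dual K 𝔤) w = 0 := by
  rw [contr, map_zero, LinearMap.zero_apply]

/-- For general x there is one more term, the contraction by φ ∘ ad x; the terms with φ x and with
the action of ad x on the contraction of w cancel. For x in the radical of φ ⁅·, ·⁆ the extra term
is zero. -/
theorem contrD_ι_mul {φ : Module.Dual K 𝔤} {x : 𝔤} (hx : ∀ y, φ ⁅x, y⁆ = 0)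
    (w : ExteriorAlgebra K 𝔤) : contrD φ (ι K x * w) = ι K x * contrD φ w := by
  have h0 : φ ∘ₗ (LieAlgebra.ad K 𝔤 x : Module.End K 𝔤) = 0 := LinearMap.ext hx
  simp only [contrD_apply, contr_ι_mul, ceD_ι_mul, map_sub, map_smul, contr_extDer, h0,
    contr_zero, add_zero, mul_add]
  abel

theorem algebraMapInv_ι_mul (x : 𝔤) (w : ExteriorAlgebra K 𝔤) :
    algebraMapInv (ι K x * w) = 0 := by
  rw [map_mul]
  simp [algebraMapInv]

theorem algebraMapInv_extDer (δ : Module.End K 𝔤) (w : ExteriorAlgebra K 𝔤) :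
    algebraMapInv (extDer K 𝔤 δ w) = 0 := by
  induction w using ext_induction K 𝔤 with
  | h1 => rw [extDer_one, map_zero]
  | hs c x h => rw [map_smul, map_smul, h, smul_zero]
  | ha x y h h' => rw [map_add, map_add, h, h', add_zero]
  | hm x w h => rw [extDer_ι_mul, map_add, algebraMapInv_ι_mul, algebraMapInv_ι_mul, add_zero]

/-- A boundary has no scalar part because d is zero on Λ¹. The scalar part is the invariant by which
the contradiction is detected. -/
theorem algebraMapInv_ceD (w : ExteriorAlgebra K 𝔤) : algebraMapInv (ceD K 𝔤 w) = 0 := by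
  induction w using ext_induction K 𝔤 with
  | h1 => rw [ceD_one, map_zero]
  | hs c x h => rw [map_smul, map_smul, h, smul_zero]
  | ha x y h h' => rw [map_add, map_add, h, h', add_zero]
  | hm x w h => rw [ceD_ι_mul, map_sub, algebraMapInv_extDer, algebraMapInv_ι_mul, sub_zero]

variable (φ : Module.Dual K 𝔤)

/-- The left ideal of `Λ𝔤` generated by the radical of the form `φ ⁅x, y⁆`. -/
def radIdeal : Submodule K (ExteriorAlgebra K 𝔤) :=
  Submodule.span K {w | ∃ x, (∀ y, φ ⁅x, y⁆ = 0) ∧ ∃ w', w = ι K x * w'}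

variable {φ}

theorem contrD_mem_radIdeal {w : ExteriorAlgebra K 𝔤} (hw : w ∈ radIdeal φ) :
    contrD φ w ∈ radIdeal φ := by
  suffices h : radIdeal φ ≤ (radIdeal φ).comap (contrD φ) from h hw
  conv_lhs => rw [radIdeal]
  rw [Submodule.span_le]
  rintro _ ⟨x, hx, w, rfl⟩
  rw [SetLike.mem_coe, Submodule.mem_comap, contrD_ι_mul hx]
  exact Submodule.subset_span ⟨x, hx, _, rfl⟩

theorem algebraMapInv_of_mem_radIdeal {w : ExteriorAlgebra K 𝔤} (hw : w ∈ radIdeal φ) :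
    algebraMapInv w = 0 := by
  suffices h : radIdeal φ ≤ LinearMap.ker (algebraMapInv (R := K) (M := 𝔤)).toLinearMap from h hw
  rw [radIdeal, Submodule.span_le]
  rintro _ ⟨x, _, w, rfl⟩
  exact algebraMapInv_ι_mul x w

/-- The sum of the boundaries and of the multiples of `z` in `Λ𝔤`. -/
def boundariesAdd (z : 𝔤) : Submodule K (ExteriorAlgebra K 𝔤) :=
  LinearMap.range (ceD K 𝔤) ⊔ LinearMap.range (LinearMap.mulLeft K (ι K z))

theorem algebraMapInv_of_mem_boundariesAdd {z : 𝔤} {w : ExteriorAlgebra K 𝔤}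
    (hw : w ∈ boundariesAdd (K := K) z) : algebraMapInv w = 0 := by
  obtain ⟨_, ⟨u, rfl⟩, _, ⟨v, rfl⟩, rfl⟩ := Submodule.mem_sup.1 hw
  rw [map_add, algebraMapInv_ceD, LinearMap.mulLeft_apply, algebraMapInv_ι_mul, add_zero]

/-- From d² = 0 the operator `contrD φ` preserves boundaries, and it commutes with multiplication by
z because a central element lies in the radical. -/
theorem contrD_mem_boundariesAdd {z : 𝔤} (hz : ∀ y : 𝔤, ⁅z, y⁆ = 0) {w : ExteriorAlgebra K 𝔤}
    (hw : w ∈ boundariesAdd (K := K) z) : contrD φ w ∈ boundariesAdd (K := K) z := by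
  obtain ⟨_, ⟨u, rfl⟩, _, ⟨v, rfl⟩, rfl⟩ := Submodule.mem_sup.1 hw
  rw [map_add]
  refine add_mem (Submodule.mem_sup_left ⟨contr φ (ceD K 𝔤 u), ?_⟩)
    (Submodule.mem_sup_right ⟨contrD φ v, ?_⟩)
  · rw [contrD_apply, ceD_ceD, map_zero, add_zero]
  · rw [LinearMap.mulLeft_apply, LinearMap.mulLeft_apply,
      contrD_ι_mul fun y => by rw [hz, map_zero]]

theorem pow_apply_mem {V : Type*} [AddCommGroup V] [Module K V] {T : Module.End K V}
    {N : Submodule K V} (h : ∀ w ∈ N, T w ∈ N) (k : ℕ) {w : V} (hw : w ∈ N) : (T ^ k) w ∈ N := by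
  induction k with
  | zero => exact hw
  | succ k ih => rw [pow_succ', Module.End.mul_apply]; exact h _ ih

theorem ceD_ι_mul_of_central {z : 𝔤} (hz : ∀ y : 𝔤, ⁅z, y⁆ = 0) (w : ExteriorAlgebra K 𝔤) :
    ceD K 𝔤 (ι K z * w) = - (ι K z * ceD K 𝔤 w) := by
  -- The zero map is written as a multiple by 0 so that `extDer_smul` removes its term.
  have h0 : (LieAlgebra.ad K 𝔤 z : Module.End K 𝔤) = (0 : K) • LieAlgebra.ad K 𝔤 z := by
    rw [zero_smul]
    exact LinearMap.ext hz
  rw [ceD_ι_mul, h0, extDer_smul, zero_smul, LinearMap.zero_apply, zero_sub]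

end Central

/-! ### Invariant central elements vanish when the invariant homology does. -/

section CentralGraded

open ExteriorAlgebra

variable {K : Type*} [Field K] [CharZero K] {𝔤 : Type*} [LieRing 𝔤] [LieAlgebra K 𝔤]
variable {I : Type*} [LinearOrder I] {D : ℕ}
variable {b : Module.Basis I K 𝔤} {wt : I → (Fin D →₀ ℕ) × ℤ} {e f h : LieDerivation K 𝔤 𝔤}

theorem repr_eq_zero_of_mem_piece {A : Type*} [AddCommMonoid A] {wt : I → A} {a : A} {x : 𝔤}
    (hx : x ∈ piece b wt a) {i : I} (hi : wt i ≠ a) : b.repr x i = 0 := by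
  suffices hle : piece b wt a ≤ LinearMap.ker (b.coord i) from hle hx
  refine piece_le fun j hj => ?_
  rw [LinearMap.mem_ker, Module.Basis.coord_apply, b.repr_self, Finsupp.single_apply, if_neg]
  rintro rfl
  exact hi hj

namespace IsSl2Graded

variable (G : IsSl2Graded b wt e f h)
include G

/-- Pigeonhole: a product of more factors than there are basis vectors of degree at most m contains
a factor outside that finite set, and such a factor lies in the radical. -/
theorem extPiece_le_radIdeal {φ : Module.Dual K 𝔤} {m : Fin D →₀ ℕ}
    (hφ : ∀ i, ¬ (wt i).1 ≤ m → ∀ y, φ ⁅b i, y⁆ = 0) {k : ℕ} (a : (Fin D →₀ ℕ) × ℤ)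
    (hk : (G.finite m).toFinset.card < k) : extPiece b wt k a ≤ radIdeal φ := by
  refine extPiece_le fun s hs _ => ?_
  obtain ⟨i, his, hi⟩ := Finset.exists_mem_notMem_of_card_lt_card (hs ▸ hk)
  rw [Set.Finite.mem_toFinset] at hi
  rw [← Finset.insert_erase his]
  exact extBasis_insert_mem (Finset.notMem_erase i s)
    (Submodule.subset_span ⟨b i, hφ i hi, _, rfl⟩)

/-- The induction builds u with d u' = z ∧ u at each step. The condition z ∧ d u = 0 is carried
along because it makes z ∧ u a cycle; the last condition records that k contractions bring u back to
1. -/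
theorem exists_chain (hex : ∀ k, 1 ≤ k → ∀ (m : Fin D →₀ ℕ), ∀ w ∈ lowest b wt f 0 k m,
      ceD K 𝔤 w = 0 → ∃ u ∈ lowest b wt f 0 (k + 1) m, ceD K 𝔤 u = w)
    {m : Fin D →₀ ℕ} {z : 𝔤} (hz : z ∈ piece b wt (m, 0)) (hc : ∀ y : 𝔤, ⁅z, y⁆ = 0)
    (hf : (f : Module.End K 𝔤) z = 0) {φ : Module.Dual K 𝔤} (hφ : φ z = 1) (k : ℕ) :
    ∃ u ∈ lowest b wt f 0 (2 * k) (k • m), ι K z * ceD K 𝔤 u = 0 ∧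
      (contrD φ ^ k) u - 1 ∈ boundariesAdd (K := K) z := by
  induction k with
  | zero =>
    refine ⟨1, ⟨?_, ?_⟩, ?_, ?_⟩
    · have := one_mem_extPiece (b := b) (wt := wt)
      rw [zero_smul]
      exact this
    · exact extDer_one K 𝔤 _
    · rw [ceD_one, mul_zero]
    · rw [pow_zero, Module.End.one_apply, sub_self]
      exact zero_mem _
  | succ k ih =>
    obtain ⟨u, hu, hdu, hθ⟩ := ih
    have hw : ι K z * u ∈ lowest b wt f 0 (2 * k + 1) ((k + 1) • m) := by
      refine ⟨?_, ?_⟩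
      · have := ι_mul_mem hz hu.1
        rwa [Prod.mk_add_mk, zero_add, add_comm m, ← succ_nsmul] at this
      · rw [SetLike.mem_coe, LinearMap.mem_ker, extDer_ι_mul, hf, LinearMap.mem_ker.1 hu.2,
          map_zero, zero_mul, mul_zero, add_zero]
    obtain ⟨u', hu', hdu'⟩ := hex (2 * k + 1) (by omega) _ _ hw
      (by rw [ceD_ι_mul_of_central hc, hdu, neg_zero])
    refine ⟨u', hu', ?_, ?_⟩
    · rw [hdu', ← mul_assoc, ι_sq_zero, zero_mul]
    -- Since φ z = 1, contracting d u' = z ∧ u gives u minus a multiple of z, and the other half of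
    -- `contrD` is a boundary.
    · have h1 : contrD φ u' - u ∈ boundariesAdd (K := K) z := by
        rw [contrD_apply, hdu', contr_ι_mul, hφ, one_smul]
        have : ceD K 𝔤 (contr φ u') + (u - ι K z * contr φ u) - u
            = ceD K 𝔤 (contr φ u') + ι K z * (- contr φ u) := by rw [mul_neg]; abel
        rw [this]
        exact add_mem (Submodule.mem_sup_left ⟨_, rfl⟩) (Submodule.mem_sup_right ⟨_, rfl⟩)
      have h2 := pow_apply_mem (fun w hw => contrD_mem_boundariesAdd (φ := φ) hc hw) k h1
      rw [map_sub] at h2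
      rw [pow_succ, Module.End.mul_apply]
      have := add_mem h2 hθ
      rwa [sub_add_sub_cancel] at this

/-- The scalar part of (contrD φ)ᵏ uₖ is 1 by the chain and, for large k, 0 because uₖ then lies in
the ideal generated by the radical, which the operator preserves. -/
theorem eq_zero_of_central (hex : ∀ k, 1 ≤ k → ∀ (m : Fin D →₀ ℕ), ∀ w ∈ lowest b wt f 0 k m,
      ceD K 𝔤 w = 0 → ∃ u ∈ lowest b wt f 0 (k + 1) m, ceD K 𝔤 u = w)
    {m : Fin D →₀ ℕ} {z : 𝔤} (hz : z ∈ piece b wt (m, 0)) (hc : ∀ y : 𝔤, ⁅z, y⁆ = 0)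
    (hf : (f : Module.End K 𝔤) z = 0) : z = 0 := by
  by_contra hne
  obtain ⟨i, hi⟩ : ∃ i, b.repr z i ≠ 0 := by
    by_contra! h0
    exact hne (b.repr.map_eq_zero_iff.1 (Finsupp.ext h0))
  have hwi : wt i = (m, 0) := by
    by_contra h0
    exact hi (repr_eq_zero_of_mem_piece hz h0)
  -- A coordinate along a basis vector of weight (m, 0) occurring in z, normalized so that φ z = 1.
  set φ : Module.Dual K 𝔤 := (b.repr z i)⁻¹ • b.coord i with hφ
  have hφz : φ z = 1 := by
    rw [hφ, LinearMap.smul_apply, Module.Basis.coord_apply, smul_eq_mul, inv_mul_cancel₀ hi]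
  -- Bracketing with `b j` gives degree at least that of `b j`. If the latter is not at most m, the
  -- result has no component in degree m, where φ lives.
  have hrad : ∀ j, ¬ (wt j).1 ≤ m → ∀ y, φ ⁅b j, y⁆ = 0 := by
    intro j hj y
    suffices h0 : φ ∘ₗ (LieAlgebra.ad K 𝔤 (b j) : Module.End K 𝔤) = 0 from LinearMap.congr_fun h0 y
    refine b.ext fun l => ?_
    rw [LinearMap.comp_apply, LieAlgebra.ad_apply, hφ, LinearMap.smul_apply,
      Module.Basis.coord_apply, repr_eq_zero_of_mem_piece (G.bracket j l), smul_zero,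
      LinearMap.zero_apply]
    rw [hwi]
    intro h0
    have h1 : (wt j).1 + (wt l).1 = m := (congrArg Prod.fst h0).symm
    exact hj (h1 ▸ le_self_add)
  -- With one more step than there are basis vectors of degree at most m, u lies in an exterior
  -- power exceeding that number.
  obtain ⟨u, hu, -, hθ⟩ := G.exists_chain hex hz hc hf hφz ((G.finite m).toFinset.card + 1)
  have h1 := algebraMapInv_of_mem_boundariesAdd hθ
  have h2 := algebraMapInv_of_mem_radIdeal
    (pow_apply_mem (fun w hw => contrD_mem_radIdeal hw) ((G.finite m).toFinset.card + 1)
      (G.extPiece_le_radIdeal hrad _ (by omega) hu.1))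
  rw [map_sub, h2, map_one, zero_sub, neg_eq_zero] at h1
  exact one_ne_zero h1

end IsSl2Graded

end CentralGraded

/-! ### Consequences of the vanishing of the isotypic parts of the homology -/

section Vanishing

open ExteriorAlgebra

variable (K : Type u) [Field K] [CharZero K]

/-! ### From vanishing homology classes to boundaries. -/

section General

variable {K} {J : Type v} [NonUnitalNonAssocCommRing J] [Module K J] [IsScalarTower K J J]
    [SMulCommClass K J J] [IsCommJordan J]

theorem sl2Der_eq (x : Sl2 K) : (sl2Der K J x : Module.End K (TAG K J))
    = x.1 0 0 • (sl2Der K J (sl2Basis K 0) : Module.End K (TAG K J))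
      + x.1 0 1 • (sl2Der K J (sl2Basis K 1) : Module.End K (TAG K J))
      + x.1 1 0 • (sl2Der K J (sl2Basis K 2) : Module.End K (TAG K J)) := by
  refine tag_linearMap_ext (fun ω => ?_) fun y a => ?_
  · simp only [LinearMap.add_apply, LinearMap.smul_apply, LieDerivation.coeFn_coe, sl2Der_tagB,
      smul_zero, add_zero]
  · simp only [LinearMap.add_apply, LinearMap.smul_apply, LieDerivation.coeFn_coe, sl2Der_tagS]
    conv_lhs => rw [sl2_eq K x]
    simp only [← tagSMap_apply, add_lie, smul_lie, map_add, map_smul, LinearMap.add_apply,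
      LinearMap.smul_apply]

theorem extAct_sl2Der (x : Sl2 K) (w : ExteriorAlgebra K (TAG K J)) : extAct K (sl2Der K J x) w
    = x.1 0 0 • extAct K (sl2Der K J (sl2Basis K 0)) w
      + x.1 0 1 • extAct K (sl2Der K J (sl2Basis K 1)) w
      + x.1 1 0 • extAct K (sl2Der K J (sl2Basis K 2)) w := by
  rw [extAct, sl2Der_eq, extDer_add, extDer_add, extDer_smul, extDer_smul, extDer_smul]
  rfl

theorem mem_boundaries_of_trivialPart_eq_bot {k : ℕ} (htriv : trivialPart K J k = ⊥)
    {w : ExteriorAlgebra K (TAG K J)} (hw : w ∈ cycles K (TAG K J) k)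
    (h : ∀ x, extAct K (sl2Der K J x) w = 0) : w ∈ boundaries K (TAG K J) k := by
  have hmem : Submodule.Quotient.mk ⟨w, hw⟩ ∈ trivialPart K J k := by
    rw [trivialPart, Submodule.mem_iInf]
    intro x
    rw [LinearMap.mem_ker, homologyAct, Submodule.mapQ_apply, Submodule.Quotient.mk_eq_zero]
    change extAct K (sl2Der K J x) w ∈ boundaries K (TAG K J) k
    rw [h x]
    exact zero_mem _
  rw [htriv, Submodule.mem_bot, Submodule.Quotient.mk_eq_zero] at hmem
  exact hmem

/-- Composed with the passage to homology, φ becomes an equivariant map from the adjoint module,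
whose image lies in the adjoint component. -/
theorem mem_boundaries_of_adjointPart_eq_bot {k : ℕ} (hadj : adjointPart K J k = ⊥)
    (φ : Sl2 K →ₗ[K] ExteriorAlgebra K (TAG K J)) (hφ : ∀ x, φ x ∈ cycles K (TAG K J) k)
    (h : ∀ x y, φ ⁅x, y⁆ = extAct K (sl2Der K J x) (φ y)) (x : Sl2 K) :
    φ x ∈ boundaries K (TAG K J) k := by
  set ψ : Sl2 K →ₗ[K] LieHomology K (TAG K J) k :=
    Submodule.mkQ _ ∘ₗ φ.codRestrict (cycles K (TAG K J) k) hφ with hψ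
  have hψ' : ∀ x y, ψ ⁅x, y⁆ = homologyAct K (sl2Der K J x) k (ψ y) := fun x y =>
    congrArg (Submodule.mkQ _) (Subtype.ext (h x y))
  have hmem : ψ x ∈ adjointPart K J k := by
    rw [adjointPart]
    exact Submodule.mem_iSup_of_mem ⟨ψ, hψ'⟩ ⟨x, rfl⟩
  rw [hadj, Submodule.mem_bot] at hmem
  have : (⟨φ x, hφ x⟩ : cycles K (TAG K J) k)
      ∈ (boundaries K (TAG K J) k).submoduleOf (cycles K (TAG K J) k) :=
    (Submodule.Quotient.mk_eq_zero _).1 hmem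
  exact this

/-- The linear map from `sl₂` to `Λ𝔤` with `f ↦ w`, `h ↦ e w`, `e ↦ -½ e e w`. -/
def adjMap (w : ExteriorAlgebra K (TAG K J)) : Sl2 K →ₗ[K] ExteriorAlgebra K (TAG K J) :=
  (sl2Basis K).constr K ![extAct K (sl2Der K J (sl2Basis K 1)) w,
    (-2⁻¹ : K) • extAct K (sl2Der K J (sl2Basis K 1)) (extAct K (sl2Der K J (sl2Basis K 1)) w), w]

theorem adjMap_apply (w : ExteriorAlgebra K (TAG K J)) (x : Sl2 K) : adjMap w x
    = x.1 0 0 • extAct K (sl2Der K J (sl2Basis K 1)) w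
      + x.1 0 1 • (-2⁻¹ : K) • extAct K (sl2Der K J (sl2Basis K 1))
        (extAct K (sl2Der K J (sl2Basis K 1)) w) + x.1 1 0 • w := by
  conv_lhs => rw [sl2_eq K x]
  simp only [map_add, map_smul, adjMap, Module.Basis.constr_basis]
  rfl

end General

variable (D : ℕ)

/-- The lowest weight vectors in the exterior powers of `sl₂ J(D)`. -/
abbrev tagLowest (n k : ℕ) (m : Fin D →₀ ℕ) :
    Submodule K (ExteriorAlgebra K (TAG K (FreeJordanAlg K D))) :=
  lowest (tagBasis K D) (tagWt K D) (sl2Der K (FreeJordanAlg K D) (sl2Basis K 2)) n k m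

variable {K D}

/-- A lowest weight cycle of weight 0 is invariant, so it is a boundary, and its preimage can then
be chosen of lowest weight. -/
theorem exists_tagLowest_zero {k : ℕ} (htriv : trivialPart K (FreeJordanAlg K D) k = ⊥)
    {m : Fin D →₀ ℕ} {w : ExteriorAlgebra K (TAG K (FreeJordanAlg K D))}
    (hw : w ∈ tagLowest K D 0 k m) (hd : ceD K _ w = 0) :
    ∃ u ∈ tagLowest K D 0 (k + 1) m, ceD K _ u = w := by
  have G := isSl2Graded K D
  obtain ⟨u, hu, huw⟩ := mem_boundaries_of_trivialPart_eq_bot htriv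
    ⟨extPiece_le_exteriorPower _ _ hw.1, LinearMap.mem_ker.2 hd⟩ fun x => by
      rw [extAct_sl2Der, G.h_apply_of_lowest_zero hw, G.e_apply_of_lowest_zero hw,
        LinearMap.mem_ker.1 hw.2, smul_zero, smul_zero, smul_zero, add_zero, add_zero]
  exact G.exists_lowest_of_ceD_eq hw hu huw

/-- A lowest weight cycle of weight -2 generates a copy of the adjoint module made of cycles;
`adjMap` realizes it with w as the image of f. -/
theorem exists_tagLowest_one {k : ℕ} (hadj : adjointPart K (FreeJordanAlg K D) k = ⊥)
    {m : Fin D →₀ ℕ} {w : ExteriorAlgebra K (TAG K (FreeJordanAlg K D))}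
    (hw : w ∈ tagLowest K D 1 k m) (hd : ceD K _ w = 0) :
    ∃ u ∈ tagLowest K D 1 (k + 1) m, ceD K _ u = w := by
  have G := isSl2Graded K D
  have hwc : w ∈ cycles K (TAG K (FreeJordanAlg K D)) k :=
    ⟨extPiece_le_exteriorPower _ _ hw.1, LinearMap.mem_ker.2 hd⟩
  have hEw := extDer_mem_cycles K (sl2Der K (FreeJordanAlg K D) (sl2Basis K 1)) k w hwc
  have hEEw := extDer_mem_cycles K (sl2Der K (FreeJordanAlg K D) (sl2Basis K 1)) k _ hEw
  obtain ⟨r1, r2, r3, r4, r5, r6⟩ := G.lowest_one_relations hw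
  have hb := mem_boundaries_of_adjointPart_eq_bot hadj (adjMap w) (fun x => by
      rw [adjMap_apply]
      exact add_mem (add_mem (Submodule.smul_mem _ _ hEw)
        (Submodule.smul_mem _ _ (Submodule.smul_mem _ _ hEEw))) (Submodule.smul_mem _ _ hwc))
    (fun x y => by
      -- The coordinates of ⁅x, y⁆ along h, e, f. Equivariance then amounts to comparing
      -- coefficients of w, e w and e e w.
      have h00 : (⁅x, y⁆ : Sl2 K).1 0 0 = x.1 0 1 * y.1 1 0 - y.1 0 1 * x.1 1 0 := by
        simp [Ring.lie_def, Matrix.mul_apply, Fin.sum_univ_two]; ring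
      have h01 : (⁅x, y⁆ : Sl2 K).1 0 1 = 2 * (x.1 0 0 * y.1 0 1 - x.1 0 1 * y.1 0 0) := by
        simp [Ring.lie_def, Matrix.mul_apply, Fin.sum_univ_two, sl2_one_one]; ring
      have h10 : (⁅x, y⁆ : Sl2 K).1 1 0 = 2 * (x.1 1 0 * y.1 0 0 - x.1 0 0 * y.1 1 0) := by
        simp [Ring.lie_def, Matrix.mul_apply, Fin.sum_univ_two, sl2_one_one]; ring
      rw [adjMap_apply, adjMap_apply, h00, h01, h10, extAct_sl2Der x]
      simp only [map_add, map_smul, r1, r2, r3, r4, r5, r6, LinearMap.mem_ker.1 hw.2]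
      module) (sl2Basis K 2)
  have hf : adjMap w (sl2Basis K 2) = w := by
    rw [adjMap, Module.Basis.constr_basis]
    rfl
  rw [hf] at hb
  obtain ⟨u, hu, huw⟩ := hb
  exact G.exists_lowest_of_ceD_eq hw hu huw

/-! ### Injectivity of `𝓑J(D) → Inner J(D)` -/

/-- Both the action of ω on J and its action on 𝓑J are expressed through ∂_ω. If ∂_ω = 0, then {ω}
is central, and sl₂ kills it by definition. -/
theorem eq_zero_of_bPartial_eq_zero
    (htriv : ∀ k, 1 ≤ k → trivialPart K (FreeJordanAlg K D) k = ⊥) {m : Fin D →₀ ℕ}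
    {ω : BSpace K (FreeJordanAlg K D)} (hω : ω ∈ bPiece K m) (h : bPartial K _ ω = 0) : ω = 0 := by
  have hact : bAct K (FreeJordanAlg K D) ω = 0 := BSpace.hom_ext K fun a b => by
    rw [bAct_brace, h]
    simp
  have hc : (LieAlgebra.ad K (TAG K (FreeJordanAlg K D)) (tagB ω) : Module.End K _) = 0 := by
    refine tag_linearMap_ext (fun ω' => ?_) fun x a => ?_
    · rw [LieAlgebra.ad_apply, lie_tagB_tagB, hact, ← tagBMap_apply]
      simp
    · rw [LieAlgebra.ad_apply, lie_tagB_tagS, h, ← tagSMap_apply]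
      simp
  have h0 := (isSl2Graded K D).eq_zero_of_central
    (fun k hk m w hw hd => exists_tagLowest_zero (htriv k hk) hw hd) (tagB_mem_piece hω)
    (LinearMap.congr_fun hc) (sl2Der_tagB _ _)
  exact congrArg Prod.fst h0

theorem finrank_weightSpace_repInner
    (htriv : ∀ k, 1 ≤ k → trivialPart K (FreeJordanAlg K D) k = ⊥) (m : Fin D →₀ ℕ) :
    Module.finrank K (weightSpace (repInner K D) m) = Module.finrank K (bPiece K m) := by
  rw [weightSpace_repInner]
  rw [← LinearMap.range_domRestrict]
  refine LinearMap.finrank_range_of_inj (LinearMap.ker_eq_bot.1 (LinearMap.ker_eq_bot'.2 ?_))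
  exact fun ω hω => Subtype.ext
    (eq_zero_of_bPartial_eq_zero htriv ω.2 (congrArg Subtype.val hω))

/-! ### Lowest weight vectors in degrees one and two -/

theorem extDer_ι {𝔤 : Type*} [LieRing 𝔤] [LieAlgebra K 𝔤] (δ : Module.End K 𝔤) (x : 𝔤) :
    extDer K 𝔤 δ (ι K x) = ι K (δ x) := by
  rw [← mul_one (ι K x), extDer_ι_mul, extDer_one, mul_zero, add_zero, mul_one]

theorem ceD_ι {𝔤 : Type*} [LieRing 𝔤] [LieAlgebra K 𝔤] (x : 𝔤) : ceD K 𝔤 (ι K x) = 0 := by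
  rw [← mul_one (ι K x), ceD_ι_mul, extDer_one, ceD_one, mul_zero, sub_zero]

theorem ceD_ι_mul_ι {𝔤 : Type*} [LieRing 𝔤] [LieAlgebra K 𝔤] (x y : 𝔤) :
    ceD K 𝔤 (ι K x * ι K y) = ι K ⁅x, y⁆ := by
  rw [ceD_ι_mul, extDer_ι, ceD_ι, mul_zero, sub_zero, LieAlgebra.ad_apply]

variable (K D) in
/-- The map `a ↦ f(a)` from `J(D)` to the exterior algebra. -/
def lowMap : FreeJordanAlg K D →ₗ[K] ExteriorAlgebra K (TAG K (FreeJordanAlg K D)) :=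
  ι K ∘ₗ tagSMap K _ (sl2Basis K 2)

theorem lowMap_apply (a : FreeJordanAlg K D) : lowMap K D a = ι K (tagS (sl2Basis K 2) a) := rfl

theorem tagLowest_one_one_le (m : Fin D →₀ ℕ) :
    tagLowest K D 1 1 m ≤ (jPiece K m).map (lowMap K D) := by
  refine inf_le_left.trans (extPiece_le fun s hs hs' => ?_)
  obtain ⟨i, rfl⟩ := Finset.card_eq_one.1 hs
  rw [Finset.sum_singleton] at hs'
  rw [extBasis_singleton]
  rcases i with i | ⟨t, i⟩
  · rw [tagWt_inl] at hs'
    exact absurd (congrArg Prod.snd hs') (by norm_num)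
  · rw [tagWt_inr] at hs'
    have h1 : i.1 = m := congrArg Prod.fst hs'
    have h2 : sl2Wt t = -1 := congrArg Prod.snd hs'
    have ht : t = 2 := by
      revert h2
      fin_cases t <;> simp [sl2Wt]
    rw [tagBasis_inr, ht]
    exact ⟨_, h1 ▸ jBasis_mem i, rfl⟩

theorem lowMap_mem {m : Fin D →₀ ℕ} {a : FreeJordanAlg K D} (ha : a ∈ jPiece K m) :
    lowMap K D a ∈ tagLowest K D 1 1 m := by
  refine ⟨ι_mem (tagS_mem_piece (sl2Basis_mem 2) ha), ?_⟩
  rw [SetLike.mem_coe, LinearMap.mem_ker, lowMap_apply, extAct, extDer_ι, LieDerivation.coeFn_coe,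
    sl2Der_tagS, lie_self, ← tagSMap_apply, map_zero, LinearMap.zero_apply, map_zero]

theorem lowMap_mul_mem {p q : Fin D →₀ ℕ} {a b : FreeJordanAlg K D} (ha : a ∈ jPiece K p)
    (hb : b ∈ jPiece K q) :
    lowMap K D (a * b) ∈ (tagLowest K D 1 2 (p + q)).map (ceD K _) := by
  have hfh : ⁅sl2Basis K 2, sl2Basis K 0⁆ = (2 : K) • sl2Basis K 2 := by
    rw [← lie_skew, sl2_lie_h_f, neg_smul, neg_neg]
  -- Under f both terms yield 2 f(a) ∧ f(b), with opposite signs, so u is of lowest weight. Under d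
  -- they add up: each contributes -2 f(ab).
  set u := ι K (tagS (sl2Basis K 0) a) * ι K (tagS (sl2Basis K 2) b)
    - ι K (tagS (sl2Basis K 2) a) * ι K (tagS (sl2Basis K 0) b) with hu
  have hκ : kappa K (sl2Basis K 0) (sl2Basis K 2) = 0 :=
    kappa_eq_zero (sl2Basis_mem 0) (sl2Basis_mem 2) (by decide)
  have hd : ceD K _ u = (-4 : K) • lowMap K D (a * b) := by
    rw [hu, map_sub, ceD_ι_mul_ι, ceD_ι_mul_ι, lie_tagS_tagS, lie_tagS_tagS, kappa_comm K _ (sl2Basis K 0),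
      hκ, zero_smul, add_zero, add_zero, hfh, sl2_lie_h_f, ← tagSMap_apply, ← tagSMap_apply,
      map_smul, map_smul, LinearMap.smul_apply, LinearMap.smul_apply, map_smul, map_smul, lowMap_apply,
      tagSMap_apply]
    module
  have hmem : u ∈ tagLowest K D 1 2 (p + q) := by
    refine ⟨sub_mem ?_ ?_, ?_⟩
    · have := ι_mul_mem (tagS_mem_piece (sl2Basis_mem 0) ha)
        (ι_mem (tagS_mem_piece (sl2Basis_mem 2) hb))
      exact this
    · have := ι_mul_mem (tagS_mem_piece (sl2Basis_mem 2) ha)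
        (ι_mem (tagS_mem_piece (sl2Basis_mem 0) hb))
      exact this
    · rw [SetLike.mem_coe, LinearMap.mem_ker, hu, map_sub, extAct, extDer_ι_mul, extDer_ι_mul, extDer_ι,
        extDer_ι]
      simp only [LieDerivation.coeFn_coe, sl2Der_tagS, lie_self, hfh]
      simp only [← tagSMap_apply, map_zero, LinearMap.zero_apply,
        map_smul, LinearMap.smul_apply, zero_mul, mul_zero, add_zero, zero_add, smul_mul_assoc,
        mul_smul_comm, sub_self]
  have := Submodule.smul_mem _ (-4 : K)⁻¹ (Submodule.mem_map_of_mem (f := ceD K _) hmem)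
  rwa [hd, inv_smul_smul₀ (by norm_num)] at this

theorem lowMap_injective : Function.Injective (lowMap K D) := by
  -- A left inverse of a ↦ f(a): the coordinate along f in the tensor factor sl₂.
  let π : TAG K (FreeJordanAlg K D) →ₗ[K] FreeJordanAlg K D :=
    (TensorProduct.lid K _).toLinearMap ∘ₗ LinearMap.rTensor _ ((sl2Basis K).coord 2) ∘ₗ
      LinearMap.snd K (BSpace K (FreeJordanAlg K D)) (Sl2 K ⊗[K] FreeJordanAlg K D)
  have hπ : ∀ a, π (tagS (sl2Basis K 2) a) = a := fun a => by
    change TensorProduct.lid K _ (LinearMap.rTensor _ ((sl2Basis K).coord 2)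
      (sl2Basis K 2 ⊗ₜ[K] a)) = a
    simp
  intro a b hab
  rw [lowMap_apply, lowMap_apply] at hab
  have := congrArg π ((ι_inj K _ _).1 hab)
  rwa [hπ, hπ] at this

theorem finrank_tagLowest_one_one (m : Fin D →₀ ℕ) :
    Module.finrank K (tagLowest K D 1 1 m) = Module.finrank K (jPiece K m) := by
  rw [le_antisymm (tagLowest_one_one_le m) (Submodule.map_le_iff_le_comap.2 fun _ => lowMap_mem)]
  exact (Submodule.equivMapOfInjective _ lowMap_injective _).finrank_eq.symm

theorem map_ceD_tagLowest_le (n : ℕ) (m : Fin D →₀ ℕ) :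
    (tagLowest K D n 2 m).map (ceD K _) ≤ tagLowest K D n 1 m :=
  Submodule.map_le_iff_le_comap.2 fun _ hu => (isSl2Graded K D).ceD_mem_lowest hu

/-- When m is not the degree of a generator, every element of J_m is a sum of products, and f(ab) is
a boundary. -/
theorem map_ceD_tagLowest_eq {m : Fin D →₀ ℕ} (hm : ∀ i, Finsupp.single i 1 ≠ m) :
    (tagLowest K D 1 2 m).map (ceD K _) = tagLowest K D 1 1 m := by
  refine le_antisymm (map_ceD_tagLowest_le 1 m) ((tagLowest_one_one_le m).trans ?_)
  rw [Submodule.map_le_iff_le_comap]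
  refine (jPiece_le m).trans (sup_le ?_ ?_)
  · rw [Submodule.span_le]
    rintro _ ⟨i, hi, rfl⟩
    exact absurd hi (hm i)
  · refine iSup₂_le fun x hx => Submodule.map₂_le.2 fun a ha b hb => ?_
    rw [← Finset.HasAntidiagonal.mem_antidiagonal.1 (Finset.mem_filter.1 hx).1]
    exact lowMap_mul_mem ha hb

/-- A product of two monomials has total degree at least 2, so only the generator itself remains. -/
theorem finrank_jPiece_single (i : Fin D) :
    Module.finrank K (jPiece K (Finsupp.single i 1)) = 1 := by
  have h : jPiece K (Finsupp.single i 1) = Submodule.span K {gen K D i} := by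
    refine le_antisymm ((jPiece_le _).trans (sup_le ?_ ?_)) ?_
    · refine Submodule.span_mono ?_
      rintro _ ⟨j, hj, rfl⟩
      rw [Finsupp.single_left_injective one_ne_zero hj]
      rfl
    · refine iSup₂_le fun x hx => ?_
      rw [Finset.mem_filter, Finset.HasAntidiagonal.mem_antidiagonal] at hx
      exfalso
      have h1 := congrArg Finsupp.degree hx.1
      rw [map_add, Finsupp.degree_single] at h1
      have h2 := mt (Finsupp.degree_eq_zero_iff x.1).1 hx.2.1
      have h3 := mt (Finsupp.degree_eq_zero_iff x.2).1 hx.2.2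
      omega
    · rw [Submodule.span_singleton_le_iff_mem]
      exact gen_mem_jPiece i
  rw [h, finrank_span_singleton (gen_ne_zero i)]

/-! ### The main theorem -/

/-- Here the homology in degree 1 vanishes too: every element of Λ¹ of degree m ≠ 0 is a cycle, so
the hypothesis with k = 1 makes the invariant ones boundaries. -/
theorem mult_zero_coeff_lam
    (htriv : ∀ k, 1 ≤ k → trivialPart K (FreeJordanAlg K D) k = ⊥) {m : Fin D →₀ ℕ} (hm : m ≠ 0) :
    mult 0 (MvPowerSeries.coeff m (lam (tagClass (jSeries K D) (bSeries K D)))) = 0 := by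
  have G := isSl2Graded K D
  rw [mult_coeff_lam, G.sum_alternating_lowest hm fun k hk w hw hd =>
    exists_tagLowest_zero (htriv k (by omega)) hw hd, sub_eq_zero]
  suffices h : (tagLowest K D 0 2 m).map (ceD K _) = tagLowest K D 0 1 m by rw [h]
  refine le_antisymm (map_ceD_tagLowest_le 0 m) fun w hw => ?_
  have h0 := G.ceD_mem_lowest hw
  rw [IsSl2Graded.lowest_zero_eq_bot hm, Submodule.mem_bot] at h0
  exact exists_tagLowest_zero (htriv 1 le_rfl) hw h0

theorem mult_one_coeff_lam
    (hadj : ∀ k, 2 ≤ k → adjointPart K (FreeJordanAlg K D) k = ⊥) {m : Fin D →₀ ℕ} (hm : m ≠ 0) :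
    mult 1 (MvPowerSeries.coeff m (lam (tagClass (jSeries K D) (bSeries K D))))
      = MvPowerSeries.coeff m (- ∑ i, MvPowerSeries.X i) := by
  classical
  have G := isSl2Graded K D
  rw [mult_coeff_lam, G.sum_alternating_lowest hm fun k hk w hw hd =>
    exists_tagLowest_one (hadj k hk) hw hd, map_neg, map_sum]
  simp only [MvPowerSeries.coeff_X]
  by_cases h : ∃ i, Finsupp.single i 1 = m
  · obtain ⟨i, rfl⟩ := h
    -- In the degree of a generator Λ² is zero, so the Euler characteristic is minus the dimension 1
    -- of that component of J(D).
    rw [G.lowest_eq_bot_of_degree (by simp), Submodule.map_bot, finrank_bot,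
      finrank_tagLowest_one_one, finrank_jPiece_single]
    simp [Finsupp.single_left_inj]
  · push Not at h
    rw [map_ceD_tagLowest_eq h, sub_self, Finset.sum_eq_zero, neg_zero]
    exact fun i _ => if_neg (h i).symm

theorem isCombiPair_series
    (htriv : ∀ k, 1 ≤ k → trivialPart K (FreeJordanAlg K D) k = ⊥)
    (hadj : ∀ k, 2 ≤ k → adjointPart K (FreeJordanAlg K D) k = ⊥) :
    IsCombiPair (jSeries K D) (bSeries K D) := by
  classical
  refine ⟨?_, ?_, ?_, ?_⟩
  · rw [← MvPowerSeries.coeff_zero_eq_constantCoeff_apply]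
    change (Module.finrank K (jPiece K 0) : ℤ) = 0
    rw [jPiece_zero, finrank_bot, Nat.cast_zero]
  · rw [← MvPowerSeries.coeff_zero_eq_constantCoeff_apply]
    change (Module.finrank K (bPiece K 0) : ℤ) = 0
    rw [bPiece_zero, finrank_bot, Nat.cast_zero]
  · ext m
    change mult 0 (MvPowerSeries.coeff m _) = _
    by_cases hm : m = 0
    · subst hm
      rw [coeff_lam_zero]
      simp [mult, ← LaurentPolynomial.T_zero]
    · rw [mult_zero_coeff_lam htriv hm, MvPowerSeries.coeff_one, if_neg hm]
  · ext m
    change mult 1 (MvPowerSeries.coeff m _) = _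
    by_cases hm : m = 0
    · subst hm
      rw [coeff_lam_zero]
      simp [mult, ← LaurentPolynomial.T_zero]
    · exact mult_one_coeff_lam hadj hm

end Vanishing

end FreeJordan

end

theorem mainTheorem3 (K : Type*) [Field K] [CharZero K] (D : ℕ) (hD : 1 ≤ D)
    (htriv : ∀ k : ℕ, 1 ≤ k → FreeJordan.trivialPart K (FreeJordan.FreeJordanAlg K D) k = ⊥)
    (hadj : ∀ k : ℕ, 2 ≤ k → FreeJordan.adjointPart K (FreeJordan.FreeJordanAlg K D) k = ⊥) :
    (∀ m : Fin D →₀ ℕ,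
      Module.Finite K (FreeJordan.weightSpace (FreeJordan.repJ K D) m) ∧
      Module.Finite K (FreeJordan.weightSpace (FreeJordan.repInner K D) m)) ∧
    FreeJordan.gradedClass (FreeJordan.repJ K D) = FreeJordan.classA D ∧
    FreeJordan.gradedClass (FreeJordan.repInner K D) = FreeJordan.classB D := by
  obtain ⟨hA, hB⟩ := (FreeJordan.isCombiPair_iff _ _).1 (FreeJordan.isCombiPair_series htriv hadj)
  refine ⟨fun m => ⟨?_, ?_⟩, ?_, ?_⟩
  · rw [FreeJordan.weightSpace_repJ]
    infer_instance
  · rw [FreeJordan.weightSpace_repInner]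
    infer_instance
  · rw [← hA]
    funext m
    exact congrArg (fun N : Submodule K _ => (Module.finrank K N : ℤ))
      (FreeJordan.weightSpace_repJ m)
  -- The second series counts 𝓑J(D); injectivity of {ω} ↦ ∂_ω in each multidegree turns it into the
  -- series of Inner J(D).
  · rw [← hB]
    funext m
    exact congrArg Nat.cast (FreeJordan.finrank_weightSpace_repInner htriv m)
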